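/- **Setting.** Let $\Omega\subset\mathbb R^2$ be an open rectangle with sides parallel to the axes and let $\Gamma$ be a smooth curve (a simple closed curve in $\Omega$, or a simple arc in $\Omega$ with its end points on $\partial\Omega$) that separates $\Omega$ into disjoint open parts $\Omega_+$ and $\Omega_-$; let $\mathbf n$ be the unit normal of $\Gamma$ pointing from $\Omega_-$ to $\Omega_+$. Let $\alpha=\alpha_\pm$ on $\Omega_\pm$ with constants $\alpha_\pm\ge\alpha_0>0$. For a pair $v=(v_+,v_-)$ with $v_\pm$ defined on $\Omega_\pm$ put $\llbracket v\rrbracket=v_+-v_-$ on $\Gamma$. The interface problem is $$-\nabla\cdot(\alpha\nabla u)=f\ \text{ in }\Omega_-\cup\Omega_+,\qquad \llbracket u\rrbracket=0,\quad \llbracket\alpha\,\partial_{\mathbf n}u\rrbracket=0\ \text{ on }\Gamma,$$ where the equation holds almost everywhere and the jump conditions hold for the traces in $L^2(\Gamma)$ of $u_\pm$ and $\nabla u_\pm$. Let $\mathcal T_h$ be a finite partition of $\overline\Omega$ into closed axis-parallel rectangles $K$ such that $\Gamma$ meets the boundary of each $K$ in finitely many points; let $h_K$ be the longest edge length of $K$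 and $h=\max_K h_K$. Put $\mathcal T_{\Gamma,h}=\{K:K\cap\Gamma\ne\emptyset\}$, $\mathcal T_{\pm,h}=\{K:K\cap\Omega_\pm\neq\emptyset\}$, $\Omega_{\pm,h}=\bigcup_{K\in\mathcal T_{\pm,h}}K$, $K_\pm=K\cap\Omega_\pm$, $\Gamma_K=K\cap\Gamma$, and let $\mathcal G_{\pm,h}$ be the set of the faces $K\cap K'$ with $K\ne K'$, $K\in\mathcal T_{\Gamma,h}\cap\mathcal T_{\pm,h}$, $K'\in\mathcal T_{\pm,h}$. Let $p\ge1$. Let $V^{p,h}$ be the set of pairs $v=(v_+,v_-)$ with $v_\pm\in C^0(\Omega_{\pm,h})$ and $v_\pm|_K\in\mathbb Q_p(K)$ (polynomials of degree at most $p$ in each variable) for $K\in\mathcal T_{\pm,h}$, and $V^{p,h}_0$ the set of $v\in V^{p,h}$ that vanish on $\partial\Omega$, that is, $v_\pm=0$ on $\partial\Omega\cap\overline{\Omega_\pm}$. On $\Gamma_K$ let $$\kappa_+=\tfrac{\alpha_-|K_+|}{\alpha_-|K_+|+\alpha_+|K_-|},\quad \kappa_-=\tfrac{\alpha_+|K_-|}{\alpha_-|K_+|+\alpha_+|K_-|},\quad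 \gamma=\tfrac{2h_K|\Gamma_K|}{|K_+|/\alpha_++|K_-|/\alpha_-},$$ and $\{\!\{\alpha\partial_{\mathbf n}v\}\!\}=\kappa_+\alpha_+\partial_{\mathbf n}v_++\kappa_-\alpha_-\partial_{\mathbf n}v_-$. Define $$a_{p,h}(v,w)=\sum_{i=\pm}(\alpha_i\nabla v_i,\nabla w_i)_{\Omega_i}+\langle\llbracket v\rrbracket,\{\!\{\alpha\partial_{\mathbf n}w\}\!\}\rangle_\Gamma+\langle\{\!\{\alpha\partial_{\mathbf n}v\}\!\},\llbracket w\rrbracket\rangle_\Gamma+\frac{p^2}{h}\langle\gamma\llbracket v\rrbracket,\llbracket w\rrbracket\rangle_\Gamma,$$ with $\langle\cdot,\cdot\rangle_\Gamma=\sum_{K\in\mathcal T_{\Gamma,h}}\langle\cdot,\cdot\rangle_{\Gamma_K}$ and traces on $\Gamma_K$ taken from $K_\pm$, the ghost penalty $$g_{p,h}(v,w)=\sum_{i=\pm}\sum_{e\in\mathcal G_{i,h}}\sum_{j=0}^p\frac{h^{2j+1}}{p^{2j}}\big([\partial_{\mathbf n}^jv_i],[\partial_{\mathbf n}^jw_i]\big)_e$$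 ($[\cdot]$ is the jump across $e$ and $\partial_{\mathbf n}$ the derivative normal to $e$), $l_{p,h}(v)=\sum_{i=\pm}(f,v_i)_{\Omega_i}$, and, for a real parameter $\gamma_A$, $A_{p,h}=a_{p,h}+\gamma_Ah^{-2}g_{p,h}$. **Theorem.** Let $u=(u_+,u_-)$ with $u_\pm\in H^{p+1}(\Omega_\pm)$ solve the interface problem, and let $u^{p,h}\in V_0^{p,h}$ be a discrete solution: $A_{p,h}(u^{p,h},v)=l_{p,h}(v)$ for all $v\in V_0^{p,h}$. Then $$a_{p,h}(u-u^{p,h},v)=\frac{\gamma_A}{h^2}\,g_{p,h}(u^{p,h},v)\qquad\text{for all }v\in V_0^{p,h};$$ in particular, for $\gamma_A=1$ the right-hand side is $h^{-2}g_{p,h}(u^{p,h},v)$. -/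

import Mathlib

open MeasureTheory Set Filter Topology
open scoped ContDiff ENNReal

noncomputable section

namespace USEM

/-- The Euclidean plane. -/
abbrev Plane := EuclideanSpace ℝ (Fin 2)

/-- The two sides of the interface. -/
abbrev Side := Bool

/-- The side `+`. -/
abbrev plus : Side := true

/-- The side `-`. -/
abbrev minus : Side := false

/-- The vector of the standard basis in direction `k`. -/
def basisVec (k : Fin 2) : Plane := EuclideanSpace.single k 1

/-- The classical partial derivative `∂_k φ`. -/
def partialDeriv (k : Fin 2) (φ : Plane → ℝ) (x : Plane) : ℝ :=
  fderiv ℝ φ x (basisVec k)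

/-! ### Weak derivatives and Sobolev spaces -/

/-- `φ ∈ C_c^∞(D)`. -/
def IsTestFunction (D : Set Plane) (φ : Plane → ℝ) : Prop :=
  ContDiff ℝ ∞ φ ∧ HasCompactSupport φ ∧ tsupport φ ⊆ D

/-- `g` is the weak derivative `∂_k w` on the open set `D`. -/
def HasWeakPartial (D : Set Plane) (k : Fin 2) (w g : Plane → ℝ) : Prop :=
  LocallyIntegrableOn w D volume ∧ LocallyIntegrableOn g D volume ∧
    ∀ φ : Plane → ℝ, IsTestFunction D φ →
      ∫ x in D, w x * partialDeriv k φ x = - ∫ x in D, g x * φ x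

open Classical in
/-- A representative of the weak derivative `∂_k w` on `D` (zero if there is none). -/
def weakPartial (D : Set Plane) (k : Fin 2) (w : Plane → ℝ) : Plane → ℝ :=
  if h : ∃ g, HasWeakPartial D k w g then h.choose else 0

/-- `w ∈ H^m(D)`: the function `w` and its weak derivatives up to order `m` are in `L²(D)`. -/
def MemSobolev (D : Set Plane) : ℕ → (Plane → ℝ) → Prop
  | 0, w => MemLp w 2 (volume.restrict D)
  | m + 1, w => MemLp w 2 (volume.restrict D) ∧
      ∀ k, ∃ g, HasWeakPartial D k w g ∧ MemSobolev D m g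

/-- The weak divergence `∇ · X` on `D` of a vector field `X` with components `X k`. -/
def weakDiv (D : Set Plane) (X : Fin 2 → Plane → ℝ) (x : Plane) : ℝ :=
  ∑ k, weakPartial D k (X k) x

/-- `g ∈ L²(ν)` is the trace of `w ∈ H¹(D)`, where `ν` is the arc length measure on a piece of a
curve in the closure of `D`: some sequence of functions that are smooth on the whole plane converges
to `w` in `H¹(D)`, while its restrictions to the curve converge to `g` in `L²(ν)`. -/
def IsTrace (D : Set Plane) (ν : Measure Plane) (w g : Plane → ℝ) : Prop :=
  MemSobolev D 1 w ∧ MemLp g 2 ν ∧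
    ∃ φ : ℕ → Plane → ℝ, (∀ m, ContDiff ℝ ∞ (φ m)) ∧
      Tendsto (fun m => eLpNorm (fun x => φ m x - w x) 2 (volume.restrict D)) atTop (𝓝 0) ∧
      (∀ k, Tendsto
        (fun m => eLpNorm (fun x => partialDeriv k (φ m) x - weakPartial D k w x) 2
          (volume.restrict D)) atTop (𝓝 0)) ∧
      Tendsto (fun m => eLpNorm (fun x => φ m x - g x) 2 ν) atTop (𝓝 0)

open Classical in
/-- A representative of the trace of `w` (zero if there is none). -/
def trace (D : Set Plane) (ν : Measure Plane) (w : Plane → ℝ) : Plane → ℝ :=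
  if h : ∃ g, IsTrace D ν w g then h.choose else 0

/-! ### Rectangles and the interface -/

/-- A nondegenerate rectangle with sides parallel to the axes. -/
@[ext]
structure Rect where
  lo : Fin 2 → ℝ
  hi : Fin 2 → ℝ
  lo_lt_hi : ∀ k, lo k < hi k

namespace Rect

/-- The closed rectangle. -/
def closed (K : Rect) : Set Plane := {x | ∀ k, K.lo k ≤ x k ∧ x k ≤ K.hi k}

/-- The open rectangle. -/
def inner (K : Rect) : Set Plane := {x | ∀ k, K.lo k < x k ∧ x k < K.hi k}

/-- The boundary of the rectangle. -/
def bdry (K : Rect) : Set Plane := K.closed \ K.inner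

/-- The length `h_K` of the longest edge. -/
def size (K : Rect) : ℝ := max (K.hi 0 - K.lo 0) (K.hi 1 - K.lo 1)

end Rect

/-- Rotation by a quarter turn, counterclockwise. -/
def rot (v : Plane) : Plane := !₂[-(v 1), v 0]

/-- A smooth curve `Γ` that separates the open rectangle `Ω = Q.inner` into the disjoint open parts
`Ω₊ = part plus` and `Ω₋ = part minus`. The curve is given by a regular smooth parametrization on
`[0, 1]`, directed so that `Ω₊` lies on its left. It is either a simple closed curve in `Ω`, or a
simple arc in `Ω` with its two end points on `∂Ω`. -/
structure Interface (Q : Rect) where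
  curve : ℝ → Plane
  smooth : ContDiff ℝ ∞ curve
  regular : ∀ t ∈ Icc (0 : ℝ) 1, deriv curve t ≠ 0
  closed_or_arc :
    (Function.Periodic curve 1 ∧ InjOn curve (Ico 0 1) ∧ ∀ t ∈ Icc (0 : ℝ) 1, curve t ∈ Q.inner) ∨
    (InjOn curve (Icc 0 1) ∧ (∀ t ∈ Ioo (0 : ℝ) 1, curve t ∈ Q.inner) ∧
      curve 0 ∈ Q.bdry ∧ curve 1 ∈ Q.bdry)
  part : Side → Set Plane
  isOpen_part : ∀ i, IsOpen (part i)
  disjoint_part : Disjoint (part plus) (part minus)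
  part_union : part plus ∪ part minus = Q.inner \ curve '' Icc 0 1
  normal : Plane → Plane
  normal_eq : ∀ t ∈ Icc (0 : ℝ) 1,
    normal (curve t) = ‖deriv curve t‖⁻¹ • rot (deriv curve t)
  normal_side : ∀ t ∈ Icc (0 : ℝ) 1, curve t ∈ Q.inner → ∀ᶠ s in 𝓝[>] (0 : ℝ),
    curve t + s • normal (curve t) ∈ part plus ∧ curve t - s • normal (curve t) ∈ part minus

namespace Interface

variable {Q : Rect}

/-- The set `Γ`. -/
def carrier (I : Interface Q) : Set Plane := I.curve '' Icc 0 1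

/-- The arc length measure on `Γ`. -/
def arcLength (I : Interface Q) : Measure Plane :=
  ((volume.restrict (Icc (0 : ℝ) 1)).withDensity
    (fun t => ENNReal.ofReal ‖deriv I.curve t‖)).map I.curve

end Interface

/-- `u = (u₊, u₋)` solves the interface problem
`-∇ · (α ∇u) = f` in `Ω₋ ∪ Ω₊`, `⟦u⟧ = 0` and `⟦α ∂_n u⟧ = 0` on `Γ`:
the equation holds almost everywhere, with weak derivatives, and the two jump conditions hold for
the traces on `Γ` of `u±` and of `∇u±`. -/
def SolvesInterfaceProblem {Q : Rect} (I : Interface Q) (α : Side → ℝ) (f : Plane → ℝ)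
    (u : Side → Plane → ℝ) : Prop :=
  (∀ i, ∀ᵐ x ∂(volume.restrict (I.part i)),
    - weakDiv (I.part i) (fun k y => α i * weakPartial (I.part i) k (u i) y) x = f x) ∧
  (∃ g : Side → Plane → ℝ, (∀ i, IsTrace (I.part i) I.arcLength (u i) (g i)) ∧
    ∀ᵐ x ∂I.arcLength, g plus x - g minus x = 0) ∧
  (∃ q : Side → Fin 2 → Plane → ℝ,
    (∀ i k, IsTrace (I.part i) I.arcLength (weakPartial (I.part i) k (u i)) (q i k)) ∧
    ∀ᵐ x ∂I.arcLength,
      α plus * ∑ k, q plus k x * I.normal x k - α minus * ∑ k, q minus k x * I.normal x k = 0)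

/-! ### The mesh and the discrete space -/

/-- A partition of the closed rectangle into finitely many rectangles. -/
structure Mesh (Q : Rect) where
  elems : Finset Rect
  iUnion_eq : ⋃ K ∈ elems, K.closed = Q.closed
  disjoint_inner : ∀ K ∈ elems, ∀ K' ∈ elems, K ≠ K' → Disjoint K.inner K'.inner

namespace Mesh

variable {Q : Rect} (T : Mesh Q) (I : Interface Q)

/-- The mesh size `h`. -/
def h : ℝ := sSup (Rect.size '' (T.elems : Set Rect))

open Classical in
/-- The interface elements, `𝒯_{Γ,h}`. -/
def interfaceElems : Finset Rect :=
  {K ∈ T.elems | (K.closed ∩ I.carrier).Nonempty}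

open Classical in
/-- The elements that meet `Ω_i`, `𝒯_{i,h}`. -/
def sideElems (i : Side) : Finset Rect :=
  {K ∈ T.elems | (K.closed ∩ I.part i).Nonempty}

/-- The fictitious domain `Ω_{i,h}`. -/
def fictDomain (i : Side) : Set Plane := ⋃ K ∈ T.sideElems I i, K.closed

/-- The ghost faces `𝒢_{i,h}`: the intersections `K ∩ K'` of two different elements of `𝒯_{i,h}`,
the first of which is an interface element. -/
def ghostFaces (i : Side) : Set (Set Plane) :=
  {e | ∃ K ∈ T.interfaceElems I, ∃ K' ∈ T.sideElems I i,
    K ∈ T.sideElems I i ∧ K ≠ K' ∧ e = K.closed ∩ K'.closed}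

end Mesh

/-- `ℚ_p`: the polynomials of degree at most `p` in each of the two variables. -/
def IsQp (p : ℕ) (q : Plane → ℝ) : Prop :=
  ∃ a : Fin (p + 1) → Fin (p + 1) → ℝ,
    ∀ x, q x = ∑ i, ∑ j, a i j * x 0 ^ (i : ℕ) * x 1 ^ (j : ℕ)

/-- The space `V^{p,h} = V₊^{p,h} ⊕ V₋^{p,h}`, as the set of pairs `(v₊, v₋)` with `v_i` continuous
on `Ω_{i,h}` and in `ℚ_p(K)` on each `K ∈ 𝒯_{i,h}`. (Values of `v_i` outside `Ω_{i,h}` play no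
role.) -/
def discreteSpace {Q : Rect} (T : Mesh Q) (I : Interface Q) (p : ℕ) : Set (Side → Plane → ℝ) :=
  {v | ∀ i, ContinuousOn (v i) (T.fictDomain I i) ∧
    ∀ K ∈ T.sideElems I i, ∃ q, IsQp p q ∧ EqOn (v i) q K.closed}

/-- The space `V₀^{p,h}` of the `v ∈ V^{p,h}` that vanish on `∂Ω`: each `v_i` is zero on the part
of `∂Ω` that belongs to the closure of `Ω_i`. -/
def discreteSpace₀ {Q : Rect} (T : Mesh Q) (I : Interface Q) (p : ℕ) : Set (Side → Plane → ℝ) :=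
  {v | v ∈ discreteSpace T I p ∧ ∀ i, ∀ x ∈ Q.bdry ∩ closure (I.part i), v i x = 0}

/-! ### The forms -/

section Forms

variable {Q : Rect} (I : Interface Q) (α : Side → ℝ)

/-- The area `|K_i|` of `K_i = K ∩ Ω_i`. -/
def cutArea (K : Rect) (i : Side) : ℝ := volume.real (K.closed ∩ I.part i)

/-- The weights: `κ₊ = α₋|K₊| / (α₋|K₊| + α₊|K₋|)` and `κ₋ = α₊|K₋| / (α₋|K₊| + α₊|K₋|)`. -/
def kappa (K : Rect) (i : Side) : ℝ :=
  α (!i) * cutArea I K i / (α minus * cutArea I K plus + α plus * cutArea I K minus)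

/-- The penalty parameter `γ|_K = 2 h_K |Γ_K| / (|K₊|/α₊ + |K₋|/α₋)`. -/
def gammaPen (K : Rect) : ℝ :=
  2 * K.size * I.arcLength.real K.closed /
    (cutArea I K plus / α plus + cutArea I K minus / α minus)

/-- The trace on `Γ_K = Γ ∩ K`, taken from `K ∩ Ω_i`, of a function on `Ω_i`. -/
def traceOn (K : Rect) (i : Side) (w : Plane → ℝ) : Plane → ℝ :=
  trace (K.inner ∩ I.part i) (I.arcLength.restrict K.closed) w

/-- The jump `⟦v⟧ = v₊ - v₋` on `Γ_K`. -/
def jump (K : Rect) (v : Side → Plane → ℝ) (x : Plane) : ℝ :=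
  traceOn I K plus (v plus) x - traceOn I K minus (v minus) x

/-- The normal derivative `∂_n v_i` on `Γ_K`. -/
def normalDer (K : Rect) (i : Side) (v : Side → Plane → ℝ) (x : Plane) : ℝ :=
  ∑ k, traceOn I K i (weakPartial (I.part i) k (v i)) x * I.normal x k

/-- The weighted average `{{α ∂_n v}} = κ₊ α₊ ∂_n v₊ + κ₋ α₋ ∂_n v₋` on `Γ_K`. -/
def avgFlux (K : Rect) (v : Side → Plane → ℝ) (x : Plane) : ℝ :=
  ∑ i, kappa I α K i * (α i * normalDer I K i v x)

variable (T : Mesh Q) (p : ℕ)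

/-- The bilinear form `a_{p,h}(v, w)`. The inner products on `Γ` are sums over the interface
elements of inner products on `Γ_K`. -/
def aForm (v w : Side → Plane → ℝ) : ℝ :=
  (∑ i, ∫ x in I.part i, ∑ k,
    α i * weakPartial (I.part i) k (v i) x * weakPartial (I.part i) k (w i) x) +
  (∑ K ∈ T.interfaceElems I, ∫ x in K.closed, jump I K v x * avgFlux I α K w x ∂I.arcLength) +
  (∑ K ∈ T.interfaceElems I, ∫ x in K.closed, avgFlux I α K v x * jump I K w x ∂I.arcLength) +
  (p : ℝ) ^ 2 / T.h *
    ∑ K ∈ T.interfaceElems I,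
      ∫ x in K.closed, gammaPen I α K * jump I K v x * jump I K w x ∂I.arcLength

open Classical in
/-- A unit normal vector of a mesh face, which is a segment parallel to one of the axes. -/
def faceNormal (e : Set Plane) : Plane :=
  if ∀ x ∈ e, ∀ y ∈ e, x 0 = y 0 then basisVec 0 else basisVec 1

/-- The derivative `∂_n^j w` in the direction `n`. -/
def dirDeriv (j : ℕ) (n : Plane) (w : Plane → ℝ) (y : Plane) : ℝ :=
  iteratedDeriv j (fun s : ℝ => w (y + s • n)) 0

/-- The jump `[w](x) = lim_{t → 0+} w(x + t n) - lim_{t → 0+} w(x - t n)`. -/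
def faceJump (n : Plane) (w : Plane → ℝ) (x : Plane) : ℝ :=
  limUnder (𝓝[>] (0 : ℝ)) (fun t => w (x + t • n)) -
    limUnder (𝓝[>] (0 : ℝ)) (fun t => w (x - t • n))

/-- The ghost penalty `g_{p,h}(v, w)`. -/
def ghostForm (v w : Side → Plane → ℝ) : ℝ :=
  ∑ i, ∑ᶠ e ∈ T.ghostFaces I i, ∑ j ∈ Finset.range (p + 1),
    T.h ^ (2 * j + 1) / (p : ℝ) ^ (2 * j) *
      ∫ x in e, faceJump (faceNormal e) (dirDeriv j (faceNormal e) (v i)) x *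
        faceJump (faceNormal e) (dirDeriv j (faceNormal e) (w i)) x ∂(Measure.hausdorffMeasure 1)

/-- The extended form `A_{p,h} = a_{p,h} + (γ_A / h²) g_{p,h}`. -/
def extForm (γA : ℝ) (v w : Side → Plane → ℝ) : ℝ :=
  aForm I α T p v w + γA / T.h ^ 2 * ghostForm I T p v w

/-- The linear functional `l_{p,h}(v) = ∑_i (f, v_i)_{Ω_i}`. -/
def loadForm (f : Plane → ℝ) (v : Side → Plane → ℝ) : ℝ :=
  ∑ i, ∫ x in I.part i, f x * v i x

/-- `uh ∈ V₀^{p,h}` is the discrete solution: `A_{p,h}(uh, v) = l_{p,h}(v)` for `v ∈ V₀^{p,h}`. -/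
def IsDiscreteSolution (γA : ℝ) (f : Plane → ℝ) (uh : Side → Plane → ℝ) : Prop :=
  uh ∈ discreteSpace₀ T I p ∧
    ∀ v ∈ discreteSpace₀ T I p, extForm I α T p γA uh v = loadForm I f v

end Forms

end USEM

end

open MeasureTheory Set Filter Topology
open scoped ContDiff ENNReal

noncomputable section

namespace USEM

/-! ### Calculus in the plane -/

/-! The identity is consistency followed by a subtraction. Once $a(u,v)=l(v)$ is known for every
discrete $v$ that vanishes on $\partial\Omega$, subtracting $a(u_h,v)+\gamma_Ah^{-2}g(u_h,v)=l(v)$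
leaves exactly the ghost penalty.

Consistency (`aForm_eq_loadForm`) is integration by parts on each side. The equation turns the
volume terms into $l(v)$ minus the jump of $\alpha\partial_{\mathbf n}u\,v$ on Γ. The terms with
$\llbracket u\rrbracket$ vanish. Since the flux of $u$ is continuous and $\kappa_++\kappa_-=1$, its
weighted average is the common flux, and the remaining term on Γ cancels the boundary terms.

The first difficulty is Green's formula: nothing is known about the angle at which an arc meets ∂Ω,
and discrete functions have kinks on mesh lines. The divergence theorem is therefore proved only for
test functions in Ω (`integral_part_partialDeriv`), by straightening Γ locally and gluing with a
partition of unity. For a discrete $v_i$ and a smooth factor ψ (`greenDefect_eq_zero`), ψ is split.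
Near Γ and inside one element $v_i$ is a polynomial and the divergence theorem applies. If ψ
vanishes near Γ, the extension of $\psi v_i$ by zero is continuous, because $v_i=0$ on ∂Ω, and
differentiable off finitely many lines, so its derivatives integrate to zero. The finitely many
points where Γ meets element boundaries are removed by shrinking cutoffs. Density gives the formula
for $H^1$ functions with a trace (`integral_weakPartial_mul`).

The second difficulty is that the forms use representatives of traces, chosen on each $\Gamma_K$
separately. They are unique almost everywhere (`Interface.IsTrace.ae_eq_zero`), again by the
divergence theorem inside $K$. Hence they agree with the traces on Γ and depend linearly on the
function, which is what `aForm_sub` needs. -/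

/-- The point with coordinates `s` and `t`. -/
def pt (z : ℝ × ℝ) : Plane := !₂[z.1, z.2]

@[simp] lemma pt_zero (z : ℝ × ℝ) : pt z 0 = z.1 := rfl

@[simp] lemma pt_one (z : ℝ × ℝ) : pt z 1 = z.2 := rfl

lemma pt_coords (x : Plane) : pt (x 0, x 1) = x := by
  ext k; fin_cases k <;> rfl

@[simp] lemma basisVec_apply (k j : Fin 2) : basisVec k j = if j = k then 1 else 0 := by
  simp [basisVec]

lemma measurePreserving_pt : MeasurePreserving pt volume volume :=
  (PiLp.volume_preserving_toLp (Fin 2)).comp (volume_preserving_finTwoArrow ℝ).symm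

lemma measurableEmbedding_pt : MeasurableEmbedding pt :=
  ((MeasurableEquiv.finTwoArrow (α := ℝ)).symm.trans
    (MeasurableEquiv.toLp 2 (Fin 2 → ℝ))).measurableEmbedding

lemma continuous_pt : Continuous pt := by
  unfold pt
  fun_prop

lemma integral_eq_integral_pt {s : Set Plane} (g : Plane → ℝ) :
    ∫ x in s, g x = ∫ z in pt ⁻¹' s, g (pt z) :=
  (measurePreserving_pt.setIntegral_preimage_emb measurableEmbedding_pt g s).symm

lemma hasDerivAt_pt_left (s t : ℝ) : HasDerivAt (fun r => pt (r, t)) (basisVec 0) s := by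
  have h : (fun r => pt (r, t)) = fun r => pt (0, t) + r • basisVec 0 := by
    ext r k
    fin_cases k <;> simp
  rw [h]
  simpa using ((hasDerivAt_id s).smul_const (basisVec 0)).const_add (pt (0, t))

lemma hasDerivAt_pt_right (s t : ℝ) : HasDerivAt (fun r => pt (s, r)) (basisVec 1) t := by
  have h : (fun r => pt (s, r)) = fun r => pt (s, 0) + r • basisVec 1 := by
    ext r k
    fin_cases k <;> simp
  rw [h]
  simpa using ((hasDerivAt_id t).smul_const (basisVec 1)).const_add (pt (s, 0))

/-! ### Integrals of partial derivatives over the plane. -/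

lemma exists_bound_of_hasCompactSupport {w : Plane → ℝ} (hs : HasCompactSupport w) :
    ∃ R : ℝ, ∀ x k, R ≤ |x k| → x ∉ tsupport w := by
  obtain ⟨R, hR⟩ := hs.isBounded.exists_norm_le
  refine ⟨|R| + 1, fun x k hk hx => ?_⟩
  have h1 := hR x hx
  have h2 : ‖x k‖ ≤ ‖x‖ := PiLp.norm_apply_le x k
  rw [Real.norm_eq_abs] at h2
  linarith [le_abs_self R]

/-- The fundamental theorem of calculus on $[-R,R]$ tolerates countably many points where `W` is
merely continuous. These will be the crossings with mesh lines. -/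
lemma integral_eq_zero_of_hasDerivAt_off_countable {W g : ℝ → ℝ} {Z : Set ℝ} (hZ : Z.Countable)
    (hW : Continuous W) (hd : ∀ s, s ∉ Z → HasDerivAt W (g s) s) (hi : Integrable g)
    {R : ℝ} (hW0 : ∀ s, R ≤ |s| → W s = 0) (hg0 : ∀ s, R ≤ |s| → g s = 0) :
    ∫ s, g s = 0 := by
  have h1 : Function.support g ⊆ Ioc (-R) R := by
    intro s hs
    by_contra h
    refine hs (hg0 s ?_)
    by_contra h'
    rw [not_le, abs_lt] at h'
    exact h ⟨h'.1, h'.2.le⟩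
  rw [← intervalIntegral.integral_eq_integral_of_support_subset h1,
    integral_eq_of_hasDerivAt_off_countable W g hZ hW.continuousOn
      (fun x hx => hd x hx.2) hi.intervalIntegrable, hW0 R (le_abs_self R),
    hW0 (-R) (by rw [abs_neg]; exact le_abs_self R), sub_zero]

lemma partialDeriv_eq_zero_of_notMem_tsupport {w : Plane → ℝ} {x : Plane} (k : Fin 2)
    (hx : x ∉ tsupport w) : partialDeriv k w x = 0 := by
  have : fderiv ℝ w x = 0 := by
    by_contra h
    exact hx (support_fderiv_subset ℝ h)
  simp [partialDeriv, this]

/-- The integral of a partial derivative of a compactly supported continuous function which is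
differentiable off finitely many lines parallel to the axes. -/
theorem integral_partialDeriv_eq_zero (k : Fin 2) {w : Plane → ℝ} (hc : Continuous w)
    (hs : HasCompactSupport w) (Z : Finset ℝ)
    (hd : ∀ x : Plane, (∀ j, x j ∉ Z) → DifferentiableAt ℝ w x)
    (hi : Integrable (partialDeriv k w)) : ∫ x, partialDeriv k w x = 0 := by
  obtain ⟨R, hR0⟩ := exists_bound_of_hasCompactSupport hs
  have hi' : Integrable (fun z => partialDeriv k w (pt z)) (volume.prod volume) :=
    (measurePreserving_pt.integrable_comp_emb measurableEmbedding_pt).2 hi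
  have hZ : ∀ᵐ t : ℝ, t ∉ Z := by
    rw [ae_iff]
    simpa using Z.finite_toSet.measure_zero volume
  have h0 := integral_eq_integral_pt (s := univ) (partialDeriv k w)
  rw [preimage_univ, setIntegral_univ, setIntegral_univ] at h0
  rw [h0, Measure.volume_eq_prod]
  fin_cases k
  · rw [integral_prod_symm _ hi']
    refine integral_eq_zero_of_ae ?_
    -- For almost every `t` the horizontal line at height `t` is not exceptional, so on it
    -- differentiability fails only where `s ∈ Z`.
    filter_upwards [hZ, hi'.prod_left_ae] with t ht hti
    refine integral_eq_zero_of_hasDerivAt_off_countable (W := fun s => w (pt (s, t)))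
      (Z := Z) Z.countable_toSet (hc.comp (continuous_pt.comp (by fun_prop)))
      (fun s hs' => ?_) hti
      (fun s hs' => image_eq_zero_of_notMem_tsupport (hR0 _ 0 (by simpa using hs')))
      (fun s hs' => partialDeriv_eq_zero_of_notMem_tsupport _ (hR0 _ 0 (by simpa using hs')))
    have hdx := hd (pt (s, t)) (fun j => by fin_cases j; exacts [hs', ht])
    exact hdx.hasFDerivAt.comp_hasDerivAt s (hasDerivAt_pt_left s t)
  · rw [integral_prod _ hi']
    refine integral_eq_zero_of_ae ?_
    filter_upwards [hZ, hi'.prod_right_ae] with s ht hti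
    refine integral_eq_zero_of_hasDerivAt_off_countable (W := fun t => w (pt (s, t)))
      (Z := Z) Z.countable_toSet (hc.comp (continuous_pt.comp (by fun_prop)))
      (fun t hs' => ?_) hti
      (fun t hs' => image_eq_zero_of_notMem_tsupport (hR0 _ 1 (by simpa using hs')))
      (fun t hs' => partialDeriv_eq_zero_of_notMem_tsupport _ (hR0 _ 1 (by simpa using hs')))
    have hdx := hd (pt (s, t)) (fun j => by fin_cases j; exacts [ht, hs'])
    exact hdx.hasFDerivAt.comp_hasDerivAt t (hasDerivAt_pt_right s t)

/-! ### Rules for partial derivatives. -/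

lemma continuous_partialDeriv (k : Fin 2) {w : Plane → ℝ} (hw : ContDiff ℝ 1 w) :
    Continuous (partialDeriv k w) :=
  (hw.continuous_fderiv one_ne_zero).clm_apply continuous_const

lemma tsupport_partialDeriv_subset (k : Fin 2) (w : Plane → ℝ) :
    tsupport (partialDeriv k w) ⊆ tsupport w :=
  tsupport_fderiv_apply_subset ℝ (basisVec k)

lemma contDiff_partialDeriv (k : Fin 2) {w : Plane → ℝ} (hw : ContDiff ℝ ∞ w) :
    ContDiff ℝ ∞ (partialDeriv k w) :=
  (hw.fderiv_right (m := ∞) le_rfl).clm_apply contDiff_const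

lemma measurable_partialDeriv (k : Fin 2) (w : Plane → ℝ) : Measurable (partialDeriv k w) :=
  measurable_fderiv_apply_const ℝ w _

lemma partialDeriv_mul (k : Fin 2) {v w : Plane → ℝ} {x : Plane} (hv : DifferentiableAt ℝ v x)
    (hw : DifferentiableAt ℝ w x) : partialDeriv k (fun y => v y * w y) x =
      partialDeriv k v x * w x + v x * partialDeriv k w x := by
  simp only [partialDeriv]
  rw [fderiv_fun_mul hv hw]
  simp
  ring

lemma partialDeriv_sub (k : Fin 2) {v w : Plane → ℝ} {x : Plane} (hv : DifferentiableAt ℝ v x)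
    (hw : DifferentiableAt ℝ w x) : partialDeriv k (fun y => v y - w y) x =
      partialDeriv k v x - partialDeriv k w x := by
  simp only [partialDeriv]
  rw [fderiv_fun_sub hv hw]
  simp

lemma partialDeriv_congr (k : Fin 2) {v w : Plane → ℝ} {x : Plane} (h : v =ᶠ[𝓝 x] w) :
    partialDeriv k v x = partialDeriv k w x := by
  simp only [partialDeriv, h.fderiv_eq]

lemma integrable_partialDeriv (k : Fin 2) {w : Plane → ℝ} (hw : ContDiff ℝ 1 w)
    (hs : HasCompactSupport w) : Integrable (partialDeriv k w) :=
  (continuous_partialDeriv k hw).integrable_of_hasCompactSupport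
    (hs.of_isClosed_subset (isClosed_tsupport _) (tsupport_partialDeriv_subset k w))

theorem integral_partialDeriv_of_contDiff (k : Fin 2) {w : Plane → ℝ} (hw : ContDiff ℝ 1 w)
    (hs : HasCompactSupport w) : ∫ x, partialDeriv k w x = 0 :=
  integral_partialDeriv_eq_zero k hw.continuous hs ∅
    (fun x _ => hw.differentiable one_ne_zero x) (integrable_partialDeriv k hw hs)

/-! ### The divergence theorem on the half plane. -/

/-- The upper half plane. -/
def upper : Set Plane := {x | 0 < x 1}

lemma isOpen_upper : IsOpen upper :=
  isOpen_lt continuous_const (by fun_prop)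

lemma preimage_pt_upper : pt ⁻¹' upper = univ ×ˢ Ioi (0 : ℝ) := by
  ext z
  simp [upper]

theorem integral_upper_partialDeriv_zero {w : Plane → ℝ} (hw : ContDiff ℝ 1 w)
    (hs : HasCompactSupport w) : ∫ x in upper, partialDeriv 0 w x = 0 := by
  obtain ⟨R, hR0⟩ := exists_bound_of_hasCompactSupport hs
  have hi' : Integrable (fun z => partialDeriv 0 w (pt z))
      ((volume.restrict univ).prod (volume.restrict (Ioi 0))) := by
    rw [Measure.prod_restrict]
    exact ((measurePreserving_pt.integrable_comp_emb measurableEmbedding_pt).2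
      (integrable_partialDeriv 0 hw hs)).integrableOn
  rw [integral_eq_integral_pt, preimage_pt_upper, Measure.volume_eq_prod, ← Measure.prod_restrict,
    integral_prod_symm _ hi', Measure.restrict_univ]
  rw [Measure.restrict_univ] at hi'
  refine integral_eq_zero_of_ae ?_
  filter_upwards [hi'.prod_left_ae] with t hti
  refine integral_eq_zero_of_hasDerivAt_off_countable (W := fun s => w (pt (s, t)))
      (Z := ∅) countable_empty (hw.continuous.comp (continuous_pt.comp (by fun_prop)))
      (fun s hs' => ?_) hti
      (fun s hs' => image_eq_zero_of_notMem_tsupport (hR0 _ 0 (by simpa using hs')))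
      (fun s hs' => partialDeriv_eq_zero_of_notMem_tsupport _ (hR0 _ 0 (by simpa using hs')))
  exact (hw.differentiable one_ne_zero _).hasFDerivAt.comp_hasDerivAt s (hasDerivAt_pt_left s t)

/-- The weight `b` is constant on vertical lines, so it leaves the inner integral. It will be a
component of the rotated tangent of Γ. -/
theorem integral_upper_partialDeriv_one {w : Plane → ℝ} (hw : ContDiff ℝ 1 w)
    (hs : HasCompactSupport w) {b : ℝ → ℝ} (hb : Continuous b) :
    ∫ x in upper, b (x 0) * partialDeriv 1 w x = - ∫ t, b t * w (pt (t, 0)) := by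
  obtain ⟨R, hR0⟩ := exists_bound_of_hasCompactSupport hs
  have hi : Integrable (fun x : Plane => b (x 0) * partialDeriv 1 w x) := by
    refine Continuous.integrable_of_hasCompactSupport
      ((hb.comp (by fun_prop)).mul (continuous_partialDeriv 1 hw)) ?_
    exact HasCompactSupport.mul_left (f := fun x : Plane => b (x 0))
      (hs.of_isClosed_subset (isClosed_tsupport _) (tsupport_partialDeriv_subset 1 w))
  have hi' : Integrable (fun z : ℝ × ℝ => b (pt z 0) * partialDeriv 1 w (pt z))
      ((volume.restrict univ).prod (volume.restrict (Ioi 0))) := by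
    rw [Measure.prod_restrict]
    exact ((measurePreserving_pt.integrable_comp_emb measurableEmbedding_pt).2 hi).integrableOn
  rw [integral_eq_integral_pt, preimage_pt_upper, Measure.volume_eq_prod, ← Measure.prod_restrict,
    integral_prod _ hi', Measure.restrict_univ, ← integral_neg]
  congr 1 with s
  simp only [pt_zero]
  rw [integral_const_mul]
  have h1 : ∀ t, deriv (fun t => w (pt (s, t))) t = partialDeriv 1 w (pt (s, t)) := fun t =>
    ((hw.differentiable one_ne_zero _).hasFDerivAt.comp_hasDerivAt t
      (hasDerivAt_pt_right s t)).deriv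
  have h2 : ContDiff ℝ 1 (fun t => w (pt (s, t))) := by
    refine hw.comp ?_
    unfold pt
    rw [contDiff_piLp]
    intro k
    fin_cases k
    · exact contDiff_const
    · exact contDiff_id
  have h3 : HasCompactSupport (fun t => w (pt (s, t))) := by
    refine HasCompactSupport.intro (isCompact_Icc (a := -R) (b := R)) fun t ht => ?_
    refine image_eq_zero_of_notMem_tsupport (hR0 _ 1 ?_)
    by_contra h
    rw [not_le, abs_lt] at h
    exact ht ⟨h.1.le, h.2.le⟩
  have h4 := HasCompactSupport.integral_Ioi_deriv_eq h2 h3 0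
  simp only [h1] at h4
  rw [h4]
  ring

/-- A finite union of lines parallel to the axes is a null set. -/
lemma ae_coord_notMem (Z : Finset ℝ) : ∀ᵐ x : Plane, ∀ j, x j ∉ Z := by
  rw [ae_all_iff]
  intro j
  have h1 : ∀ᵐ t : ℝ, t ∉ Z := by
    rw [ae_iff]
    simpa using Z.finite_toSet.measure_zero volume
  have h2 : Measure.QuasiMeasurePreserving (fun x : Plane => x j) volume volume :=
    (Measure.quasiMeasurePreserving_eval (fun _ : Fin 2 => (volume : Measure ℝ)) j).comp
      (PiLp.volume_preserving_ofLp (Fin 2)).quasiMeasurePreserving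
  exact h2.ae h1

/-! ### Limits in `L²` -/

/-- Hölder's inequality. All passages to the limit in Green's formula go through this lemma. -/
lemma tendsto_integral_mul {X : Type*} [MeasurableSpace X] {μ : Measure X} {f : ℕ → X → ℝ}
    {w b : X → ℝ} (hf : ∀ m, MemLp (f m) 2 μ) (hw : MemLp w 2 μ) (hb : MemLp b 2 μ)
    (h : Tendsto (fun m => eLpNorm (fun x => f m x - w x) 2 μ) atTop (𝓝 0)) :
    Tendsto (fun m => ∫ x, f m x * b x ∂μ) atTop (𝓝 (∫ x, w x * b x ∂μ)) := by
  refine tendsto_integral_of_L1' _ (hw.integrable_mul hb).1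
    (Eventually.of_forall fun m => (hf m).integrable_mul hb) ?_
  have h1 : Tendsto (fun m => eLpNorm (fun x => f m x - w x) 2 μ * eLpNorm b 2 μ) atTop
      (𝓝 0) := by
    simpa using ENNReal.Tendsto.mul_const h (Or.inr hb.eLpNorm_lt_top.ne)
  refine tendsto_of_tendsto_of_tendsto_of_le_of_le tendsto_const_nhds h1 (fun _ => zero_le) ?_
  intro m
  have h2 := eLpNorm_smul_le_mul_eLpNorm (p := 2) (q := 2) (r := 1) hb.1
    ((hf m).1.sub hw.1)
  refine le_trans (le_of_eq (eLpNorm_congr_ae (Eventually.of_forall fun x => ?_))) h2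
  simp only [Pi.sub_apply, Pi.mul_apply, Pi.smul_apply', smul_eq_mul]
  ring

lemma tendsto_eLpNorm_sub_sub {X : Type*} [MeasurableSpace X] {μ : Measure X}
    {f f' : ℕ → X → ℝ} {w w' : X → ℝ} (hf : ∀ m, AEStronglyMeasurable (f m) μ)
    (hf' : ∀ m, AEStronglyMeasurable (f' m) μ) (hw : AEStronglyMeasurable w μ)
    (hw' : AEStronglyMeasurable w' μ)
    (h : Tendsto (fun m => eLpNorm (fun x => f m x - w x) 2 μ) atTop (𝓝 0))
    (h' : Tendsto (fun m => eLpNorm (fun x => f' m x - w' x) 2 μ) atTop (𝓝 0)) :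
    Tendsto (fun m => eLpNorm (fun x => (f m x - f' m x) - (w x - w' x)) 2 μ) atTop (𝓝 0) := by
  have h1 := h.add h'
  rw [add_zero] at h1
  refine tendsto_of_tendsto_of_tendsto_of_le_of_le tendsto_const_nhds h1 (fun _ => zero_le) ?_
  intro m
  refine le_trans (le_of_eq (eLpNorm_congr_ae (Eventually.of_forall fun x => ?_)))
    (eLpNorm_sub_le ((hf m).sub hw) ((hf' m).sub hw') one_le_two)
  simp only [Pi.sub_apply]
  ring

lemma tendsto_eLpNorm_mono {X : Type*} [MeasurableSpace X] {μ ν : Measure X} (hν : ν ≤ μ)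
    {f : ℕ → X → ℝ} (h : Tendsto (fun m => eLpNorm (f m) 2 μ) atTop (𝓝 0)) :
    Tendsto (fun m => eLpNorm (f m) 2 ν) atTop (𝓝 0) :=
  tendsto_of_tendsto_of_tendsto_of_le_of_le tendsto_const_nhds h (fun _ => zero_le)
    fun _ => eLpNorm_mono_measure _ hν

lemma memLp_of_continuous {μ : Measure Plane} [IsFiniteMeasure μ] {S : Set Plane}
    (hS : IsCompact S) (hμ : ∀ᵐ x ∂μ, x ∈ S) {w : Plane → ℝ} (hw : Continuous w) :
    MemLp w 2 μ := by
  obtain ⟨C, hC⟩ := hS.exists_bound_of_continuousOn hw.continuousOn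
  exact MemLp.of_bound hw.aestronglyMeasurable C (hμ.mono hC)

lemma isFiniteMeasure_restrict_of_subset_isCompact {D S : Set Plane} (hS : IsCompact S)
    (hD : D ⊆ S) : IsFiniteMeasure ((volume : Measure Plane).restrict D) :=
  ⟨by simpa using (measure_mono hD).trans_lt hS.measure_lt_top⟩

/-! ### Weak derivatives -/

lemma IsTestFunction.partialDeriv {D : Set Plane} {φ : Plane → ℝ} (hφ : IsTestFunction D φ)
    (k : Fin 2) : IsTestFunction D (partialDeriv k φ) :=
  ⟨contDiff_partialDeriv k hφ.1,
    hφ.2.1.of_isClosed_subset (isClosed_tsupport _) (tsupport_partialDeriv_subset k φ),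
    (tsupport_partialDeriv_subset k φ).trans hφ.2.2⟩

lemma IsTestFunction.mono {D D' : Set Plane} {φ : Plane → ℝ} (hφ : IsTestFunction D' φ)
    (hD : D' ⊆ D) : IsTestFunction D φ :=
  ⟨hφ.1, hφ.2.1, hφ.2.2.trans hD⟩

lemma IsTestFunction.eq_zero {D : Set Plane} {φ : Plane → ℝ} (hφ : IsTestFunction D φ)
    {x : Plane} (hx : x ∉ D) : φ x = 0 :=
  image_eq_zero_of_notMem_tsupport fun h => hx (hφ.2.2 h)

lemma IsTestFunction.integrableOn_mul {D : Set Plane} {φ w : Plane → ℝ}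
    (hφ : IsTestFunction D φ) {μ : Measure Plane} (hw : LocallyIntegrableOn w D μ) :
    Integrable (fun x => w x * φ x) μ := by
  have h1 : IntegrableOn (fun x => w x * φ x) (tsupport φ) μ :=
    (hw.integrableOn_compact_subset hφ.2.2 hφ.2.1).mul_continuousOn
      hφ.1.continuous.continuousOn hφ.2.1
  rw [integrableOn_iff_integrable_of_support_subset] at h1
  · exact h1
  · intro x hx
    exact subset_tsupport _ (right_ne_zero_of_mul hx)

lemma HasWeakPartial.mono {D D' : Set Plane} (hD : MeasurableSet D) (h : D' ⊆ D) {k : Fin 2}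
    {w g : Plane → ℝ} (hw : HasWeakPartial D k w g) : HasWeakPartial D' k w g := by
  refine ⟨hw.1.mono_set h, hw.2.1.mono_set h, fun φ hφ => ?_⟩
  have h1 := hw.2.2 φ (hφ.mono h)
  rwa [← setIntegral_eq_of_subset_of_forall_sdiff_eq_zero hD h,
    ← setIntegral_eq_of_subset_of_forall_sdiff_eq_zero hD h]
  · intro x hx
    rw [hφ.eq_zero hx.2, mul_zero]
  · intro x hx
    rw [(hφ.partialDeriv k).eq_zero hx.2, mul_zero]

/-- The fundamental lemma of the calculus of variations. As `weakPartial` is an arbitrary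
representative, every later identity for it rests on this and holds almost everywhere. -/
lemma HasWeakPartial.ae_eq {D : Set Plane} (hD : IsOpen D) {k : Fin 2} {w g g' : Plane → ℝ}
    (h : HasWeakPartial D k w g) (h' : HasWeakPartial D k w g') :
    g =ᵐ[volume.restrict D] g' := by
  have h1 := hD.ae_eq_zero_of_integral_contDiff_smul_eq_zero (μ := volume)
    (h.2.1.sub h'.2.1) (fun φ hφ1 hφ2 hφ3 => ?_)
  · rw [EventuallyEq, ae_restrict_iff' hD.measurableSet]
    filter_upwards [h1] with x hx hxD
    exact sub_eq_zero.1 (hx hxD)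
  · have hφ : IsTestFunction D φ := ⟨hφ1, hφ2, hφ3⟩
    have h2 := h.2.2 φ hφ
    rw [h'.2.2 φ hφ, neg_inj] at h2
    rw [setIntegral_eq_integral_of_forall_compl_eq_zero (fun x hx => by
        rw [hφ.eq_zero hx, mul_zero]),
      setIntegral_eq_integral_of_forall_compl_eq_zero (fun x hx => by
        rw [hφ.eq_zero hx, mul_zero])] at h2
    rw [← sub_eq_zero.2 h2.symm, ← integral_sub (hφ.integrableOn_mul h.2.1)
      (hφ.integrableOn_mul h'.2.1)]
    congr 1 with x
    simp
    ring

lemma HasWeakPartial.hasWeakPartial_weakPartial {D : Set Plane} {k : Fin 2} {w g : Plane → ℝ}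
    (h : HasWeakPartial D k w g) : HasWeakPartial D k w (weakPartial D k w) := by
  have h' : ∃ g, HasWeakPartial D k w g := ⟨g, h⟩
  rw [weakPartial, dif_pos h']
  exact h'.choose_spec

lemma HasWeakPartial.weakPartial_ae_eq {D : Set Plane} (hD : IsOpen D) {k : Fin 2}
    {w g : Plane → ℝ} (h : HasWeakPartial D k w g) :
    weakPartial D k w =ᵐ[volume.restrict D] g :=
  h.hasWeakPartial_weakPartial.ae_eq hD h

lemma LocallyIntegrableOn.congr_ae {D : Set Plane} {w w' : Plane → ℝ}
    (h : w =ᵐ[volume.restrict D] w') (hw : LocallyIntegrableOn w D volume) :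
    LocallyIntegrableOn w' D volume := by
  intro x hx
  obtain ⟨U, hU, hUw⟩ := hw x hx
  refine ⟨U ∩ D, inter_mem hU self_mem_nhdsWithin, ?_⟩
  exact (hUw.mono_set inter_subset_left).congr_fun_ae
    (ae_restrict_of_ae_restrict_of_subset inter_subset_right h)

lemma HasWeakPartial.congr {D : Set Plane} {k : Fin 2} {w w' g : Plane → ℝ}
    (hw : HasWeakPartial D k w g) (h : w =ᵐ[volume.restrict D] w') :
    HasWeakPartial D k w' g := by
  refine ⟨LocallyIntegrableOn.congr_ae h hw.1, hw.2.1, fun φ hφ => ?_⟩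
  rw [← hw.2.2 φ hφ]
  refine integral_congr_ae ?_
  filter_upwards [h] with x hx
  rw [hx]

lemma HasWeakPartial.sub {D : Set Plane} {k : Fin 2} {w w' g g' : Plane → ℝ}
    (hw : HasWeakPartial D k w g) (hw' : HasWeakPartial D k w' g') :
    HasWeakPartial D k (w - w') (g - g') := by
  refine ⟨hw.1.sub hw'.1, hw.2.1.sub hw'.2.1, fun φ hφ => ?_⟩
  simp only [Pi.sub_apply, sub_mul]
  rw [integral_sub ((hφ.partialDeriv k).integrableOn_mul hw.1).integrableOn
      ((hφ.partialDeriv k).integrableOn_mul hw'.1).integrableOn,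
    integral_sub (hφ.integrableOn_mul hw.2.1).integrableOn
      (hφ.integrableOn_mul hw'.2.1).integrableOn, hw.2.2 φ hφ, hw'.2.2 φ hφ]
  ring

lemma HasWeakPartial.const_mul {D : Set Plane} {k : Fin 2} {w g : Plane → ℝ}
    (hw : HasWeakPartial D k w g) (c : ℝ) :
    HasWeakPartial D k (fun x => c * w x) (fun x => c * g x) := by
  refine ⟨hw.1.smul c, hw.2.1.smul c, fun φ hφ => ?_⟩
  simp only [mul_assoc]
  rw [integral_const_mul, integral_const_mul, hw.2.2 φ hφ]
  ring

/-- The product `q * φ` is smooth with compact support, so its derivative integrates to zero over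
the plane. -/
lemma hasWeakPartial_of_contDiff {D : Set Plane} (k : Fin 2) {q : Plane → ℝ}
    (hq : ContDiff ℝ ∞ q) : HasWeakPartial D k q (partialDeriv k q) := by
  have hq1 := contDiff_partialDeriv k hq
  refine ⟨hq.continuous.locallyIntegrable.locallyIntegrableOn _,
    hq1.continuous.locallyIntegrable.locallyIntegrableOn _, fun φ hφ => ?_⟩
  have h1 := integral_partialDeriv_of_contDiff k (w := fun x => q x * φ x)
    ((hq.mul hφ.1).of_le (by simp)) hφ.2.1.mul_left
  rw [setIntegral_eq_integral_of_forall_compl_eq_zero (fun x hx => by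
        rw [(hφ.partialDeriv k).eq_zero hx, mul_zero]),
      setIntegral_eq_integral_of_forall_compl_eq_zero (fun x hx => by
        rw [hφ.eq_zero hx, mul_zero]), eq_neg_iff_add_eq_zero, ← h1, ← integral_add]
  · congr 1 with x
    rw [partialDeriv_mul k (hq.differentiable (by simp) x) (hφ.1.differentiable (by simp) x)]
    ring
  · exact (hφ.partialDeriv k).integrableOn_mul
      (hq.continuous.locallyIntegrable.locallyIntegrableOn _)
  · exact hφ.integrableOn_mul (hq1.continuous.locallyIntegrable.locallyIntegrableOn _)

/-! ### The space `H¹` -/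

lemma memSobolev_one_iff {D : Set Plane} {w : Plane → ℝ} : MemSobolev D 1 w ↔
    MemLp w 2 (volume.restrict D) ∧
      ∀ k, ∃ g, HasWeakPartial D k w g ∧ MemLp g 2 (volume.restrict D) := Iff.rfl

lemma MemSobolev.memLp {D : Set Plane} {m : ℕ} {w : Plane → ℝ} (hw : MemSobolev D m w) :
    MemLp w 2 (volume.restrict D) := by
  cases m with
  | zero => exact hw
  | succ m => exact hw.1

lemma MemSobolev.succ_imp_one {D : Set Plane} {m : ℕ} {w : Plane → ℝ}
    (hw : MemSobolev D (m + 1) w) : MemSobolev D 1 w :=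
  memSobolev_one_iff.2 ⟨hw.1, fun k => (hw.2 k).imp fun _ h => ⟨h.1, h.2.memLp⟩⟩

lemma MemSobolev.hasWeakPartial {D : Set Plane} {w : Plane → ℝ}
    (hw : MemSobolev D 1 w) (k : Fin 2) : HasWeakPartial D k w (weakPartial D k w) :=
  (hw.2 k).choose_spec.1.hasWeakPartial_weakPartial

lemma MemSobolev.memLp_weakPartial {D : Set Plane} (hD : IsOpen D) {w : Plane → ℝ}
    (hw : MemSobolev D 1 w) (k : Fin 2) :
    MemLp (weakPartial D k w) 2 (volume.restrict D) := by
  obtain ⟨g, hg, hg2⟩ := (memSobolev_one_iff.1 hw).2 k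
  exact (memLp_congr_ae (hg.weakPartial_ae_eq hD)).2 hg2

lemma MemSobolev.sub {D : Set Plane} {w w' : Plane → ℝ} (hw : MemSobolev D 1 w)
    (hw' : MemSobolev D 1 w') : MemSobolev D 1 (w - w') := by
  rw [memSobolev_one_iff] at *
  refine ⟨hw.1.sub hw'.1, fun k => ?_⟩
  obtain ⟨g, hg, hg2⟩ := hw.2 k
  obtain ⟨g', hg', hg2'⟩ := hw'.2 k
  exact ⟨g - g', hg.sub hg', hg2.sub hg2'⟩

lemma MemSobolev.mono {D D' : Set Plane} (hD : MeasurableSet D) (h : D' ⊆ D) {w : Plane → ℝ}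
    (hw : MemSobolev D 1 w) : MemSobolev D' 1 w := by
  rw [memSobolev_one_iff] at *
  refine ⟨hw.1.mono_measure (Measure.restrict_mono h le_rfl), fun k => ?_⟩
  obtain ⟨g, hg, hg2⟩ := hw.2 k
  exact ⟨g, hg.mono hD h, hg2.mono_measure (Measure.restrict_mono h le_rfl)⟩

lemma MemSobolev.congr {D : Set Plane} {w w' : Plane → ℝ}
    (hw : MemSobolev D 1 w) (h : w =ᵐ[volume.restrict D] w') : MemSobolev D 1 w' := by
  rw [memSobolev_one_iff] at *
  refine ⟨(memLp_congr_ae h).1 hw.1, fun k => ?_⟩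
  obtain ⟨g, hg, hg2⟩ := hw.2 k
  exact ⟨g, hg.congr h, hg2⟩

lemma memSobolev_of_contDiff {D S : Set Plane} (hS : IsCompact S) (hDS : D ⊆ S)
    (hD : MeasurableSet D) {q : Plane → ℝ} (hq : ContDiff ℝ ∞ q) : MemSobolev D 1 q := by
  have := isFiniteMeasure_restrict_of_subset_isCompact hS hDS
  have h1 : ∀ᵐ x ∂(volume.restrict D), x ∈ S := by
    rw [ae_restrict_iff' hD]
    exact Eventually.of_forall hDS
  refine memSobolev_one_iff.2 ⟨memLp_of_continuous hS h1 hq.continuous, fun k =>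
    ⟨_, hasWeakPartial_of_contDiff k hq,
      memLp_of_continuous hS h1 (contDiff_partialDeriv k hq).continuous⟩⟩

lemma weakPartial_sub_ae_eq {D : Set Plane} (hD : IsOpen D) {w w' : Plane → ℝ}
    (hw : MemSobolev D 1 w) (hw' : MemSobolev D 1 w') (k : Fin 2) :
    weakPartial D k (w - w') =ᵐ[volume.restrict D] weakPartial D k w - weakPartial D k w' :=
  ((hw.hasWeakPartial k).sub (hw'.hasWeakPartial k)).weakPartial_ae_eq hD

lemma weakPartial_mono_ae_eq {D D' : Set Plane} (hD : IsOpen D) (hD' : IsOpen D') (h : D' ⊆ D)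
    {w : Plane → ℝ} (hw : MemSobolev D 1 w) (k : Fin 2) :
    weakPartial D' k w =ᵐ[volume.restrict D'] weakPartial D k w :=
  ((hw.hasWeakPartial k).mono hD.measurableSet h).weakPartial_ae_eq hD'

/-! ### Traces -/

lemma IsTrace.isTrace_trace {D : Set Plane} {ν : Measure Plane} {w g : Plane → ℝ}
    (h : IsTrace D ν w g) : IsTrace D ν w (trace D ν w) := by
  have h' : ∃ g, IsTrace D ν w g := ⟨g, h⟩
  rw [trace, dif_pos h']
  exact h'.choose_spec

lemma IsTrace.sub {D : Set Plane} (hD : IsOpen D) {ν : Measure Plane} {w w' g g' : Plane → ℝ}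
    (h : IsTrace D ν w g) (h' : IsTrace D ν w' g') : IsTrace D ν (w - w') (g - g') := by
  obtain ⟨hw, hg, φ, hφ, h1, h2, h3⟩ := h
  obtain ⟨hw', hg', φ', hφ', h1', h2', h3'⟩ := h'
  refine ⟨hw.sub hw', hg.sub hg', fun m x => φ m x - φ' m x, fun m => (hφ m).sub (hφ' m),
    ?_, fun k => ?_, ?_⟩
  · exact tendsto_eLpNorm_sub_sub (fun m => (hφ m).continuous.aestronglyMeasurable)
      (fun m => (hφ' m).continuous.aestronglyMeasurable) hw.memLp.1 hw'.memLp.1 h1 h1'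
  · refine (tendsto_eLpNorm_sub_sub
      (fun m => (contDiff_partialDeriv k (hφ m)).continuous.aestronglyMeasurable)
      (fun m => (contDiff_partialDeriv k (hφ' m)).continuous.aestronglyMeasurable)
      (hw.memLp_weakPartial hD k).1 (hw'.memLp_weakPartial hD k).1 (h2 k) (h2' k)).congr ?_
    intro m
    refine eLpNorm_congr_ae ?_
    filter_upwards [weakPartial_sub_ae_eq hD hw hw' k] with x hx
    rw [hx, partialDeriv_sub k ((hφ m).differentiable (by simp) x)
      ((hφ' m).differentiable (by simp) x), Pi.sub_apply]
  · exact tendsto_eLpNorm_sub_sub (fun m => (hφ m).continuous.aestronglyMeasurable)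
      (fun m => (hφ' m).continuous.aestronglyMeasurable) hg.1 hg'.1 h3 h3'

/-- The same approximating sequence serves on the smaller sets. In this way traces on Γ become
traces on $\Gamma_K$ from the cut cell, the ones that the forms use. -/
lemma IsTrace.mono {D D' : Set Plane} (hD : IsOpen D) (hD' : IsOpen D') (hDD : D' ⊆ D)
    {ν ν' : Measure Plane} (hν : ν' ≤ ν) {w g : Plane → ℝ} (h : IsTrace D ν w g) :
    IsTrace D' ν' w g := by
  obtain ⟨hw, hg, φ, hφ, h1, h2, h3⟩ := h
  have hle : (volume : Measure Plane).restrict D' ≤ volume.restrict D :=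
    Measure.restrict_mono hDD le_rfl
  refine ⟨hw.mono hD.measurableSet hDD, hg.mono_measure hν, φ, hφ,
    tendsto_eLpNorm_mono hle h1, fun k => ?_, tendsto_eLpNorm_mono hν h3⟩
  refine (tendsto_eLpNorm_mono hle (h2 k)).congr fun m => eLpNorm_congr_ae ?_
  filter_upwards [weakPartial_mono_ae_eq hD hD' hDD hw k] with x hx
  rw [hx]

lemma IsTrace.congr {D : Set Plane} (hD : IsOpen D) {ν : Measure Plane} {w w' g : Plane → ℝ}
    (h : IsTrace D ν w g) (hw' : w =ᵐ[volume.restrict D] w') : IsTrace D ν w' g := by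
  obtain ⟨hw, hg, φ, hφ, h1, h2, h3⟩ := h
  refine ⟨hw.congr hw', hg, φ, hφ, ?_, fun k => ?_, h3⟩
  · refine h1.congr fun m => eLpNorm_congr_ae ?_
    filter_upwards [hw'] with x hx
    rw [hx]
  · refine (h2 k).congr fun m => eLpNorm_congr_ae ?_
    filter_upwards [((hw.hasWeakPartial k).congr hw').weakPartial_ae_eq hD] with x hx
    rw [hx]

lemma isTrace_of_contDiff {D S : Set Plane} (hS : IsCompact S) (hDS : D ⊆ S)
    (hD : IsOpen D) {ν : Measure Plane} {q : Plane → ℝ} (hq : ContDiff ℝ ∞ q)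
    (hqν : MemLp q 2 ν) : IsTrace D ν q q := by
  refine ⟨memSobolev_of_contDiff hS hDS hD.measurableSet hq, hqν, fun _ => q, fun _ => hq,
    by simp, fun k => ?_, by simp⟩
  refine tendsto_const_nhds.congr fun m => ?_
  symm
  rw [← eLpNorm_zero (μ := volume.restrict D) (α := Plane) (ε := ℝ) (p := 2)]
  refine eLpNorm_congr_ae ?_
  filter_upwards [(hasWeakPartial_of_contDiff (D := D) k hq).weakPartial_ae_eq hD] with x hx
  simp [hx]

/-! ### Rectangles -/

namespace Rect

variable (K : Rect)

lemma isOpen_inner : IsOpen K.inner := by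
  have h : K.inner = ⋂ k, {x : Plane | K.lo k < x k ∧ x k < K.hi k} := by
    ext x
    simp [inner]
  rw [h]
  refine isOpen_iInter_of_finite fun k => ?_
  have hk : Continuous fun x : Plane => x k := by fun_prop
  exact (isOpen_lt continuous_const hk).inter (isOpen_lt hk continuous_const)

lemma isCompact_closed : IsCompact K.closed := by
  have h : K.closed = WithLp.toLp 2 '' Icc K.lo K.hi := by
    ext x
    constructor
    · intro hx
      exact ⟨WithLp.ofLp x, ⟨fun k => (hx k).1, fun k => (hx k).2⟩, rfl⟩
    · rintro ⟨y, hy, rfl⟩ k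
      exact ⟨hy.1 k, hy.2 k⟩
  rw [h]
  exact isCompact_Icc.image (PiLp.continuous_toLp 2 _)

lemma isClosed_closed : IsClosed K.closed := K.isCompact_closed.isClosed

lemma inner_subset_closed : K.inner ⊆ K.closed := fun _ hx k => ⟨(hx k).1.le, (hx k).2.le⟩

lemma inner_subset_inner {K L : Rect} (h : K.closed ⊆ L.closed) : K.inner ⊆ L.inner := by
  intro x hx k
  have h1 : WithLp.toLp 2 K.lo ∈ L.closed := h fun k => ⟨le_rfl, (K.lo_lt_hi k).le⟩
  have h2 : WithLp.toLp 2 K.hi ∈ L.closed := h fun k => ⟨(K.lo_lt_hi k).le, le_rfl⟩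
  exact ⟨(h1 k).1.trans_lt (hx k).1, (hx k).2.trans_le (h2 k).2⟩

lemma inner_nonempty : K.inner.Nonempty :=
  ⟨WithLp.toLp 2 fun k => (K.lo k + K.hi k) / 2, fun k => by
    have := K.lo_lt_hi k
    constructor <;> simp <;> linarith⟩

end Rect

/-! ### Rotation and sides -/

@[simp] lemma rot_zero (v : Plane) : rot v 0 = -(v 1) := rfl

@[simp] lemma rot_one (v : Plane) : rot v 1 = v 0 := rfl

lemma norm_rot (v : Plane) : ‖rot v‖ = ‖v‖ := by
  simp [EuclideanSpace.norm_eq, add_comm]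

lemma continuous_rot : Continuous rot := by
  unfold rot
  fun_prop

/-- The sign of a side. -/
def sgn (i : Side) : ℝ := if i then 1 else -1

lemma sgn_mul_self (i : Side) : sgn i * sgn i = 1 := by
  cases i <;> simp [sgn]

lemma sgn_ne_zero (i : Side) : sgn i ≠ 0 := by
  cases i <;> simp [sgn]

lemma sgn_not (i : Side) : sgn (!i) = - sgn i := by
  cases i <;> simp [sgn]

namespace Interface

variable {Q : Rect} (I : Interface Q)

/-! ### The arc length -/

lemma continuous_curve : Continuous I.curve := I.smooth.continuous

lemma continuous_deriv : Continuous (deriv I.curve) := I.smooth.continuous_deriv (by simp)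

lemma hasDerivAt_curve (t : ℝ) : HasDerivAt I.curve (deriv I.curve t) t :=
  (I.smooth.differentiable (by simp) t).hasDerivAt

lemma isCompact_carrier : IsCompact I.carrier := isCompact_Icc.image I.continuous_curve

lemma carrier_subset : I.carrier ⊆ Q.closed := by
  rintro x ⟨t, ht, rfl⟩
  rcases I.closed_or_arc with ⟨_, _, h⟩ | ⟨_, h, h0, h1⟩
  · exact Q.inner_subset_closed (h t ht)
  · rcases eq_or_lt_of_le ht.1 with rfl | h0'
    · exact h0.1
    rcases eq_or_lt_of_le ht.2 with rfl | h1'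
    · exact h1.1
    exact Q.inner_subset_closed (h t ⟨h0', h1'⟩)

instance isFiniteMeasure_arcLength : IsFiniteMeasure I.arcLength := by
  unfold arcLength
  have : IsFiniteMeasure ((volume.restrict (Icc (0 : ℝ) 1)).withDensity
      (fun t => ENNReal.ofReal ‖deriv I.curve t‖)) := by
    refine isFiniteMeasure_withDensity_ofReal ?_
    exact (I.continuous_deriv.norm.integrableOn_Icc).2
  infer_instance

lemma ae_mem_carrier : ∀ᵐ x ∂I.arcLength, x ∈ I.carrier := by
  unfold arcLength
  refine (ae_map_iff I.continuous_curve.aemeasurable I.isCompact_carrier.measurableSet).2 ?_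
  refine (withDensity_absolutelyContinuous _ _).ae_le ?_
  filter_upwards [ae_restrict_mem measurableSet_Icc] with t ht
  exact mem_image_of_mem _ ht

lemma restrict_carrier : I.arcLength.restrict I.carrier = I.arcLength :=
  Measure.restrict_eq_self_of_ae_mem I.ae_mem_carrier

lemma finite_preimage (x : Plane) : (Icc (0 : ℝ) 1 ∩ I.curve ⁻¹' {x}).Finite := by
  have h : InjOn I.curve (Ico 0 1) := by
    rcases I.closed_or_arc with ⟨_, h, _⟩ | ⟨h, _⟩
    · exact h
    · exact h.mono Ico_subset_Icc_self
  have h1 : (Ico (0 : ℝ) 1 ∩ I.curve ⁻¹' {x}).Subsingleton := by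
    intro s hs t ht
    exact h hs.1 ht.1 (hs.2.trans ht.2.symm)
  -- The parameter 1 is set apart because a closed curve returns there to its starting point.
  refine (h1.finite.union (finite_singleton 1)).subset ?_
  rintro t ⟨ht, htx⟩
  rcases eq_or_lt_of_le ht.2 with rfl | h'
  · exact Or.inr rfl
  · exact Or.inl ⟨⟨ht.1, h'⟩, htx⟩

instance nullSingletonClass_arcLength : NullSingletonClass I.arcLength := by
  refine ⟨fun x => ?_⟩
  have hm : MeasurableSet (I.curve ⁻¹' {x}) :=
    I.continuous_curve.measurable (measurableSet_singleton x)
  unfold arcLength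
  rw [Measure.map_apply I.continuous_curve.measurable (measurableSet_singleton x)]
  refine withDensity_absolutelyContinuous _ _ ?_
  rw [Measure.restrict_apply hm, inter_comm]
  exact (I.finite_preimage x).measure_zero _

lemma norm_normal {x : Plane} (hx : x ∈ I.carrier) : ‖I.normal x‖ = 1 := by
  obtain ⟨t, ht, rfl⟩ := hx
  rw [I.normal_eq t ht, norm_smul, norm_inv, norm_norm, norm_rot,
    inv_mul_cancel₀ (norm_ne_zero_iff.2 (I.regular t ht))]

/-- The normal is continuous as a function of the parameter. This descends to Γ because the curve
maps closed sets of parameters in $[0,1]$, which are compact, to closed sets. -/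
lemma continuousOn_normal : ContinuousOn I.normal I.carrier := by
  have h1 : ContinuousOn (fun t => I.normal (I.curve t)) (Icc 0 1) := by
    have h2 : ContinuousOn (fun t => ‖deriv I.curve t‖⁻¹ • rot (deriv I.curve t)) (Icc 0 1) := by
      refine ContinuousOn.smul (ContinuousOn.inv₀ I.continuous_deriv.norm.continuousOn
        fun t ht => norm_ne_zero_iff.2 (I.regular t ht))
        (continuous_rot.comp I.continuous_deriv).continuousOn
    exact h2.congr fun t ht => I.normal_eq t ht
  rw [continuousOn_iff_isClosed]
  intro C hC
  refine ⟨I.curve '' (Icc 0 1 ∩ (fun t => I.normal (I.curve t)) ⁻¹' C), ?_, ?_⟩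
  · refine IsCompact.isClosed (IsCompact.image ?_ I.continuous_curve)
    exact isCompact_Icc.of_isClosed_subset (h1.preimage_isClosed_of_isClosed isClosed_Icc hC)
      inter_subset_left
  · ext x
    constructor
    · rintro ⟨hx, t, ht, rfl⟩
      exact ⟨⟨t, ⟨ht, hx⟩, rfl⟩, ⟨t, ht, rfl⟩⟩
    · rintro ⟨⟨t, ⟨ht, hx⟩, rfl⟩, _⟩
      exact ⟨hx, ⟨t, ht, rfl⟩⟩

lemma aestronglyMeasurable_normal (k : Fin 2) :
    AEStronglyMeasurable (fun x => I.normal x k) I.arcLength := by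
  have h : ContinuousOn (fun x => I.normal x k) I.carrier :=
    (EuclideanSpace.proj (𝕜 := ℝ) k).continuous.comp_continuousOn I.continuousOn_normal
  have h1 := h.aestronglyMeasurable (μ := I.arcLength) I.isCompact_carrier.measurableSet
  rwa [I.restrict_carrier] at h1

lemma ae_abs_normal_le (k : Fin 2) : ∀ᵐ x ∂I.arcLength, ‖I.normal x k‖ ≤ 1 := by
  filter_upwards [I.ae_mem_carrier] with x hx
  rw [← I.norm_normal hx]
  exact PiLp.norm_apply_le _ k

lemma memLp_mul_normal {ν : Measure Plane} (hν : ν ≤ I.arcLength) {g : Plane → ℝ}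
    (hg : MemLp g 2 ν) (k : Fin 2) : MemLp (fun x => g x * I.normal x k) 2 ν := by
  have hac : ν ≪ I.arcLength := Measure.absolutelyContinuous_of_le hν
  refine hg.of_le (hg.1.mul ((I.aestronglyMeasurable_normal k).mono_ac hac)) ?_
  filter_upwards [hac.ae_le (I.ae_abs_normal_le k)] with x hx
  rw [norm_mul]
  exact mul_le_of_le_one_right (norm_nonneg _) hx

/-- The speed in the arc length density cancels the normalisation of the normal, which leaves the
rotated tangent. -/
lemma integral_mul_normal (k : Fin 2) {φ : Plane → ℝ} (hφ : Continuous φ) :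
    ∫ x, φ x * I.normal x k ∂I.arcLength =
      ∫ t in (0 : ℝ)..1, φ (I.curve t) * rot (deriv I.curve t) k := by
  have hm : AEStronglyMeasurable (fun x => φ x * I.normal x k) I.arcLength :=
    hφ.aestronglyMeasurable.mul (I.aestronglyMeasurable_normal k)
  unfold arcLength at hm ⊢
  rw [integral_map I.continuous_curve.aemeasurable hm,
    integral_withDensity_eq_integral_toReal_smul
      (I.continuous_deriv.norm.measurable.ennreal_ofReal) (by simp),
    intervalIntegral.integral_of_le zero_le_one, ← integral_Icc_eq_integral_Ioc]
  refine setIntegral_congr_fun measurableSet_Icc fun t ht => ?_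
  have h0 : ‖deriv I.curve t‖ ≠ 0 := norm_ne_zero_iff.2 (I.regular t ht)
  simp only [I.normal_eq t ht, smul_eq_mul, ENNReal.toReal_ofReal (norm_nonneg _),
    PiLp.smul_apply]
  field_simp

end Interface

namespace Interface

variable {Q : Rect} (I : Interface Q)

/-! ### Parametrizations of the interface around an inner point -/

lemma periodic_deriv {c : ℝ → Plane} (h : Function.Periodic c 1) :
    Function.Periodic (deriv c) 1 := by
  intro t
  rw [← deriv_comp_add_const]
  congr 1
  funext s
  exact h s

/-- The parameter interval `[a, a + 1]` describes the interface, and its inner parameters are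
assumed only once. -/
structure IsChart (a : ℝ) : Prop where
  inj : ∀ t ∈ Icc a (a + 1), ∀ t' ∈ Ioo a (a + 1), I.curve t = I.curve t' → t = t'
  mem : ∀ t ∈ Icc a (a + 1), I.curve t ∈ I.carrier
  surj : ∀ x ∈ I.carrier, ∃ t ∈ Icc a (a + 1), I.curve t = x
  ne_zero : ∀ t ∈ Icc a (a + 1), deriv I.curve t ≠ 0
  normal_eq : ∀ t ∈ Icc a (a + 1),
    I.normal (I.curve t) = ‖deriv I.curve t‖⁻¹ • rot (deriv I.curve t)
  integral_eq : ∀ (k : Fin 2) (φ : Plane → ℝ), Continuous φ →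
    ∫ x, φ x * I.normal x k ∂I.arcLength =
      ∫ t in a..(a + 1), φ (I.curve t) * rot (deriv I.curve t) k

/-- A closed curve is reparametrized by periodicity so that the given point is the middle of the
interval. For an arc, the end points lie on ∂Ω, so a point inside Ω already has an inner parameter.
-/
lemma exists_isChart {x : Plane} (hx : x ∈ I.carrier) (hxQ : x ∈ Q.inner) :
    ∃ a t₀, t₀ ∈ Ioo a (a + 1) ∧ I.curve t₀ = x ∧ I.IsChart a := by
  obtain ⟨t₀, ht₀, rfl⟩ := hx
  rcases I.closed_or_arc with ⟨hp, hi, _⟩ | ⟨hi, _, h0, h1⟩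
  · have hfr : ∀ t, I.curve (Int.fract t) = I.curve t := fun t => by
      have := hp.sub_int_mul_eq (x := t) ⌊t⌋
      rwa [mul_one] at this
    have hfr' : ∀ t, deriv I.curve (Int.fract t) = deriv I.curve t := fun t => by
      have := (periodic_deriv hp).sub_int_mul_eq (x := t) ⌊t⌋
      rwa [mul_one] at this
    have hfm : ∀ t : ℝ, Int.fract t ∈ Ico (0 : ℝ) 1 := fun t =>
      ⟨Int.fract_nonneg t, Int.fract_lt_one t⟩
    refine ⟨t₀ - 1 / 2, t₀, ⟨by linarith, by linarith⟩, rfl, ?_, ?_, ?_, ?_, ?_, ?_⟩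
    · intro t ht t' ht' h
      rw [← hfr t, ← hfr t'] at h
      have h2 := hi (hfm t) (hfm t') h
      -- Parameters of the same point differ by an integer, and this integer is 0 because `t'` is
      -- not an end point of the interval of length 1.
      obtain ⟨z, hz⟩ := Int.fract_eq_fract.1 h2
      have h3 : |(z : ℝ)| < 1 := by
        rw [← hz, abs_lt]
        constructor <;> linarith [ht.1, ht.2, ht'.1, ht'.2]
      have h4 : z = 0 := by
        rw [← Int.abs_lt_one_iff]
        exact_mod_cast h3
      rw [h4, Int.cast_zero] at hz
      linarith
    · intro t _
      rw [← hfr]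
      exact mem_image_of_mem _ (Ico_subset_Icc_self (hfm t))
    · rintro x ⟨t, _, rfl⟩
      obtain ⟨s, hs, hst⟩ := hp.exists_mem_Ico one_pos t (t₀ - 1 / 2)
      exact ⟨s, Ico_subset_Icc_self hs, hst.symm⟩
    · intro t _
      rw [← hfr']
      exact I.regular _ (Ico_subset_Icc_self (hfm t))
    · intro t _
      rw [← hfr, ← hfr']
      exact I.normal_eq _ (Ico_subset_Icc_self (hfm t))
    · intro k φ hφ
      have hper : Function.Periodic (fun t => φ (I.curve t) * rot (deriv I.curve t) k) 1 := by
        intro t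
        simp only [hp t, periodic_deriv hp t]
      have := hper.intervalIntegral_add_eq 0 (t₀ - 1 / 2)
      rw [← this, zero_add, I.integral_mul_normal k hφ]
  · have h0' : t₀ ≠ 0 := by
      rintro rfl
      exact h0.2 hxQ
    have h1' : t₀ ≠ 1 := by
      rintro rfl
      exact h1.2 hxQ
    refine ⟨0, t₀, ?_, rfl, ?_, ?_, ?_, ?_, ?_, ?_⟩
    · rw [zero_add]
      exact ⟨lt_of_le_of_ne ht₀.1 h0'.symm, lt_of_le_of_ne ht₀.2 h1'⟩
    all_goals rw [zero_add]
    · intro t ht t' ht' h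
      exact hi ht (Ioo_subset_Icc_self ht') h
    · intro t ht
      exact mem_image_of_mem _ ht
    · intro x hx
      exact hx
    · exact I.regular
    · exact I.normal_eq
    · intro k φ hφ
      exact I.integral_mul_normal k hφ

/-! ### Straightening the interface -/

/-- The vector transversal to the interface at the parameter `t₀` that points to the side `i`. -/
def transversal (i : Side) (t₀ : ℝ) : Plane := sgn i • rot (deriv I.curve t₀)

/-- Coordinates around a point of the interface, in which the side `i` is the upper half plane. -/
def straight (i : Side) (t₀ : ℝ) (y : Plane) : Plane := I.curve (y 0) + y 1 • I.transversal i t₀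

/-- The derivative of `straight`. -/
def straightDeriv (i : Side) (t₀ : ℝ) (y : Plane) : Plane →L[ℝ] Plane :=
  (EuclideanSpace.proj (𝕜 := ℝ) (0 : Fin 2)).smulRight (deriv I.curve (y 0)) +
    (EuclideanSpace.proj (𝕜 := ℝ) (1 : Fin 2)).smulRight (I.transversal i t₀)

lemma contDiff_straight (i : Side) (t₀ : ℝ) : ContDiff ℝ ∞ (I.straight i t₀) := by
  have h0 : ContDiff ℝ ∞ fun y : Plane => y 0 := (EuclideanSpace.proj (𝕜 := ℝ) (0 : Fin 2)).contDiff
  have h1 : ContDiff ℝ ∞ fun y : Plane => y 1 := (EuclideanSpace.proj (𝕜 := ℝ) (1 : Fin 2)).contDiff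
  exact (I.smooth.comp h0).add (h1.smul contDiff_const)

lemma hasFDerivAt_straight (i : Side) (t₀ : ℝ) (y : Plane) :
    HasFDerivAt (I.straight i t₀) (I.straightDeriv i t₀ y) y := by
  have h0 : HasFDerivAt (fun y : Plane => y 0) (EuclideanSpace.proj (𝕜 := ℝ) (0 : Fin 2)) y :=
    (EuclideanSpace.proj (𝕜 := ℝ) (0 : Fin 2)).hasFDerivAt
  have h1 : HasFDerivAt (fun y : Plane => y 1) (EuclideanSpace.proj (𝕜 := ℝ) (1 : Fin 2)) y :=
    (EuclideanSpace.proj (𝕜 := ℝ) (1 : Fin 2)).hasFDerivAt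
  have h2 := (I.hasDerivAt_curve (y 0)).hasFDerivAt.comp y h0
  have h3 := h1.smul_const (I.transversal i t₀)
  refine (h2.add h3).congr_fderiv ?_
  ext v k
  simp [straightDeriv]

lemma straightDeriv_basisVec_zero (i : Side) (t₀ : ℝ) (y : Plane) :
    I.straightDeriv i t₀ y (basisVec 0) = deriv I.curve (y 0) := by
  simp [straightDeriv]

lemma straightDeriv_basisVec_one (i : Side) (t₀ : ℝ) (y : Plane) :
    I.straightDeriv i t₀ y (basisVec 1) = I.transversal i t₀ := by
  simp [straightDeriv]

/-- The columns are the tangent at `y 0` and the rotated tangent at `t₀`, up to sign. The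
determinant is therefore an inner product of tangents, nonzero near `t₀`. -/
lemma det_straightDeriv (i : Side) (t₀ : ℝ) (y : Plane) :
    (I.straightDeriv i t₀ y).det =
      sgn i * ∑ k, deriv I.curve (y 0) k * deriv I.curve t₀ k := by
  rw [ContinuousLinearMap.det,
    ← LinearMap.det_toMatrix (EuclideanSpace.basisFun (Fin 2) ℝ).toBasis, Matrix.det_fin_two]
  simp [LinearMap.toMatrix_apply, straightDeriv, transversal, Fin.sum_univ_two]
  ring

/-- The ball of radius `r` around `(t₀, 0)` is a domain of good coordinates. -/
structure IsStraight (i : Side) (a t₀ r : ℝ) : Prop where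
  injOn : InjOn (I.straight i t₀) (Metric.ball (pt (t₀, 0)) r)
  isOpen_image : IsOpen (I.straight i t₀ '' Metric.ball (pt (t₀, 0)) r)
  isCompact_preimage : ∀ C ⊆ I.straight i t₀ '' Metric.ball (pt (t₀, 0)) r, IsCompact C →
    IsCompact (Metric.ball (pt (t₀, 0)) r ∩ I.straight i t₀ ⁻¹' C)
  mem_Ioo : ∀ t, |t - t₀| < r → t ∈ Ioo a (a + 1)
  of_mem_image : ∀ t ∈ Icc a (a + 1),
    I.curve t ∈ I.straight i t₀ '' Metric.ball (pt (t₀, 0)) r → |t - t₀| < r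
  inner_pos : ∀ t, |t - t₀| < r → 0 < ∑ k, deriv I.curve t k * deriv I.curve t₀ k
  mem_part : ∀ y ∈ Metric.ball (pt (t₀, 0)) r, 0 < y 1 → I.straight i t₀ y ∈ I.part i
  notMem_part : ∀ y ∈ Metric.ball (pt (t₀, 0)) r, y 1 ≤ 0 → I.straight i t₀ y ∉ I.part i

lemma disjoint_part' (i : Side) : Disjoint (I.part i) (I.part (!i)) := by
  cases i
  · exact I.disjoint_part.symm
  · exact I.disjoint_part

lemma part_union' (i : Side) : I.part i ∪ I.part (!i) = Q.inner \ I.carrier := by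
  cases i
  · rw [union_comm]
    exact I.part_union
  · exact I.part_union

lemma part_subset (i : Side) : I.part i ⊆ Q.inner \ I.carrier :=
  subset_union_left.trans (I.part_union' i).le

lemma straight_pt_zero (i : Side) (t₀ t : ℝ) : I.straight i t₀ (pt (t, 0)) = I.curve t := by
  simp [straight]

lemma abs_coord_sub_lt {y z : Plane} {r : ℝ} (h : y ∈ Metric.ball z r) (k : Fin 2) :
    |y k - z k| < r := by
  rw [mem_ball_iff_norm] at h
  exact (PiLp.norm_apply_le (y - z) k).trans_lt h

lemma pt_mem_ball {t t₀ r : ℝ} : pt (t, 0) ∈ Metric.ball (pt (t₀, 0)) r ↔ |t - t₀| < r := by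
  rw [mem_ball_iff_norm, EuclideanSpace.norm_eq]
  simp [Real.sqrt_sq_eq_abs]

/-- The side `i` is met when leaving the interface in direction `sgn i • n`. -/
lemma eventually_mem_part (i : Side) {x : Plane} (hx : x ∈ I.carrier) (hxQ : x ∈ Q.inner) :
    ∀ᶠ s in 𝓝[>] (0 : ℝ), x + (s * sgn i) • I.normal x ∈ I.part i := by
  obtain ⟨t, ht, rfl⟩ := hx
  filter_upwards [I.normal_side t ht hxQ] with s hs
  cases i
  · simpa [sgn, sub_eq_add_neg] using hs.2
  · simpa [sgn] using hs.1

/-- The inverse function theorem gives coordinates near $(t_0,0)$. In a small ball the rest of Γ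
stays away, so Γ is exactly the axis there. Each open half ball is connected and misses Γ, hence
lies in one part, and the normal at the centre decides which. -/
lemma exists_isStraight (i : Side) {a t₀ : ℝ} (ht₀ : t₀ ∈ Ioo a (a + 1)) (ha : I.IsChart a)
    (hxQ : I.curve t₀ ∈ Q.inner) : ∃ r > 0, I.IsStraight i a t₀ r := by
  set Φ := I.straight i t₀ with hΦ
  set y₀ := pt (t₀, 0) with hy₀
  have hΦ0 : Φ y₀ = I.curve t₀ := I.straight_pt_zero i t₀ t₀
  have hΦc : Continuous Φ := (I.contDiff_straight i t₀).continuous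
  have hpos : 0 < ∑ k, deriv I.curve t₀ k * deriv I.curve t₀ k := by
    have h1 := norm_pos_iff.2 (ha.ne_zero t₀ (Ioo_subset_Icc_self ht₀))
    rw [EuclideanSpace.norm_eq, Real.sqrt_pos] at h1
    simpa [sq] using h1
  have hdet : (I.straightDeriv i t₀ y₀).det ≠ 0 := by
    rw [det_straightDeriv]
    exact mul_ne_zero (sgn_ne_zero i) hpos.ne'
  have hfd : HasFDerivAt Φ
      ((I.straightDeriv i t₀ y₀).toContinuousLinearEquivOfDetNeZero hdet : Plane →L[ℝ] Plane)
      y₀ := I.hasFDerivAt_straight i t₀ y₀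
  set e := (I.contDiff_straight i t₀).contDiffAt.toOpenPartialHomeomorph Φ hfd (by simp) with he
  have hey₀ : y₀ ∈ e.source :=
    ContDiffAt.mem_toOpenPartialHomeomorph_source _ hfd (by simp)
  have hee : ∀ y, e y = Φ y := fun y => rfl
  -- the radius for the coordinates
  obtain ⟨r₁, hr₁, hr₁e⟩ := Metric.isOpen_iff.1 e.open_source y₀ hey₀
  -- the radius for the transversality
  have hcont : Continuous fun t => ∑ k, deriv I.curve t k * deriv I.curve t₀ k := by
    have := I.continuous_deriv
    fun_prop
  obtain ⟨r₂, hr₂, hr₂p⟩ := Metric.isOpen_iff.1 (isOpen_lt continuous_const hcont) t₀ hpos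
  -- the radius for the parameter interval
  obtain ⟨r₃, hr₃, hr₃p⟩ := Metric.isOpen_iff.1 isOpen_Ioo t₀ ht₀
  set δ := min r₁ r₃ with hδ
  have hδ0 : 0 < δ := lt_min hr₁ hr₃
  -- the rest of the curve stays away
  have hC : IsClosed (I.curve '' (Icc a (a + 1) \ Metric.ball t₀ δ)) :=
    ((isCompact_Icc.diff Metric.isOpen_ball).image I.continuous_curve).isClosed
  have hxC : Φ y₀ ∈ (I.curve '' (Icc a (a + 1) \ Metric.ball t₀ δ))ᶜ ∩ Q.inner := by
    rw [hΦ0]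
    refine ⟨?_, hxQ⟩
    rintro ⟨t, ht, htt⟩
    rw [ha.inj t ht.1 t₀ ht₀ htt] at ht
    exact ht.2 (Metric.mem_ball_self hδ0)
  obtain ⟨r₄, hr₄, hr₄p⟩ := Metric.isOpen_iff.1
    ((hC.isOpen_compl.inter Q.isOpen_inner).preimage hΦc) y₀ hxC
  set r := min (min r₂ r₄) δ with hr
  have hr0 : 0 < r := lt_min (lt_min hr₂ hr₄) hδ0
  have hrδ : r ≤ δ := min_le_right _ _
  have hr2 : r ≤ r₂ := (min_le_left _ _).trans (min_le_left _ _)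
  have hr4 : r ≤ r₄ := (min_le_left _ _).trans (min_le_right _ _)
  have hsrc : Metric.ball y₀ r ⊆ e.source :=
    (Metric.ball_subset_ball (hrδ.trans (min_le_left _ _))).trans hr₁e
  have hQ : ∀ y ∈ Metric.ball y₀ r, Φ y ∈ Q.inner := fun y hy =>
    (hr₄p (Metric.ball_subset_ball hr4 hy)).2
  have hIoo : ∀ t, |t - t₀| < r → t ∈ Ioo a (a + 1) := fun t ht =>
    hr₃p (by rw [Metric.mem_ball, Real.dist_eq]
             exact ht.trans_le (hrδ.trans (min_le_right _ _)))
  -- the curve in the coordinate domain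
  have hcurve : ∀ t ∈ Icc a (a + 1), ∀ y ∈ Metric.ball y₀ r, Φ y = I.curve t →
      y = pt (t, 0) := by
    intro t ht y hy hyt
    have h1 : t ∈ Metric.ball t₀ δ := by
      by_contra h
      exact (hr₄p (Metric.ball_subset_ball hr4 hy)).1 ⟨t, ⟨ht, h⟩, hyt.symm⟩
    have h2 : pt (t, 0) ∈ e.source := by
      refine hr₁e (pt_mem_ball.2 ?_)
      rw [Metric.mem_ball, Real.dist_eq] at h1
      exact h1.trans_le (min_le_left _ _)
    refine e.injOn (hsrc hy) h2 ?_
    rw [hee, hee, hyt]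
    exact (I.straight_pt_zero i t₀ t).symm
  have hoff : ∀ y ∈ Metric.ball y₀ r, y 1 ≠ 0 → Φ y ∈ I.part i ∪ I.part (!i) := by
    intro y hy hy1
    rw [I.part_union' i]
    refine ⟨hQ y hy, fun hyc => ?_⟩
    obtain ⟨t, ht, htt⟩ := ha.surj _ hyc
    have := hcurve t ht y hy htt.symm
    rw [this] at hy1
    exact hy1 rfl
  -- one side of the coordinate domain lies in one part
  have hside : ∀ (j : Side) (S : Set Plane), Convex ℝ S → S ⊆ Metric.ball y₀ r →
      (∀ y ∈ S, y 1 ≠ 0) → (∀ᶠ s in 𝓝[>] (0 : ℝ), pt (t₀, s * (sgn i * sgn j)) ∈ S) →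
      ∀ y ∈ S, Φ y ∈ I.part j := by
    intro j S hS hSb hS1 hev y hy
    have hpre : IsPreconnected (Φ '' S) := hS.isPreconnected.image _ hΦc.continuousOn
    have hn := ha.normal_eq t₀ (Ioo_subset_Icc_self ht₀)
    have hnorm := norm_pos_iff.2 (ha.ne_zero t₀ (Ioo_subset_Icc_self ht₀))
    -- The transversal vector is not normalised: a step `s` along it is a step `s * ‖deriv I.curve
    -- t₀‖` along the normal.
    have hlim : Tendsto (fun s : ℝ => s * ‖deriv I.curve t₀‖) (𝓝[>] 0) (𝓝[>] 0) := by
      refine tendsto_nhdsWithin_iff.2 ⟨?_, ?_⟩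
      · have : Tendsto (fun s : ℝ => s * ‖deriv I.curve t₀‖) (𝓝 0) (𝓝 0) := by
          simpa using (continuous_mul_const ‖deriv I.curve t₀‖).tendsto 0
        exact this.mono_left nhdsWithin_le_nhds
      · filter_upwards [self_mem_nhdsWithin] with s hs
        exact mul_pos hs hnorm
    have hev' := hlim.eventually (I.eventually_mem_part j
      (ha.mem t₀ (Ioo_subset_Icc_self ht₀)) hxQ)
    obtain ⟨s, hs1, hs2⟩ := (hev.and hev').exists
    have hpt : Φ (pt (t₀, s * (sgn i * sgn j))) ∈ I.part j := by
      convert hs2 using 1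
      rw [hΦ, straight, hn, transversal]
      simp only [pt_zero, pt_one, smul_smul]
      congr 2
      have h1 := sgn_mul_self i
      field_simp
      linear_combination s * sgn j * h1
    have hunion : Φ '' S ⊆ I.part j ∪ I.part (!j) := by
      rintro _ ⟨z, hz, rfl⟩
      rw [I.part_union' j, ← I.part_union' i]
      exact hoff z (hSb hz) (hS1 z hz)
    exact hpre.subset_left_of_subset_union (I.isOpen_part j) (I.isOpen_part _)
      (I.disjoint_part' j) hunion ⟨_, mem_image_of_mem _ hs1, hpt⟩ (mem_image_of_mem _ hy)
  have hconv : ∀ σ : ℝ, Convex ℝ {y : Plane | 0 < σ * y 1} := by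
    intro σ x hx y hy b c hb hc hbc
    have := (convex_Ioi (0 : ℝ)) hx hy hb hc hbc
    simp only [mem_Ioi, smul_eq_mul] at this
    simp only [mem_ofPred_eq, PiLp.add_apply, PiLp.smul_apply, smul_eq_mul]
    linarith
  have hsmall : ∀ σ : ℝ, σ * σ = 1 → ∀ᶠ s in 𝓝[>] (0 : ℝ),
      pt (t₀, s * σ) ∈ Metric.ball y₀ r ∩ {y : Plane | 0 < σ * y 1} := by
    intro σ hσ
    have h1 : Continuous fun s : ℝ => pt (t₀, s * σ) := continuous_pt.comp (by fun_prop)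
    have h2 : ∀ᶠ s in 𝓝 (0 : ℝ), pt (t₀, s * σ) ∈ Metric.ball y₀ r := by
      refine h1.continuousAt.eventually (Metric.isOpen_ball.mem_nhds ?_)
      simpa [hy₀] using hr0
    filter_upwards [nhdsWithin_le_nhds h2, self_mem_nhdsWithin] with s hs hs0
    refine ⟨hs, ?_⟩
    have : σ * (s * σ) = s := by linear_combination s * hσ
    simpa [this] using hs0
  refine ⟨r, hr0, ?_, ?_, ?_, hIoo, ?_, ?_, ?_, ?_⟩
  · exact e.injOn.mono hsrc
  · exact e.isOpen_image_of_subset_source Metric.isOpen_ball hsrc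
  · intro C hCs hCc
    have h1 : C ⊆ e.target := hCs.trans (by
      rw [← e.image_source_eq_target]
      exact image_mono hsrc)
    have h2 : IsCompact (e.symm '' C) := hCc.image_of_continuousOn (e.continuousOn_symm.mono h1)
    convert h2 using 1
    ext y
    constructor
    · rintro ⟨hy, hyC⟩
      exact ⟨Φ y, hyC, e.left_inv (hsrc hy)⟩
    · rintro ⟨x, hx, rfl⟩
      obtain ⟨y, hy, rfl⟩ := hCs hx
      rw [show e.symm (I.straight i t₀ y) = y from e.left_inv (hsrc hy)]
      exact ⟨hy, hx⟩
  · rintro t ht ⟨y, hy, hyt⟩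
    rw [hcurve t ht y hy hyt] at hy
    exact pt_mem_ball.1 hy
  · intro t ht
    refine hr₂p ?_
    rw [Metric.mem_ball, Real.dist_eq]
    exact ht.trans_le hr2
  · intro y hy hy1
    refine hside i (Metric.ball y₀ r ∩ {y : Plane | 0 < sgn i * sgn i * y 1})
      ((convex_ball _ _).inter (hconv _)) inter_subset_left (fun z hz hz1 => ?_)
      (hsmall _ (by rw [sgn_mul_self, one_mul])) y ⟨hy, ?_⟩
    · have := hz.2
      simp [hz1] at this
    · simpa [sgn_mul_self] using hy1
  · intro y hy hy1 hyi
    -- Points of the axis lie on Γ, which no part contains; points below it lie in the opposite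
    -- part.
    rcases eq_or_lt_of_le hy1 with hy0 | hy0
    · have h1 : y = pt (y 0, 0) := by
        rw [← hy0]
        exact (pt_coords y).symm
      rw [h1] at hyi hy
      rw [straight_pt_zero] at hyi
      exact (I.part_subset i hyi).2
        (ha.mem _ (Ioo_subset_Icc_self (hIoo _ (pt_mem_ball.1 hy))))
    · have h2 : sgn i * sgn (!i) = -1 := by rw [sgn_not, mul_neg, sgn_mul_self]
      refine (I.disjoint_part' i).le_bot ⟨hyi, hside (!i)
        (Metric.ball y₀ r ∩ {y : Plane | 0 < sgn i * sgn (!i) * y 1})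
        ((convex_ball _ _).inter (hconv _)) inter_subset_left (fun z hz hz1 => ?_)
        (hsmall _ (by rw [h2]; norm_num)) y ⟨hy, ?_⟩⟩
      · have := hz.2
        simp [hz1] at this
      · rw [mem_ofPred_eq, h2]
        linarith

end Interface

namespace Interface

variable {Q : Rect} (I : Interface Q)

/-! ### The divergence theorem for smooth functions with compact support -/

lemma notMem_part_of_mem {i : Side} {x : Plane} (hx : x ∈ I.part (!i)) : x ∉ I.part i :=
  fun h => (I.disjoint_part' i).le_bot ⟨h, hx⟩

/-- The function `φ` in straight coordinates. -/
def pullback (i : Side) (t₀ r : ℝ) (φ : Plane → ℝ) : Plane → ℝ :=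
  (Metric.ball (pt (t₀, 0)) r).indicator fun y => φ (I.straight i t₀ y)

lemma pullback_eventuallyEq (i : Side) (t₀ r : ℝ) (φ : Plane → ℝ) {y : Plane}
    (hy : y ∈ Metric.ball (pt (t₀, 0)) r) :
    I.pullback i t₀ r φ =ᶠ[𝓝 y] fun y => φ (I.straight i t₀ y) := by
  filter_upwards [Metric.isOpen_ball.mem_nhds hy] with z hz
  exact indicator_of_mem hz _

/-- The preimage of the support of `φ` is a compact subset of the open ball, so extension by zero
creates no singularity. -/
lemma IsStraight.pullback_spec {i : Side} {a t₀ r : ℝ} (h : I.IsStraight i a t₀ r)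
    {φ : Plane → ℝ} (hφ : IsTestFunction (I.straight i t₀ '' Metric.ball (pt (t₀, 0)) r) φ) :
    ContDiff ℝ 1 (I.pullback i t₀ r φ) ∧
      HasCompactSupport (I.pullback i t₀ r φ) ∧
      tsupport (I.pullback i t₀ r φ) ⊆ Metric.ball (pt (t₀, 0)) r := by
  have hK := h.isCompact_preimage _ hφ.2.2 hφ.2.1
  have hsub : tsupport (I.pullback i t₀ r φ) ⊆
      Metric.ball (pt (t₀, 0)) r ∩ I.straight i t₀ ⁻¹' tsupport φ := by
    refine closure_minimal ?_ hK.isClosed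
    intro y hy
    by_cases hyb : y ∈ Metric.ball (pt (t₀, 0)) r
    · refine ⟨hyb, subset_tsupport _ ?_⟩
      rw [Function.mem_support, pullback, indicator_of_mem hyb] at hy
      exact hy
    · rw [Function.mem_support, pullback, indicator_of_notMem hyb] at hy
      exact absurd rfl hy
  refine ⟨contDiff_iff_contDiffAt.2 fun y => ?_,
    hK.of_isClosed_subset (isClosed_tsupport _) hsub, hsub.trans inter_subset_left⟩
  by_cases hy : y ∈ tsupport (I.pullback i t₀ r φ)
  swap
  · exact contDiffAt_const.congr_of_eventuallyEq (notMem_tsupport_iff_eventuallyEq.1 hy)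
  refine ContDiffAt.congr_of_eventuallyEq ?_ (I.pullback_eventuallyEq i t₀ r φ (hsub hy).1)
  exact ((hφ.1.comp (I.contDiff_straight i t₀)).of_le (by simp)).contDiffAt

lemma fderiv_eq_sum (φ : Plane → ℝ) (x v : Plane) :
    fderiv ℝ φ x v = ∑ k, v k * partialDeriv k φ x := by
  have h : v = ∑ k, v k • basisVec k := by
    ext j
    fin_cases j <;> simp [Fin.sum_univ_two]
  conv_lhs => rw [h]
  simp [partialDeriv]

lemma partialDeriv_pullback (i : Side) (t₀ r : ℝ) {φ : Plane → ℝ} (hφ : ContDiff ℝ ∞ φ)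
    {y : Plane} (hy : y ∈ Metric.ball (pt (t₀, 0)) r) (j : Fin 2) :
    partialDeriv j (I.pullback i t₀ r φ) y =
      ∑ k, I.straightDeriv i t₀ y (basisVec j) k * partialDeriv k φ (I.straight i t₀ y) := by
  rw [partialDeriv_congr j (I.pullback_eventuallyEq i t₀ r φ hy), ← fderiv_eq_sum, partialDeriv]
  have h1 := (hφ.differentiable (by simp) (I.straight i t₀ y)).hasFDerivAt.comp y
    (I.hasFDerivAt_straight i t₀ y)
  have h2 := h1.fderiv
  simp only [Function.comp_def] at h2
  rw [h2]
  rfl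

/-- Change of variables to the half plane. By Cramer's rule $|\det D\Phi|\,\partial_k\varphi$
combines $\partial_0F$ with a constant coefficient and $\partial_1F$ with a coefficient that depends
on the first coordinate only. The first term integrates to zero and the second to the flux through
the axis. The sign reflects that `-sgn i • n` is the outer normal. -/
lemma IsStraight.integral_part {i : Side} {a t₀ r : ℝ} (ha : I.IsChart a)
    (h : I.IsStraight i a t₀ r) {φ : Plane → ℝ}
    (hφ : IsTestFunction (I.straight i t₀ '' Metric.ball (pt (t₀, 0)) r) φ) (k : Fin 2) :
    ∫ x in I.part i, partialDeriv k φ x =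
      - (sgn i * ∫ x, φ x * I.normal x k ∂I.arcLength) := by
  obtain ⟨hF, hFc, hFs⟩ := h.pullback_spec I hφ
  set B := Metric.ball (pt (t₀, 0)) r with hB
  set Φ := I.straight i t₀ with hΦ
  set F := I.pullback i t₀ r φ with hFdef
  set N := I.transversal i t₀ with hN
  have himage : Φ '' (B ∩ upper) = I.part i ∩ Φ '' B := by
    ext x
    constructor
    · rintro ⟨y, ⟨hy, hy1⟩, rfl⟩
      exact ⟨h.mem_part y hy hy1, mem_image_of_mem _ hy⟩
    · rintro ⟨hx, y, hy, rfl⟩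
      refine ⟨y, ⟨hy, ?_⟩, rfl⟩
      by_contra hy1
      exact h.notMem_part y hy (not_lt.1 hy1) hx
  have hUo : IsOpen (Φ '' B) := h.isOpen_image
  have h1 : ∫ x in I.part i, partialDeriv k φ x = ∫ x in Φ '' (B ∩ upper), partialDeriv k φ x := by
    rw [himage]
    refine setIntegral_eq_of_subset_of_forall_sdiff_eq_zero (I.isOpen_part i).measurableSet
      inter_subset_left fun x hx => ?_
    exact (hφ.partialDeriv k).eq_zero fun hxU => hx.2 ⟨hx.1, hxU⟩
  have hmeas : MeasurableSet (B ∩ upper) :=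
    (Metric.isOpen_ball.inter isOpen_upper).measurableSet
  have h2 := integral_image_eq_integral_abs_det_fderiv_smul volume hmeas
    (fun y _ => (I.hasFDerivAt_straight i t₀ y).hasFDerivWithinAt)
    (h.injOn.mono inter_subset_left) (partialDeriv k φ)
  have h3 : ∀ y ∈ B ∩ upper, |(I.straightDeriv i t₀ y).det| • partialDeriv k φ (Φ y) =
      sgn i * (-(rot N k) * partialDeriv 0 F y +
        rot (deriv I.curve (y 0)) k * partialDeriv 1 F y) := by
    rintro y ⟨hy, _⟩
    have hpos := h.inner_pos (y 0) (abs_coord_sub_lt hy 0)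
    have hdet : |(I.straightDeriv i t₀ y).det| = sgn i * (I.straightDeriv i t₀ y).det := by
      rw [det_straightDeriv, ← mul_assoc, sgn_mul_self, one_mul, abs_mul, abs_of_pos hpos]
      cases i <;> simp [sgn]
    have hd0 := I.partialDeriv_pullback i t₀ r hφ.1 hy 0
    have hd1 := I.partialDeriv_pullback i t₀ r hφ.1 hy 1
    rw [straightDeriv_basisVec_zero] at hd0
    rw [straightDeriv_basisVec_one] at hd1
    rw [hdet, det_straightDeriv, hFdef, hd0, hd1, smul_eq_mul, mul_assoc]
    congr 1
    simp only [Fin.sum_univ_two, hN, transversal, PiLp.smul_apply, smul_eq_mul, rot_zero,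
      rot_one, ← hΦ]
    fin_cases k
    · simp
      ring
    · simp
      ring
  have hF0 : ∀ y ∉ B, ∀ j, partialDeriv j F y = 0 := fun y hy j =>
    partialDeriv_eq_zero_of_notMem_tsupport j fun hy' => hy (hFs hy')
  rw [h1, hΦ, h2, setIntegral_congr_fun hmeas h3, integral_const_mul, inter_comm,
    ← setIntegral_eq_of_subset_of_forall_sdiff_eq_zero isOpen_upper.measurableSet
      inter_subset_left (fun y hy => by
        have hyB : y ∉ B := fun hyB => hy.2 ⟨hy.1, hyB⟩
        rw [hF0 y hyB, hF0 y hyB, mul_zero, mul_zero, add_zero])]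
  have hb : Continuous fun t => rot (deriv I.curve t) k :=
    (EuclideanSpace.proj (𝕜 := ℝ) k).continuous.comp (continuous_rot.comp I.continuous_deriv)
  have hi1 : Integrable (fun y : Plane => rot (deriv I.curve (y 0)) k * partialDeriv 1 F y) := by
    refine Continuous.integrable_of_hasCompactSupport
      ((hb.comp (by fun_prop)).mul (continuous_partialDeriv 1 hF)) ?_
    exact HasCompactSupport.mul_left (f := fun y : Plane => rot (deriv I.curve (y 0)) k)
      (hFc.of_isClosed_subset (isClosed_tsupport _) (tsupport_partialDeriv_subset 1 F))
  rw [integral_add ((integrable_partialDeriv 0 hF hFc).const_mul _).integrableOn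
    hi1.integrableOn, integral_const_mul, integral_upper_partialDeriv_zero hF hFc,
    integral_upper_partialDeriv_one hF hFc hb, ha.integral_eq k φ hφ.1.continuous, mul_zero,
    zero_add, mul_neg, neg_inj]
  congr 1
  -- For parameters at distance at least `r` from `t₀` both integrands vanish: the curve is outside
  -- the image of the ball there.
  rw [intervalIntegral.integral_of_le (by linarith), ← integral_Icc_eq_integral_Ioc,
    ← setIntegral_eq_integral_of_forall_compl_eq_zero (s := Icc a (a + 1))]
  · refine setIntegral_congr_fun measurableSet_Icc fun t ht => ?_
    simp only [hFdef, pullback]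
    by_cases htr : |t - t₀| < r
    · rw [indicator_of_mem (pt_mem_ball.2 htr), straight_pt_zero, mul_comm]
    · rw [indicator_of_notMem (fun hm => htr (pt_mem_ball.1 hm)),
        hφ.eq_zero fun hm => htr (h.of_mem_image t ht hm), zero_mul, mul_zero]
  · intro t ht
    have htr : ¬ |t - t₀| < r := fun htr => ht (Ioo_subset_Icc_self (h.mem_Ioo t htr))
    simp only [hFdef, pullback]
    rw [indicator_of_notMem (fun hm => htr (pt_mem_ball.1 hm)), mul_zero]

/-- Off Γ a neighbourhood can be taken inside one part; then the arc length integral vanishes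
because the test function is zero on Γ, and so does the volume integral. -/
lemma exists_isOpen_integral_part (i : Side) (k : Fin 2) {x : Plane} (hx : x ∈ Q.inner) :
    ∃ U, IsOpen U ∧ x ∈ U ∧ ∀ φ, IsTestFunction U φ → ∫ x in I.part i, partialDeriv k φ x =
      - (sgn i * ∫ x, φ x * I.normal x k ∂I.arcLength) := by
  have hzero : ∀ j φ, IsTestFunction (I.part j) φ →
      ∫ x, φ x * I.normal x k ∂I.arcLength = 0 := by
    intro j φ hφ
    refine integral_eq_zero_of_ae ?_
    filter_upwards [I.ae_mem_carrier] with y hy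
    rw [hφ.eq_zero fun h => (I.part_subset j h).2 hy, zero_mul, Pi.zero_apply]
  by_cases hxc : x ∈ I.carrier
  · obtain ⟨a, t₀, ht₀, rfl, ha⟩ := I.exists_isChart hxc hx
    obtain ⟨r, hr, h⟩ := I.exists_isStraight i ht₀ ha hx
    refine ⟨_, h.isOpen_image, ⟨pt (t₀, 0), Metric.mem_ball_self hr,
      I.straight_pt_zero i t₀ t₀⟩, fun φ hφ => h.integral_part I ha hφ k⟩
  · have hx' : x ∈ I.part i ∪ I.part (!i) := by
      rw [I.part_union' i]
      exact ⟨hx, hxc⟩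
    rcases hx' with hx' | hx'
    · refine ⟨I.part i, I.isOpen_part i, hx', fun φ hφ => ?_⟩
      rw [hzero i φ hφ, mul_zero, neg_zero, setIntegral_eq_integral_of_forall_compl_eq_zero
        (fun y hy => (hφ.partialDeriv k).eq_zero hy)]
      exact integral_partialDeriv_of_contDiff k (hφ.1.of_le (by simp)) hφ.2.1
    · refine ⟨I.part (!i), I.isOpen_part _, hx', fun φ hφ => ?_⟩
      rw [hzero _ φ hφ, mul_zero, neg_zero]
      refine setIntegral_eq_zero_of_forall_eq_zero fun y hy => ?_
      refine (hφ.partialDeriv k).eq_zero fun h => I.notMem_part_of_mem h hy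

/-- The divergence theorem on the two sides of the interface. -/
theorem integral_part_partialDeriv (i : Side) (k : Fin 2) {φ : Plane → ℝ}
    (hφ : IsTestFunction Q.inner φ) : ∫ x in I.part i, partialDeriv k φ x =
      - (sgn i * ∫ x, φ x * I.normal x k ∂I.arcLength) := by
  choose! U hUo hxU hU using fun x (hx : x ∈ Q.inner) => I.exists_isOpen_integral_part i k hx
  obtain ⟨s, hs⟩ := hφ.2.1.elim_finite_subcover (fun x : Q.inner => U x)
    (fun x => hUo x x.2) (fun x hx => mem_iUnion.2 ⟨⟨x, hφ.2.2 hx⟩, hxU x (hφ.2.2 hx)⟩)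
  -- Both sides are linear in `φ`, so a partition of unity on the compact support reduces the
  -- formula to its local versions.
  obtain ⟨f, hf⟩ := SmoothPartitionOfUnity.exists_isSubordinate (modelWithCornersSelf ℝ Plane)
    (isClosed_tsupport φ) (fun x : s => U x) (fun x => hUo x x.1.2) (fun x hx => by
      obtain ⟨y, hy, hxy⟩ := mem_iUnion₂.1 (hs hx)
      exact mem_iUnion.2 ⟨⟨y, hy⟩, hxy⟩)
  have hsum : ∀ x, φ x = ∑ j : s, f j x * φ x := by
    intro x
    by_cases hx : x ∈ tsupport φ
    · have := f.sum_eq_one hx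
      rw [finsum_eq_sum_of_fintype] at this
      rw [← Finset.sum_mul, this, one_mul]
    · rw [image_eq_zero_of_notMem_tsupport hx]
      simp
  have htest : ∀ j : s, IsTestFunction (U j) (fun x => f j x * φ x) := by
    intro j
    refine ⟨(f j).contMDiff.contDiff.mul hφ.1, hφ.2.1.mul_left, ?_⟩
    exact (tsupport_mul_subset_left).trans (hf j)
  have hd : ∀ x, partialDeriv k φ x = ∑ j : s, partialDeriv k (fun x => f j x * φ x) x := by
    intro x
    simp only [partialDeriv]
    conv_lhs => rw [funext hsum]
    rw [fderiv_fun_sum fun j _ => (htest j).1.differentiable (by simp) x]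
    simp
  have hint : ∀ j : s, Integrable (fun x => f j x * φ x * I.normal x k) I.arcLength := by
    intro j
    have h1 := memLp_of_continuous (μ := I.arcLength) I.isCompact_carrier I.ae_mem_carrier
      (htest j).1.continuous
    exact (I.memLp_mul_normal le_rfl h1 k).integrable one_le_two
  have h2 : ∫ x, φ x * I.normal x k ∂I.arcLength =
      ∑ j : s, ∫ x, f j x * φ x * I.normal x k ∂I.arcLength := by
    rw [← integral_finsetSum _ fun j _ => hint j]
    refine integral_congr_ae (Eventually.of_forall fun x => ?_)
    simp only
    rw [← Finset.sum_mul, ← hsum]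
  simp only [hd]
  rw [integral_finsetSum _ fun j _ => (integrable_partialDeriv k
    ((htest j).1.of_le (by simp)) (htest j).2.1).integrableOn, h2, Finset.mul_sum,
    ← Finset.sum_neg_distrib]
  exact Finset.sum_congr rfl fun j _ => hU j j.1.2 _ (htest j)

end Interface

/-! ### The mesh -/

namespace Mesh

variable {Q : Rect} (T : Mesh Q) (I : Interface Q)

lemma closed_subset {K : Rect} (hK : K ∈ T.elems) : K.closed ⊆ Q.closed := by
  rw [← T.iUnion_eq]
  exact subset_biUnion_of_mem (u := fun K : Rect => K.closed) hK

lemma inner_subset {K : Rect} (hK : K ∈ T.elems) : K.inner ⊆ Q.inner :=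
  Rect.inner_subset_inner (T.closed_subset hK)

lemma exists_mem_closed {x : Plane} (hx : x ∈ Q.closed) : ∃ K ∈ T.elems, x ∈ K.closed := by
  rw [← T.iUnion_eq] at hx
  simpa using hx

open Classical in
/-- The coordinates of the vertices of the mesh. -/
def coords : Finset ℝ :=
  T.elems.biUnion fun K => Finset.univ.image K.lo ∪ Finset.univ.image K.hi

lemma mem_inner_of_coords {x : Plane} (hx : ∀ j, x j ∉ T.coords) {K : Rect} (hK : K ∈ T.elems)
    (hxK : x ∈ K.closed) : x ∈ K.inner := by
  intro k
  have h1 : K.lo k ∈ T.coords :=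
    Finset.mem_biUnion.2 ⟨K, hK, Finset.mem_union_left _ (by simp)⟩
  have h2 : K.hi k ∈ T.coords :=
    Finset.mem_biUnion.2 ⟨K, hK, Finset.mem_union_right _ (by simp)⟩
  refine ⟨lt_of_le_of_ne (hxK k).1 ?_, lt_of_le_of_ne (hxK k).2 ?_⟩
  · rintro h
    exact hx k (h ▸ h1)
  · rintro h
    exact hx k (h ▸ h2)

lemma mem_sideElems {i : Side} {K : Rect} :
    K ∈ T.sideElems I i ↔ K ∈ T.elems ∧ (K.closed ∩ I.part i).Nonempty := by
  simp [sideElems]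

lemma mem_interfaceElems {K : Rect} :
    K ∈ T.interfaceElems I ↔ K ∈ T.elems ∧ (K.closed ∩ I.carrier).Nonempty := by
  simp [interfaceElems]

lemma exists_mem_sideElems {i : Side} {x : Plane} (hx : x ∈ I.part i) :
    ∃ K ∈ T.sideElems I i, x ∈ K.closed := by
  obtain ⟨K, hK, hxK⟩ := T.exists_mem_closed (Q.inner_subset_closed (I.part_subset i hx).1)
  exact ⟨K, (T.mem_sideElems I).2 ⟨hK, x, hxK, hx⟩, hxK⟩

lemma isClosed_fictDomain (i : Side) : IsClosed (T.fictDomain I i) :=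
  (T.sideElems I i).finite_toSet.isClosed_biUnion fun K _ => K.isClosed_closed

lemma closure_part_subset (i : Side) : closure (I.part i) ⊆ T.fictDomain I i := by
  refine closure_minimal (fun x hx => ?_) (T.isClosed_fictDomain I i)
  obtain ⟨K, hK, hxK⟩ := T.exists_mem_sideElems I hx
  exact mem_biUnion hK hxK

end Mesh

/-! ### Closures of the two parts and negligible points of the interface. -/

namespace Interface

variable {Q : Rect} (I : Interface Q)

lemma mem_closure_part (i : Side) {x : Plane} (hx : x ∈ I.carrier) (hxQ : x ∈ Q.inner) :
    x ∈ closure (I.part i) := by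
  have h1 : Tendsto (fun s : ℝ => x + (s * sgn i) • I.normal x) (𝓝[>] 0) (𝓝 x) := by
    have h2 : Continuous fun s : ℝ => x + (s * sgn i) • I.normal x := by fun_prop
    have h3 := h2.tendsto 0
    simp only [zero_mul, zero_smul, add_zero] at h3
    exact h3.mono_left nhdsWithin_le_nhds
  exact mem_closure_of_tendsto h1 (I.eventually_mem_part i hx hxQ)

lemma closure_part_subset_closed (i : Side) : closure (I.part i) ⊆ Q.closed :=
  closure_minimal (fun _ hx => Q.inner_subset_closed (I.part_subset i hx).1) Q.isClosed_closed

lemma isCompact_closure_part (i : Side) : IsCompact (closure (I.part i)) :=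
  Q.isCompact_closed.of_isClosed_subset isClosed_closure (I.closure_part_subset_closed i)

/-- The opposite part is open and disjoint from this one, so it contains no limit points of it. -/
lemma mem_carrier_or_bdry_of_mem_closure {i : Side} {x : Plane} (hx : x ∈ closure (I.part i))
    (hxi : x ∉ I.part i) : x ∈ I.carrier ∨ x ∈ Q.bdry := by
  by_contra h
  rw [not_or] at h
  have hxQ : x ∈ Q.inner := by
    by_contra hxQ
    exact h.2 ⟨I.closure_part_subset_closed i hx, hxQ⟩
  have h1 : x ∈ I.part i ∪ I.part (!i) := by
    rw [I.part_union' i]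
    exact ⟨hxQ, h.1⟩
  rcases h1 with h1 | h1
  · exact hxi h1
  · obtain ⟨y, hy, hy'⟩ := mem_closure_iff.1 hx _ (I.isOpen_part _) h1
    exact I.notMem_part_of_mem hy hy'

instance isFiniteMeasure_restrict_part (i : Side) :
    IsFiniteMeasure ((volume : Measure Plane).restrict (I.part i)) :=
  isFiniteMeasure_restrict_of_subset_isCompact (I.isCompact_closure_part i) subset_closure

variable {I} {T : Mesh Q} (hT : ∀ K ∈ T.elems, (I.carrier ∩ K.bdry).Finite)

include hT

/-- Γ meets the element boundaries in finitely many points, and points are null for arc length. The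
end points of an arc are discarded with them. -/
lemma ae_notMem_bdry : ∀ᵐ x ∂I.arcLength, ∀ K ∈ T.elems, x ∉ K.bdry := by
  rw [eventually_all_finset]
  intro K hK
  have h1 : ∀ᵐ x ∂I.arcLength, x ∉ I.carrier ∩ K.bdry := by
    rw [ae_iff]
    simpa using (hT K hK).measure_zero I.arcLength
  filter_upwards [h1, I.ae_mem_carrier] with x hx hxc hxK
  exact hx ⟨hxc, hxK⟩

lemma ae_mem_inner : ∀ᵐ x ∂I.arcLength, ∀ K ∈ T.elems, x ∈ K.closed → x ∈ K.inner := by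
  filter_upwards [ae_notMem_bdry hT] with x hx K hK hxK
  by_contra h
  exact hx K hK ⟨hxK, h⟩

lemma ae_mem_inner' : ∀ᵐ x ∂I.arcLength, x ∈ Q.inner := by
  filter_upwards [ae_mem_inner hT, I.ae_mem_carrier] with x hx hxc
  obtain ⟨K, hK, hxK⟩ := T.exists_mem_closed (I.carrier_subset hxc)
  exact T.inner_subset hK (hx K hK hxK)

lemma ae_mem_closure_part (i : Side) : ∀ᵐ x ∂I.arcLength, x ∈ closure (I.part i) := by
  filter_upwards [ae_mem_inner' hT, I.ae_mem_carrier] with x hx hxc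
  exact I.mem_closure_part i hxc hx

omit hT

lemma mem_sideElems_of_mem_inner {K : Rect} (hK : K ∈ T.elems) {x : Plane} (hx : x ∈ I.carrier)
    (hxK : x ∈ K.inner) (i : Side) : K ∈ T.sideElems I i := by
  obtain ⟨y, hy, hy'⟩ := mem_closure_iff.1 (I.mem_closure_part i hx (T.inner_subset hK hxK)) _
    K.isOpen_inner hxK
  exact (T.mem_sideElems I).2 ⟨hK, y, K.inner_subset_closed hy, hy'⟩

/-! ### Uniqueness of traces -/

section Trace

variable (I) {K : Rect}

lemma isOpen_cut (i : Side) : IsOpen (K.inner ∩ I.part i) :=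
  K.isOpen_inner.inter (I.isOpen_part i)

lemma ae_restrict_mem_closed : ∀ᵐ x ∂(I.arcLength.restrict K.closed), x ∈ K.closed :=
  ae_restrict_mem K.isClosed_closed.measurableSet

variable {I}

include hT

/-- The divergence theorem is applied to `ψ m * χ` with `χ` supported inside $K$. In the limit the
volume terms vanish, so each `g * n_k` integrates to zero against all `χ`. As $|\mathbf n|=1$, this
forces `g = 0`. -/
lemma IsTrace.ae_eq_zero (hK : K ∈ T.elems) {i : Side} {g : Plane → ℝ}
    (h : IsTrace (K.inner ∩ I.part i) (I.arcLength.restrict K.closed) 0 g) :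
    g =ᵐ[I.arcLength.restrict K.closed] 0 := by
  obtain ⟨hw, hg, ψ, hψ, h1, h2, h3⟩ := h
  set D := K.inner ∩ I.part i with hDdef
  set ν := I.arcLength.restrict K.closed with hν
  have hD : IsOpen D := I.isOpen_cut i
  have hDK : D ⊆ K.closed := inter_subset_left.trans K.inner_subset_closed
  have hνσ : ν ≤ I.arcLength := Measure.restrict_le_self
  have := isFiniteMeasure_restrict_of_subset_isCompact K.isCompact_closed hDK
  have hD' : ∀ᵐ x ∂(volume.restrict D), x ∈ K.closed := by
    rw [ae_restrict_iff' hD.measurableSet]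
    exact Eventually.of_forall hDK
  have hwp : ∀ k, weakPartial D k 0 =ᵐ[volume.restrict D] 0 := by
    intro k
    have h4 := hasWeakPartial_of_contDiff (D := D) k (q := 0) contDiff_const
    filter_upwards [h4.weakPartial_ae_eq hD] with x hx
    rw [hx]
    simp [partialDeriv]
  have hkey : ∀ k, ∀ᵐ x ∂ν, x ∈ K.inner → g x * I.normal x k = 0 := by
    intro k
    have hgn := I.memLp_mul_normal hνσ hg k
    refine K.isOpen_inner.ae_eq_zero_of_integral_contDiff_smul_eq_zero
      ((hgn.integrable one_le_two).locallyIntegrable.locallyIntegrableOn _) ?_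
    intro χ hχ1 hχ2 hχ3
    have hχ : IsTestFunction K.inner χ := ⟨hχ1, hχ2, hχ3⟩
    have hχ' := contDiff_partialDeriv k hχ1
    have hgreen : ∀ m, (∫ x in D, partialDeriv k (ψ m) x * χ x) +
        (∫ x in D, ψ m x * partialDeriv k χ x) =
          - (sgn i * ∫ x, ψ m x * (χ x * I.normal x k) ∂ν) := by
      intro m
      have ht : IsTestFunction K.inner (fun x => ψ m x * χ x) :=
        ⟨(hψ m).mul hχ1, hχ2.mul_left, (tsupport_mul_subset_right).trans hχ3⟩
      have h5 := I.integral_part_partialDeriv i k (ht.mono (T.inner_subset hK))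
      rw [setIntegral_eq_of_subset_of_forall_sdiff_eq_zero (s := D)
        (I.isOpen_part i).measurableSet inter_subset_right
        (fun x hx => (ht.partialDeriv k).eq_zero fun hxK => hx.2 ⟨hxK, hx.1⟩)] at h5
      rw [← integral_add]
      · refine Eq.trans (integral_congr_ae (Eventually.of_forall fun x => ?_)) (h5.trans ?_)
        · exact (partialDeriv_mul k ((hψ m).differentiable (by simp) x)
            (hχ1.differentiable (by simp) x)).symm
        · congr 2
          rw [hν, setIntegral_eq_integral_of_forall_compl_eq_zero]
          · simp only [mul_assoc]
          · intro x hx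
            rw [hχ.eq_zero fun h => hx (K.inner_subset_closed h), zero_mul, mul_zero]
      · exact (memLp_of_continuous K.isCompact_closed hD'
          (contDiff_partialDeriv k (hψ m)).continuous).integrable_mul
          (memLp_of_continuous K.isCompact_closed hD' hχ1.continuous)
      · exact (memLp_of_continuous K.isCompact_closed hD' (hψ m).continuous).integrable_mul
          (memLp_of_continuous K.isCompact_closed hD' hχ'.continuous)
    have hχν : MemLp χ 2 ν :=
      memLp_of_continuous K.isCompact_closed I.ae_restrict_mem_closed hχ1.continuous
    have l1 := tendsto_integral_mul
      (fun m => memLp_of_continuous K.isCompact_closed hD'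
        (contDiff_partialDeriv k (hψ m)).continuous)
      (hw.memLp_weakPartial hD k)
      (memLp_of_continuous K.isCompact_closed hD' hχ1.continuous) (h2 k)
    have l2 := tendsto_integral_mul
      (fun m => memLp_of_continuous K.isCompact_closed hD' (hψ m).continuous) hw.memLp
      (memLp_of_continuous K.isCompact_closed hD' hχ'.continuous) h1
    have l3 := tendsto_integral_mul
      (fun m => memLp_of_continuous K.isCompact_closed I.ae_restrict_mem_closed
        (hψ m).continuous) hg (I.memLp_mul_normal hνσ hχν k) h3
    have l4 := (l1.add l2).congr hgreen
    have l5 := tendsto_nhds_unique l4 (l3.const_mul (sgn i)).neg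
    have h6 : ∫ x in D, weakPartial D k 0 x * χ x = 0 := by
      refine integral_eq_zero_of_ae ?_
      filter_upwards [hwp k] with x hx
      simp [hx]
    simp only [h6, Pi.zero_apply, zero_mul, integral_zero, add_zero] at l5
    have l6 : ∫ x, g x * (χ x * I.normal x k) ∂ν = 0 := by
      have := neg_eq_zero.1 l5.symm
      exact (mul_eq_zero.1 this).resolve_left (sgn_ne_zero i)
    rw [← l6]
    congr 1 with x
    simp only [smul_eq_mul]
    ring
  have hac : ν ≪ I.arcLength := Measure.absolutelyContinuous_of_le hνσ
  -- Functions supported in the open element detect almost every point of $\Gamma_K$, since Γ meets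
  -- the boundary of $K$ in a null set.
  filter_upwards [hkey 0, hkey 1, I.ae_restrict_mem_closed, hac.ae_le (ae_mem_inner hT),
    hac.ae_le I.ae_mem_carrier] with x hx0 hx1 hxK hxin hxc
  have hxK' := hxin K hK hxK
  have hn := I.norm_normal hxc
  by_contra hgx
  have hg0 : g x ≠ 0 := hgx
  have hn0 := (mul_eq_zero.1 (hx0 hxK')).resolve_left hg0
  have hn1 := (mul_eq_zero.1 (hx1 hxK')).resolve_left hg0
  rw [EuclideanSpace.norm_eq, Fin.sum_univ_two, hn0, hn1] at hn
  simp at hn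

lemma IsTrace.ae_eq (hK : K ∈ T.elems) {i : Side} {w g g' : Plane → ℝ}
    (h : IsTrace (K.inner ∩ I.part i) (I.arcLength.restrict K.closed) w g)
    (h' : IsTrace (K.inner ∩ I.part i) (I.arcLength.restrict K.closed) w g') :
    g =ᵐ[I.arcLength.restrict K.closed] g' := by
  have h1 := h.sub (I.isOpen_cut i) h'
  rw [sub_self] at h1
  filter_upwards [IsTrace.ae_eq_zero hT hK h1] with x hx
  exact sub_eq_zero.1 hx

lemma traceOn_ae_eq (hK : K ∈ T.elems) {i : Side} {w g : Plane → ℝ}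
    (h : IsTrace (K.inner ∩ I.part i) (I.arcLength.restrict K.closed) w g) :
    traceOn I K i w =ᵐ[I.arcLength.restrict K.closed] g :=
  IsTrace.ae_eq hT hK h.isTrace_trace h

end Trace

end Interface

/-! ### Discrete functions -/

lemma IsQp.contDiff {p : ℕ} {q : Plane → ℝ} (hq : IsQp p q) : ContDiff ℝ ∞ q := by
  obtain ⟨a, ha⟩ := hq
  rw [funext ha]
  have h0 : ContDiff ℝ ∞ fun y : Plane => y 0 :=
    (EuclideanSpace.proj (𝕜 := ℝ) (0 : Fin 2)).contDiff
  have h1 : ContDiff ℝ ∞ fun y : Plane => y 1 :=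
    (EuclideanSpace.proj (𝕜 := ℝ) (1 : Fin 2)).contDiff
  exact ContDiff.sum fun i _ => ContDiff.sum fun j _ =>
    (contDiff_const.mul (h0.pow _)).mul (h1.pow _)

lemma exists_forall_norm_le {K : Set Plane} (hK : IsCompact K) {w : Plane → ℝ}
    (hw : ContinuousOn w K) : ∃ C, 0 ≤ C ∧ ∀ x ∈ K, ‖w x‖ ≤ C := by
  obtain ⟨C, hC⟩ := hK.exists_bound_of_continuousOn hw
  exact ⟨max C 0, le_max_right _ _, fun x hx => (hC x hx).trans (le_max_left _ _)⟩

section Discrete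

variable {Q : Rect} {T : Mesh Q} {I : Interface Q} {p : ℕ} {v : Side → Plane → ℝ}

lemma exists_polynomials (hv : v ∈ discreteSpace₀ T I p) (i : Side) :
    ∃ q : Rect → Plane → ℝ, (∀ K, ContDiff ℝ ∞ (q K)) ∧
      ∀ K ∈ T.sideElems I i, EqOn (v i) (q K) K.closed := by
  classical
  have h := (hv.1 i).2
  choose! q hq using h
  -- The value 0 on all other rectangles makes every member of the family smooth without side
  -- conditions.
  refine ⟨fun K => if K ∈ T.sideElems I i then q K else 0, fun K => ?_, fun K hK => ?_⟩
  · dsimp only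
    split_ifs with hK
    · exact (hq K hK).1.contDiff
    · exact contDiff_const
  · simp only [hK, if_true]
    exact (hq K hK).2

lemma continuousOn_closure_part (hv : v ∈ discreteSpace₀ T I p) (i : Side) :
    ContinuousOn (v i) (closure (I.part i)) :=
  (hv.1 i).1.mono (T.closure_part_subset I i)

lemma exists_bound (hv : v ∈ discreteSpace₀ T I p) (i : Side) :
    ∃ C, 0 ≤ C ∧ ∀ x ∈ closure (I.part i), ‖v i x‖ ≤ C :=
  exists_forall_norm_le (I.isCompact_closure_part i) (continuousOn_closure_part hv i)

lemma eventuallyEq_of_mem_inner {i : Side} {q : Rect → Plane → ℝ}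
    (hq : ∀ K ∈ T.sideElems I i, EqOn (v i) (q K) K.closed) {K : Rect}
    (hK : K ∈ T.sideElems I i) {x : Plane} (hx : x ∈ K.inner) : v i =ᶠ[𝓝 x] q K := by
  filter_upwards [K.isOpen_inner.mem_nhds hx] with y hy
  exact hq K hK (K.inner_subset_closed hy)

lemma ae_exists_mem_inner (i : Side) : ∀ᵐ x ∂(volume.restrict (I.part i)),
    x ∈ I.part i ∧ ∃ K ∈ T.sideElems I i, x ∈ K.inner := by
  filter_upwards [ae_restrict_mem (I.isOpen_part i).measurableSet,
    ae_restrict_of_ae (ae_coord_notMem T.coords)] with x hx hxZ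
  obtain ⟨K, hK, hxK⟩ := T.exists_mem_sideElems I hx
  exact ⟨hx, K, hK, T.mem_inner_of_coords hxZ ((T.mem_sideElems I).1 hK).1 hxK⟩

lemma exists_bound_partialDeriv (hv : v ∈ discreteSpace₀ T I p) (i : Side) (k : Fin 2) :
    ∃ C, 0 ≤ C ∧ ∀ᵐ x ∂(volume.restrict (I.part i)), ‖partialDeriv k (v i) x‖ ≤ C := by
  obtain ⟨q, hq, hqv⟩ := exists_polynomials hv i
  choose C hC0 hC using fun K : Rect => exists_forall_norm_le K.isCompact_closed
    (contDiff_partialDeriv k (hq K)).continuous.continuousOn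
  -- The sum of the bounds on the elements serves as their maximum.
  refine ⟨∑ K ∈ T.sideElems I i, C K, Finset.sum_nonneg fun K _ => hC0 K, ?_⟩
  filter_upwards [ae_exists_mem_inner (T := T) i] with x hx
  obtain ⟨_, K, hK, hxK⟩ := hx
  rw [partialDeriv_congr k (eventuallyEq_of_mem_inner hqv hK hxK)]
  exact (hC K x (K.inner_subset_closed hxK)).trans
    (Finset.single_le_sum (fun K _ => hC0 K) hK)

lemma memLp_discrete (hv : v ∈ discreteSpace₀ T I p) (i : Side) :
    MemLp (v i) 2 (volume.restrict (I.part i)) := by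
  obtain ⟨C, _, hC⟩ := exists_bound hv i
  refine MemLp.of_bound (((continuousOn_closure_part hv i).mono
    subset_closure).aestronglyMeasurable (I.isOpen_part i).measurableSet) C ?_
  filter_upwards [ae_restrict_mem (I.isOpen_part i).measurableSet] with x hx
  exact hC x (subset_closure hx)

lemma memLp_partialDeriv_discrete (hv : v ∈ discreteSpace₀ T I p) (i : Side) (k : Fin 2) :
    MemLp (partialDeriv k (v i)) 2 (volume.restrict (I.part i)) := by
  obtain ⟨C, _, hC⟩ := exists_bound_partialDeriv hv i k
  exact MemLp.of_bound (measurable_partialDeriv k _).aestronglyMeasurable C hC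

lemma memLp_arcLength_discrete (hT : ∀ K ∈ T.elems, (I.carrier ∩ K.bdry).Finite)
    (hv : v ∈ discreteSpace₀ T I p) (i : Side) : MemLp (v i) 2 I.arcLength := by
  obtain ⟨C, _, hC⟩ := exists_bound hv i
  have hae := I.ae_mem_closure_part hT i
  refine MemLp.of_bound ?_ C (hae.mono hC)
  have h1 := (continuousOn_closure_part hv i).aestronglyMeasurable (μ := I.arcLength)
    isClosed_closure.measurableSet
  rwa [Measure.restrict_eq_self_of_ae_mem hae] at h1

/-! ### Integration by parts away from the interface -/

/-- At Γ the extension by zero is continuous because `ψ` vanishes nearby, at ∂Ω because `v i` does;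
there is no other boundary. The boundary condition of the discrete space enters here. -/
lemma continuous_indicator_part (hv : v ∈ discreteSpace₀ T I p) (i : Side) {ψ : Plane → ℝ}
    (hψ : ContDiff ℝ ∞ ψ) (hψ0 : ∀ x ∈ I.carrier, ψ =ᶠ[𝓝 x] 0) :
    Continuous ((I.part i).indicator fun x => ψ x * v i x) := by
  rw [continuous_iff_continuousAt]
  intro x
  by_cases hxi : x ∈ I.part i
  · have h1 : ContinuousAt (v i) x := ((continuousOn_closure_part hv i).mono
      subset_closure).continuousAt ((I.isOpen_part i).mem_nhds hxi)
    refine (hψ.continuous.continuousAt.mul h1).congr ?_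
    filter_upwards [(I.isOpen_part i).mem_nhds hxi] with y hy
    exact (indicator_of_mem hy (fun x => ψ x * v i x)).symm
  by_cases hxcl : x ∈ closure (I.part i)
  · rcases I.mem_carrier_or_bdry_of_mem_closure hxcl hxi with hxc | hxb
    · refine continuousAt_const.congr (f := fun _ => (0 : ℝ)) ?_
      filter_upwards [hψ0 x hxc] with y hy
      by_cases hyi : y ∈ I.part i
      · rw [indicator_of_mem hyi, hy, Pi.zero_apply, zero_mul]
      · rw [indicator_of_notMem hyi]
    · have hvx : v i x = 0 := hv.2 i x ⟨hxb, hxcl⟩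
      rw [ContinuousAt, indicator_of_notMem hxi]
      have h1 : Tendsto (fun y => ψ y * v i y) (𝓝[I.part i] x) (𝓝 0) := by
        have h2 := (hψ.continuous.continuousWithinAt (s := I.part i) (x := x)).mul
          (((continuousOn_closure_part hv i) x hxcl).mono subset_closure)
        have h3 := h2.tendsto
        rw [Pi.mul_apply, hvx, mul_zero] at h3
        exact h3
      refine Metric.tendsto_nhds.2 fun ε hε => ?_
      have h4 := Metric.tendsto_nhds.1 h1 ε hε
      rw [eventually_nhdsWithin_iff] at h4
      filter_upwards [h4] with y hy
      by_cases hyi : y ∈ I.part i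
      · rw [indicator_of_mem hyi]
        exact hy hyi
      · rw [indicator_of_notMem hyi, dist_self]
        exact hε
  · refine continuousAt_const.congr (f := fun _ => (0 : ℝ)) ?_
    filter_upwards [isClosed_closure.isOpen_compl.mem_nhds hxcl] with y hy
    rw [indicator_of_notMem fun h => hy (subset_closure h)]

lemma differentiableAt_indicator_part (hv : v ∈ discreteSpace₀ T I p) (i : Side) {ψ : Plane → ℝ}
    (hψ : ContDiff ℝ ∞ ψ) (hψ0 : ∀ x ∈ I.carrier, ψ =ᶠ[𝓝 x] 0) {x : Plane}
    (hx : ∀ j, x j ∉ T.coords) :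
    DifferentiableAt ℝ ((I.part i).indicator fun x => ψ x * v i x) x ∧
      ∀ k, partialDeriv k ((I.part i).indicator fun x => ψ x * v i x) x =
        (I.part i).indicator
          (fun x => partialDeriv k ψ x * v i x + ψ x * partialDeriv k (v i) x) x := by
  obtain ⟨q, hq, hqv⟩ := exists_polynomials hv i
  by_cases hxi : x ∈ I.part i
  · obtain ⟨K, hK, hxK⟩ := T.exists_mem_sideElems I hxi
    have hxK' := T.mem_inner_of_coords hx ((T.mem_sideElems I).1 hK).1 hxK
    have hvd : DifferentiableAt ℝ (v i) x :=
      ((hq K).differentiable (by simp) x).congr_of_eventuallyEq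
        (eventuallyEq_of_mem_inner hqv hK hxK')
    have hψd := hψ.differentiable (by simp) x
    have heq : ((I.part i).indicator fun x => ψ x * v i x) =ᶠ[𝓝 x] fun x => ψ x * v i x := by
      filter_upwards [(I.isOpen_part i).mem_nhds hxi] with y hy
      exact indicator_of_mem hy _
    refine ⟨(hψd.mul hvd).congr_of_eventuallyEq heq, fun k => ?_⟩
    rw [partialDeriv_congr k heq, partialDeriv_mul k hψd hvd, indicator_of_mem hxi]
  · have heq : ((I.part i).indicator fun x => ψ x * v i x) =ᶠ[𝓝 x] fun _ => 0 := by
      by_cases hxcl : x ∈ closure (I.part i)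
      · rcases I.mem_carrier_or_bdry_of_mem_closure hxcl hxi with hxc | hxb
        · filter_upwards [hψ0 x hxc] with y hy
          by_cases hyi : y ∈ I.part i
          · rw [indicator_of_mem hyi, hy, Pi.zero_apply, zero_mul]
          · rw [indicator_of_notMem hyi]
        -- Points of ∂Ω lie on mesh lines, so this case cannot occur.
        · obtain ⟨K, hK, hxK⟩ := T.exists_mem_closed hxb.1
          exact absurd (T.inner_subset hK (T.mem_inner_of_coords hx hK hxK)) hxb.2
      · filter_upwards [isClosed_closure.isOpen_compl.mem_nhds hxcl] with y hy
        rw [indicator_of_notMem fun h => hy (subset_closure h)]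
    refine ⟨(differentiableAt_const 0).congr_of_eventuallyEq heq, fun k => ?_⟩
    rw [partialDeriv_congr k heq, indicator_of_notMem hxi]
    simp [partialDeriv]

/-- `ψ` and its partial derivatives are square integrable on each side. -/
lemma memLp_part_of_continuous (i : Side) {ψ : Plane → ℝ} (hψ : Continuous ψ) :
    MemLp ψ 2 (volume.restrict (I.part i)) := by
  refine memLp_of_continuous (I.isCompact_closure_part i) ?_ hψ
  filter_upwards [ae_restrict_mem (I.isOpen_part i).measurableSet] with x hx
  exact subset_closure hx

lemma memLp_arcLength_of_continuous {ψ : Plane → ℝ} (hψ : Continuous ψ) :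
    MemLp ψ 2 I.arcLength :=
  memLp_of_continuous I.isCompact_carrier I.ae_mem_carrier hψ

lemma integrable_green (hv : v ∈ discreteSpace₀ T I p) (i : Side) (k : Fin 2) {ψ : Plane → ℝ}
    (hψ : ContDiff ℝ ∞ ψ) :
    Integrable (fun x => partialDeriv k ψ x * v i x + ψ x * partialDeriv k (v i) x)
      (volume.restrict (I.part i)) :=
  ((memLp_part_of_continuous i (contDiff_partialDeriv k hψ).continuous).integrable_mul
    (memLp_discrete hv i)).add
    ((memLp_part_of_continuous i hψ.continuous).integrable_mul
      (memLp_partialDeriv_discrete hv i k))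

/-- The integrand is almost everywhere the derivative of the extension of `ψ * v i` by zero, which
is continuous with compact support and differentiable off the mesh lines. -/
lemma integral_green_eq_zero (hv : v ∈ discreteSpace₀ T I p) (i : Side) (k : Fin 2)
    {ψ : Plane → ℝ} (hψ : ContDiff ℝ ∞ ψ) (hψ0 : ∀ x ∈ I.carrier, ψ =ᶠ[𝓝 x] 0) :
    ∫ x in I.part i, (partialDeriv k ψ x * v i x + ψ x * partialDeriv k (v i) x) = 0 := by
  have hcs : HasCompactSupport ((I.part i).indicator fun x => ψ x * v i x) := by
    refine HasCompactSupport.intro Q.isCompact_closed fun x hx => ?_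
    rw [indicator_of_notMem fun h => hx (Q.inner_subset_closed (I.part_subset i h).1)]
  have hae : (fun x => partialDeriv k ((I.part i).indicator fun x => ψ x * v i x) x) =ᵐ[volume]
      (I.part i).indicator
        (fun x => partialDeriv k ψ x * v i x + ψ x * partialDeriv k (v i) x) := by
    filter_upwards [ae_coord_notMem T.coords] with x hx
    exact (differentiableAt_indicator_part hv i hψ hψ0 hx).2 k
  have hm := (I.isOpen_part i).measurableSet
  rw [← integral_indicator hm, ← integral_congr_ae hae]
  refine integral_partialDeriv_eq_zero k (continuous_indicator_part hv i hψ hψ0) hcs T.coords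
    (fun x hx => (differentiableAt_indicator_part hv i hψ hψ0 hx).1) ?_
  exact ((integrable_indicator_iff hm).2 (integrable_green hv i k hψ)).congr hae.symm

/-- The weak derivatives of a discrete function are its piecewise derivatives. -/
lemma hasWeakPartial_discrete (hv : v ∈ discreteSpace₀ T I p) (i : Side) (k : Fin 2) :
    HasWeakPartial (I.part i) k (v i) (partialDeriv k (v i)) := by
  have h1 := memLp_discrete hv i
  have h2 := memLp_partialDeriv_discrete hv i k
  refine ⟨locallyIntegrableOn_of_locallyIntegrable_restrict
      (h1.integrable one_le_two).locallyIntegrable,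
    locallyIntegrableOn_of_locallyIntegrable_restrict
      (h2.integrable one_le_two).locallyIntegrable, fun φ hφ => ?_⟩
  -- A test function on the open part vanishes near Γ, which is disjoint from that part.
  have h3 := integral_green_eq_zero hv i k hφ.1 fun x hx => by
    refine notMem_tsupport_iff_eventuallyEq.1 fun h => ?_
    exact (I.part_subset i (hφ.2.2 h)).2 hx
  rw [integral_add] at h3
  · rw [eq_neg_iff_add_eq_zero, ← h3]
    congr 1
    · congr 1 with x
      ring
    · congr 1 with x
      ring
  · exact (memLp_part_of_continuous i (contDiff_partialDeriv k hφ.1).continuous).integrable_mul h1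
  · exact (memLp_part_of_continuous i hφ.1.continuous).integrable_mul h2

lemma memSobolev_discrete (hv : v ∈ discreteSpace₀ T I p) (i : Side) :
    MemSobolev (I.part i) 1 (v i) :=
  memSobolev_one_iff.2 ⟨memLp_discrete hv i, fun k =>
    ⟨_, hasWeakPartial_discrete hv i k, memLp_partialDeriv_discrete hv i k⟩⟩

lemma weakPartial_discrete_ae_eq (hv : v ∈ discreteSpace₀ T I p) (i : Side) (k : Fin 2) :
    weakPartial (I.part i) k (v i) =ᵐ[volume.restrict (I.part i)] partialDeriv k (v i) :=
  (hasWeakPartial_discrete hv i k).weakPartial_ae_eq (I.isOpen_part i)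

end Discrete

/-! ### Green's formula for discrete functions -/

/-- A smooth cutoff function for a compact subset of an open set. -/
lemma exists_cutoff {C U : Set Plane} (hC : IsCompact C) (hU : IsOpen U) (hCU : C ⊆ U) :
    ∃ χ, IsTestFunction U χ ∧ ∀ x ∈ C, χ =ᶠ[𝓝 x] 1 := by
  obtain ⟨L, hL, hCL, hLU⟩ := exists_compact_between hC hU hCU
  obtain ⟨f, hf1, hf0, _⟩ := exists_contMDiffMap_one_nhds_of_subset_interior
    (modelWithCornersSelf ℝ Plane) (n := (⊤ : ℕ∞)) hC.isClosed hCL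
  have hsub : tsupport f ⊆ L := by
    refine closure_minimal (fun x hx => ?_) hL.isClosed
    by_contra h
    exact hx (hf0 x h)
  refine ⟨f, ⟨f.contMDiff.contDiff, hL.of_isClosed_subset (isClosed_tsupport _) hsub,
    hsub.trans hLU⟩, fun x hx => ?_⟩
  exact hf1.filter_mono (nhds_le_nhdsSet hx)

section Green

variable {Q : Rect} {T : Mesh Q} {I : Interface Q} {p : ℕ} {v : Side → Plane → ℝ}

variable (I v) in
/-- The defect in Green's formula. -/
def greenDefect (i : Side) (k : Fin 2) (ψ : Plane → ℝ) : ℝ :=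
  (∫ x in I.part i, (partialDeriv k ψ x * v i x + ψ x * partialDeriv k (v i) x)) +
    sgn i * ∫ x, ψ x * (v i x * I.normal x k) ∂I.arcLength

variable (hT : ∀ K ∈ T.elems, (I.carrier ∩ K.bdry).Finite) (hv : v ∈ discreteSpace₀ T I p)

include hT hv

lemma memLp_mul_normal_discrete (i : Side) (k : Fin 2) :
    MemLp (fun x => v i x * I.normal x k) 2 I.arcLength :=
  I.memLp_mul_normal le_rfl (memLp_arcLength_discrete hT hv i) k

lemma greenDefect_sub (i : Side) (k : Fin 2) {ψ χ : Plane → ℝ} (hψ : ContDiff ℝ ∞ ψ)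
    (hχ : ContDiff ℝ ∞ χ) : greenDefect I v i k (fun x => ψ x - χ x) =
      greenDefect I v i k ψ - greenDefect I v i k χ := by
  have h1 : ∀ x, partialDeriv k (fun x => ψ x - χ x) x * v i x +
      (ψ x - χ x) * partialDeriv k (v i) x =
      (partialDeriv k ψ x * v i x + ψ x * partialDeriv k (v i) x) -
        (partialDeriv k χ x * v i x + χ x * partialDeriv k (v i) x) := by
    intro x
    rw [partialDeriv_sub k (hψ.differentiable (by simp) x) (hχ.differentiable (by simp) x)]
    ring
  have hn := memLp_mul_normal_discrete hT hv i k
  have h2 : ∀ x, (ψ x - χ x) * (v i x * I.normal x k) =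
      ψ x * (v i x * I.normal x k) - χ x * (v i x * I.normal x k) := fun x => sub_mul _ _ _
  simp only [greenDefect, h1, h2]
  rw [integral_sub (integrable_green hv i k hψ) (integrable_green hv i k hχ),
    integral_sub (f := fun x => ψ x * (v i x * I.normal x k))
      (g := fun x => χ x * (v i x * I.normal x k))
      ((memLp_arcLength_of_continuous hψ.continuous).integrable_mul hn)
      ((memLp_arcLength_of_continuous hχ.continuous).integrable_mul hn)]
  ring

lemma greenDefect_sub_sum (i : Side) (k : Fin 2) {ψ : Plane → ℝ} (hψ : ContDiff ℝ ∞ ψ)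
    {χ : Rect → Plane → ℝ} (S : Finset Rect) (hχ : ∀ K ∈ S, ContDiff ℝ ∞ (χ K)) :
    greenDefect I v i k (fun x => ψ x - ∑ K ∈ S, χ K x) =
      greenDefect I v i k ψ - ∑ K ∈ S, greenDefect I v i k (χ K) := by
  classical
  induction S using Finset.induction_on with
  | empty => simp
  | insert K S hK ih =>
    simp only [Finset.sum_insert hK]
    have h1 : ContDiff ℝ ∞ fun x => ψ x - ∑ L ∈ S, χ L x :=
      hψ.sub (ContDiff.sum fun L hL => hχ L (Finset.mem_insert_of_mem hL))
    have h2 := greenDefect_sub hT hv i k h1 (hχ K (Finset.mem_insert_self K S))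
    rw [ih fun L hL => hχ L (Finset.mem_insert_of_mem hL)] at h2
    rw [← sub_sub, sub_right_comm, ← h2]
    congr 1
    ext x
    ring

omit hT in
-- On one element `v i` is a polynomial, so `ψ * v i` is itself a test function in Ω and the
-- divergence theorem applies.
lemma greenDefect_eq_zero_of_test {i : Side} (k : Fin 2) {K : Rect}
    (hK : K ∈ T.sideElems I i) {ψ : Plane → ℝ} (hψ : IsTestFunction K.inner ψ) :
    greenDefect I v i k ψ = 0 := by
  obtain ⟨q, hq, hqv⟩ := exists_polynomials hv i
  have hvq := hqv K hK
  have htest : IsTestFunction K.inner fun x => ψ x * q K x :=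
    ⟨hψ.1.mul (hq K), hψ.2.1.mul_right, (tsupport_mul_subset_left).trans hψ.2.2⟩
  have h1 := I.integral_part_partialDeriv i k
    (htest.mono (T.inner_subset ((T.mem_sideElems I).1 hK).1))
  rw [greenDefect]
  have h2 : ∀ x, partialDeriv k ψ x * v i x + ψ x * partialDeriv k (v i) x =
      partialDeriv k (fun x => ψ x * q K x) x := by
    intro x
    rw [partialDeriv_mul k (hψ.1.differentiable (by simp) x) ((hq K).differentiable (by simp) x)]
    by_cases hx : x ∈ K.inner
    · have h3 := eventuallyEq_of_mem_inner hqv hK hx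
      rw [h3.eq_of_nhds, partialDeriv_congr k h3]
    · rw [(hψ.partialDeriv k).eq_zero hx, hψ.eq_zero hx]
      simp
  have h3 : ∀ x, ψ x * (v i x * I.normal x k) = ψ x * q K x * I.normal x k := by
    intro x
    by_cases hx : x ∈ K.inner
    · rw [hvq (K.inner_subset_closed hx)]
      ring
    · rw [hψ.eq_zero hx]
      simp
  simp only [h2, h3, h1]
  ring

omit hT in
lemma greenDefect_eq_zero_of_eventuallyEq_zero (i : Side) (k : Fin 2) {ψ : Plane → ℝ}
    (hψ : ContDiff ℝ ∞ ψ) (hψ0 : ∀ x ∈ I.carrier, ψ =ᶠ[𝓝 x] 0) :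
    greenDefect I v i k ψ = 0 := by
  rw [greenDefect, integral_green_eq_zero hv i k hψ hψ0, zero_add]
  refine mul_eq_zero_of_right _ (integral_eq_zero_of_ae ?_)
  filter_upwards [I.ae_mem_carrier] with x hx
  rw [(hψ0 x hx).eq_of_nhds]
  simp

/-- Green's formula if the smooth factor vanishes where the interface meets the edges. -/
lemma greenDefect_eq_zero_of_skeleton (i : Side) (k : Fin 2) {ψ : Plane → ℝ}
    (hψ : ContDiff ℝ ∞ ψ)
    (hψ0 : ∀ K ∈ T.elems, ∀ x ∈ I.carrier ∩ K.bdry, ψ =ᶠ[𝓝 x] 0) :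
    greenDefect I v i k ψ = 0 := by
  -- On the support of `ψ`, Γ stays off the element boundaries, so its piece in each element is a
  -- compact subset of the open element.
  have hC : ∀ K ∈ T.elems, I.carrier ∩ tsupport ψ ∩ K.closed ⊆ K.inner := by
    rintro K hK x ⟨⟨hx, hxψ⟩, hxK⟩
    by_contra h
    exact notMem_tsupport_iff_eventuallyEq.2 (hψ0 K hK x ⟨hx, hxK, h⟩) hxψ
  have hex : ∀ K ∈ T.elems, ∃ χ, IsTestFunction K.inner χ ∧
      ∀ x ∈ I.carrier ∩ tsupport ψ ∩ K.closed, χ =ᶠ[𝓝 x] 1 := fun K hK =>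
    exists_cutoff ((I.isCompact_carrier.inter_right (isClosed_tsupport ψ)).inter_right
      K.isClosed_closed) K.isOpen_inner (hC K hK)
  choose! χ hχ hχ1 using hex
  have hel : ∀ K ∈ T.sideElems I i, K ∈ T.elems := fun K hK => ((T.mem_sideElems I).1 hK).1
  have htest : ∀ K ∈ T.sideElems I i, IsTestFunction K.inner fun x => ψ x * χ K x :=
    fun K hK => ⟨hψ.mul (hχ K (hel K hK)).1, (hχ K (hel K hK)).2.1.mul_left,
      (tsupport_mul_subset_right).trans (hχ K (hel K hK)).2.2⟩
  -- The localized pieces `ψ * χ K` have no defect, and the remainder `ψ - ∑ ψ * χ K` vanishes near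
  -- Γ.
  have h1 := greenDefect_sub_sum hT hv i k hψ (χ := fun K x => ψ x * χ K x) (T.sideElems I i)
    fun K hK => (htest K hK).1
  rw [Finset.sum_eq_zero fun K hK => greenDefect_eq_zero_of_test hv k hK (htest K hK),
    sub_zero] at h1
  rw [← h1]
  refine greenDefect_eq_zero_of_eventuallyEq_zero hv i k
    (hψ.sub (ContDiff.sum fun K hK => (htest K hK).1)) fun x hx => ?_
  by_cases hxψ : x ∈ tsupport ψ
  · obtain ⟨K, hK, hxK⟩ := T.exists_mem_closed (I.carrier_subset hx)
    have hxin := hC K hK ⟨⟨hx, hxψ⟩, hxK⟩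
    have hKs := Interface.mem_sideElems_of_mem_inner hK hx hxin i
    filter_upwards [hχ1 K hK x ⟨⟨hx, hxψ⟩, hxK⟩, K.isOpen_inner.mem_nhds hxin] with y hy hyK
    rw [Finset.sum_eq_single_of_mem K hKs fun L hL hLK => ?_]
    · rw [hy]
      simp
    · have hyL : y ∉ L.inner := fun hyL =>
        (T.disjoint_inner K hK L (hel L hL) hLK.symm).le_bot ⟨hyK, hyL⟩
      rw [(hχ L (hel L hL)).eq_zero hyL, mul_zero]
  · filter_upwards [notMem_tsupport_iff_eventuallyEq.1 hxψ] with y hy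
    simp [hy]

/-- A point does not contribute to Green's formula. -/
lemma greenDefect_eq_zero_of_cutoff (i : Side) (k : Fin 2) {ψ : Plane → ℝ}
    (hψ : ContDiff ℝ ∞ ψ) (a : Plane)
    (h : ∀ β : Plane → ℝ, ContDiff ℝ ∞ β → β =ᶠ[𝓝 a] 1 →
      greenDefect I v i k (fun x => ψ x - ψ x * β x) = 0) :
    greenDefect I v i k ψ = 0 := by
  obtain ⟨b, hb, hb1⟩ := exists_cutoff (C := {(0 : Plane)}) isCompact_singleton
    (Metric.isOpen_ball (x := (0 : Plane)) (ε := 1)) (by simp)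
  have hb1' := hb1 0 rfl
  -- Cutoffs that concentrate at `a`. The gradient is of order `m + 1`, but it lives on a disc of
  -- area of order `(m + 1)⁻²`, so the volume term is of order `(m + 1)⁻¹`.
  set β : ℕ → Plane → ℝ := fun m x => b (((m : ℝ) + 1) • (x - a)) with hβ
  have hβs : ∀ m, ContDiff ℝ ∞ (β m) := fun m =>
    hb.1.comp ((contDiff_id.sub contDiff_const).const_smul _)
  have hβ1 : ∀ m, β m =ᶠ[𝓝 a] 1 := by
    intro m
    have hc : Continuous fun x : Plane => ((m : ℝ) + 1) • (x - a) := by fun_prop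
    have ht := hc.tendsto a
    rw [sub_self, smul_zero] at ht
    exact ht.eventually hb1'
  have hβd : ∀ m x, partialDeriv k (β m) x =
      ((m : ℝ) + 1) * partialDeriv k b (((m : ℝ) + 1) • (x - a)) := by
    intro m x
    have h1 : HasFDerivAt (fun x : Plane => ((m : ℝ) + 1) • (x - a))
        (((m : ℝ) + 1) • ContinuousLinearMap.id ℝ Plane) x := by
      have h0 : HasFDerivAt (fun x : Plane => x - a) (ContinuousLinearMap.id ℝ Plane) x :=
        (hasFDerivAt_id x).sub_const a
      exact h0.const_smul ((m : ℝ) + 1)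
    have h2 := ((hb.1.differentiable (by simp)
      (((m : ℝ) + 1) • (x - a))).hasFDerivAt.comp x h1).fderiv
    simp only [Function.comp_def] at h2
    simp only [partialDeriv, hβ, h2]
    simp
  have hpos : ∀ m : ℕ, (0 : ℝ) < (m : ℝ) + 1 := fun m => by positivity
  have hball : ∀ (m : ℕ) (x : Plane), x ∉ Metric.ball a (1 / ((m : ℝ) + 1)) →
      ((m : ℝ) + 1) • (x - a) ∉ Metric.ball (0 : Plane) 1 := by
    intro m x hx
    rw [mem_ball_iff_norm, not_lt, div_le_iff₀ (hpos m)] at hx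
    rw [mem_ball_zero_iff, norm_smul, Real.norm_of_nonneg (hpos m).le, not_lt, mul_comm]
    exact hx
  -- bounds
  obtain ⟨B, hB0, hB⟩ := exists_forall_norm_le hb.2.1 hb.1.continuous.continuousOn
  obtain ⟨B', hB'0, hB'⟩ := exists_forall_norm_le hb.2.1
    (contDiff_partialDeriv k hb.1).continuous.continuousOn
  have hBb : ∀ x, ‖b x‖ ≤ B := fun x => by
    by_cases hx : x ∈ tsupport b
    · exact hB x hx
    · rw [image_eq_zero_of_notMem_tsupport hx, norm_zero]
      exact hB0
  have hBb' : ∀ x, ‖partialDeriv k b x‖ ≤ B' := fun x => by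
    by_cases hx : x ∈ tsupport b
    · exact hB' x hx
    · rw [partialDeriv_eq_zero_of_notMem_tsupport k hx, norm_zero]
      exact hB'0
  obtain ⟨M, hM0, hM⟩ := exists_forall_norm_le (I.isCompact_closure_part i)
    hψ.continuous.continuousOn
  obtain ⟨M', hM'0, hM'⟩ := exists_forall_norm_le (I.isCompact_closure_part i)
    (contDiff_partialDeriv k hψ).continuous.continuousOn
  obtain ⟨V, hV0, hV⟩ := exists_bound hv i
  obtain ⟨V', hV'0, hV'⟩ := exists_bound_partialDeriv hv i k
  have hψβ : ∀ m, ContDiff ℝ ∞ fun x => ψ x * β m x := fun m => hψ.mul (hβs m)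
  -- the integral over the part
  have hlim1 : Tendsto (fun m => ∫ x in I.part i,
      (partialDeriv k (fun x => ψ x * β m x) x * v i x +
        (ψ x * β m x) * partialDeriv k (v i) x)) atTop (𝓝 0) := by
    set A := (M' * B + M * B') * V + M * B * V' with hA
    have hest : ∀ m, ‖∫ x in I.part i, (partialDeriv k (fun x => ψ x * β m x) x * v i x +
        (ψ x * β m x) * partialDeriv k (v i) x)‖ ≤
          A * volume.real (Metric.ball (0 : Plane) 1) * (1 / ((m : ℝ) + 1)) := by
      intro m
      set S := I.part i ∩ Metric.ball a (1 / ((m : ℝ) + 1)) with hS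
      have hS1 : ∫ x in I.part i, (partialDeriv k (fun x => ψ x * β m x) x * v i x +
          (ψ x * β m x) * partialDeriv k (v i) x) =
          ∫ x in S, (partialDeriv k (fun x => ψ x * β m x) x * v i x +
            (ψ x * β m x) * partialDeriv k (v i) x) := by
        refine setIntegral_eq_of_subset_of_forall_sdiff_eq_zero (I.isOpen_part i).measurableSet
          inter_subset_left fun x hx => ?_
        have hx' := hball m x fun h => hx.2 ⟨hx.1, h⟩
        rw [partialDeriv_mul k (hψ.differentiable (by simp) x)
          ((hβs m).differentiable (by simp) x), hβd, (hb.partialDeriv k).eq_zero hx']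
        simp only [hβ, hb.eq_zero hx']
        simp
      have hSfin : volume S < ⊤ :=
        (measure_mono inter_subset_right).trans_lt Metric.isBounded_ball.measure_lt_top
      have hSb : ∀ᵐ x ∂(volume.restrict S), ‖partialDeriv k (fun x => ψ x * β m x) x * v i x +
          (ψ x * β m x) * partialDeriv k (v i) x‖ ≤ A * ((m : ℝ) + 1) := by
        filter_upwards [ae_restrict_of_ae_restrict_of_subset inter_subset_left hV',
          ae_restrict_mem ((I.isOpen_part i).inter Metric.isOpen_ball).measurableSet] with x hx hxS
        have hxcl := subset_closure hxS.1
        have e1 := hM x hxcl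
        have e2 := hM' x hxcl
        have e3 := hV x hxcl
        have e4 := hBb (((m : ℝ) + 1) • (x - a))
        have e5 := hBb' (((m : ℝ) + 1) • (x - a))
        have hm1 : (1 : ℝ) ≤ (m : ℝ) + 1 := by simp
        rw [partialDeriv_mul k (hψ.differentiable (by simp) x)
          ((hβs m).differentiable (by simp) x), hβd]
        calc _ ≤ ‖(partialDeriv k ψ x * β m x +
              ψ x * (((m : ℝ) + 1) * partialDeriv k b (((m : ℝ) + 1) • (x - a)))) * v i x‖ +
              ‖ψ x * β m x * partialDeriv k (v i) x‖ := norm_add_le _ _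
          _ ≤ (‖partialDeriv k ψ x‖ * ‖β m x‖ + ‖ψ x‖ * (((m : ℝ) + 1) *
              ‖partialDeriv k b (((m : ℝ) + 1) • (x - a))‖)) * ‖v i x‖ +
              ‖ψ x‖ * ‖β m x‖ * ‖partialDeriv k (v i) x‖ := by
            rw [norm_mul, norm_mul, norm_mul]
            gcongr
            refine (norm_add_le _ _).trans (le_of_eq ?_)
            rw [norm_mul, norm_mul, norm_mul, Real.norm_of_nonneg (hpos m).le]
          _ ≤ (M' * B + M * (((m : ℝ) + 1) * B')) * V + M * B * V' := by
            gcongr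
          -- Terms without a derivative of the cutoff are enlarged by the factor `m + 1 ≥ 1` to
          -- share a common bound.
          _ ≤ (M' * (B * ((m : ℝ) + 1)) + M * (((m : ℝ) + 1) * B')) * V +
              M * (B * ((m : ℝ) + 1)) * V' := by
            have : B ≤ B * ((m : ℝ) + 1) := le_mul_of_one_le_right hB0 hm1
            gcongr
          _ = A * ((m : ℝ) + 1) := by
            rw [hA]
            ring
      rw [hS1]
      refine (norm_setIntegral_le_of_norm_le_const_ae hSfin hSb).trans ?_
      have hA0 : 0 ≤ A := by positivity
      have hvol : volume.real S ≤
          (1 / ((m : ℝ) + 1)) ^ 2 * volume.real (Metric.ball (0 : Plane) 1) := by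
        refine (measureReal_mono inter_subset_right
          Metric.isBounded_ball.measure_lt_top.ne).trans (le_of_eq ?_)
        rw [measureReal_def, measureReal_def, Measure.addHaar_ball volume a (by positivity),
          ENNReal.toReal_mul, ENNReal.toReal_ofReal (by positivity), finrank_euclideanSpace_fin]
      calc A * ((m : ℝ) + 1) * volume.real S ≤ A * ((m : ℝ) + 1) *
            ((1 / ((m : ℝ) + 1)) ^ 2 * volume.real (Metric.ball (0 : Plane) 1)) := by gcongr
        _ = _ := by
          have := (hpos m).ne'
          field_simp
    refine squeeze_zero_norm hest ?_
    simpa using tendsto_one_div_add_atTop_nhds_zero_nat.const_mul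
      (A * volume.real (Metric.ball (0 : Plane) 1))
  -- the integral over the interface
  have hlim2 : Tendsto (fun m => ∫ x, (ψ x * β m x) * (v i x * I.normal x k) ∂I.arcLength)
      atTop (𝓝 0) := by
    -- Dominated convergence: the cutoffs tend to zero off `a`, and the point `a` is null for arc
    -- length.
    have hn := memLp_mul_normal_discrete hT hv i k
    have h1 := tendsto_integral_of_dominated_convergence
      (μ := I.arcLength) (F := fun m x => (ψ x * β m x) * (v i x * I.normal x k))
      (f := fun _ => 0) (fun x => B * ‖ψ x * (v i x * I.normal x k)‖)
      (fun m => (hψβ m).continuous.aestronglyMeasurable.mul hn.1)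
      (((memLp_arcLength_of_continuous hψ.continuous).integrable_mul hn).norm.const_mul B)
      (fun m => Eventually.of_forall fun x => ?_) ?_
    · simpa using h1
    · rw [show ψ x * β m x * (v i x * I.normal x k) =
        β m x * (ψ x * (v i x * I.normal x k)) by ring, norm_mul]
      exact mul_le_mul_of_nonneg_right (hBb _) (norm_nonneg _)
    · have ha : ∀ᵐ x ∂I.arcLength, x ≠ a := by
        rw [ae_iff]
        simp
      filter_upwards [ha] with x hx
      have h2 : Tendsto (fun m : ℕ => ((m : ℝ) + 1) * ‖x - a‖) atTop atTop :=
        (tendsto_atTop_add_const_right _ _ tendsto_natCast_atTop_atTop).atTop_mul_const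
          (norm_pos_iff.2 (sub_ne_zero.2 hx))
      refine tendsto_const_nhds.congr' ?_
      filter_upwards [h2.eventually_ge_atTop 1] with m hm
      have h3 : ((m : ℝ) + 1) • (x - a) ∉ Metric.ball (0 : Plane) 1 := by
        rw [mem_ball_zero_iff, norm_smul, Real.norm_of_nonneg (hpos m).le, not_lt]
        exact hm
      simp only [hβ, hb.eq_zero h3]
      simp
  -- By hypothesis `ψ - ψ * β m` has no defect, so the defect of `ψ` equals that of `ψ * β m` for
  -- every `m`, which tends to zero.
  have hconst : ∀ m, greenDefect I v i k ψ = greenDefect I v i k (fun x => ψ x * β m x) := by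
    intro m
    have h1 := greenDefect_sub hT hv i k hψ (hψβ m)
    rw [h (β m) (hβs m) (hβ1 m)] at h1
    exact (sub_eq_zero.1 h1.symm)
  have hlim := hlim1.add (hlim2.const_mul (sgn i))
  rw [mul_zero, add_zero] at hlim
  exact tendsto_nhds_unique (tendsto_const_nhds.congr hconst) hlim

/-- Green's formula for a smooth function and a discrete function that vanishes on `∂Ω`. -/
theorem greenDefect_eq_zero (i : Side) (k : Fin 2) {ψ : Plane → ℝ} (hψ : ContDiff ℝ ∞ ψ) :
    greenDefect I v i k ψ = 0 := by
  classical
  -- Induction on the set `S` of exceptional points near which `ψ` need not vanish: each step cuts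
  -- one of them out.
  have key : ∀ (S : Finset Plane) (ψ : Plane → ℝ), ContDiff ℝ ∞ ψ →
      (∀ K ∈ T.elems, ∀ x ∈ I.carrier ∩ K.bdry, x ∉ S → ψ =ᶠ[𝓝 x] 0) →
      greenDefect I v i k ψ = 0 := by
    intro S
    induction S using Finset.induction_on with
    | empty =>
      intro ψ hψ h
      exact greenDefect_eq_zero_of_skeleton hT hv i k hψ fun K hK x hx => h K hK x hx (by simp)
    | insert a S _ ih =>
      intro ψ hψ h
      refine greenDefect_eq_zero_of_cutoff hT hv i k hψ a fun β hβ hβ1 => ?_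
      refine ih _ (hψ.sub (hψ.mul hβ)) fun K hK x hx hxS => ?_
      by_cases hxa : x = a
      · subst hxa
        filter_upwards [hβ1] with y hy
        simp [hy]
      · filter_upwards [h K hK x hx (by simp [hxa, hxS])] with y hy
        simp [hy]
  have hfin : (⋃ K ∈ T.elems, I.carrier ∩ K.bdry).Finite :=
    T.elems.finite_toSet.biUnion hT
  refine key hfin.toFinset ψ hψ fun K hK x hx hxS => absurd ?_ hxS
  rw [Set.Finite.mem_toFinset]
  exact mem_biUnion hK hx

/-- Green's formula for an `H¹` function with trace `g` and a discrete function that vanishes on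
`∂Ω`. -/
theorem integral_weakPartial_mul (i : Side) (k : Fin 2) {X g : Plane → ℝ}
    (hX : IsTrace (I.part i) I.arcLength X g) :
    (∫ x in I.part i, weakPartial (I.part i) k X x * v i x) +
      (∫ x in I.part i, X x * partialDeriv k (v i) x) =
        - (sgn i * ∫ x, g x * (v i x * I.normal x k) ∂I.arcLength) := by
  obtain ⟨hw, hg, ψ, hψ, h1, h2, h3⟩ := hX
  -- Each term of Green's formula is continuous under the convergences that define a trace, so the
  -- smooth case passes to the limit.
  have l1 := tendsto_integral_mul
    (fun m => memLp_part_of_continuous i (contDiff_partialDeriv k (hψ m)).continuous)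
    (hw.memLp_weakPartial (I.isOpen_part i) k) (memLp_discrete hv i) (h2 k)
  have l2 := tendsto_integral_mul
    (fun m => memLp_part_of_continuous i (hψ m).continuous) hw.memLp
    (memLp_partialDeriv_discrete hv i k) h1
  have l3 := tendsto_integral_mul
    (fun m => memLp_arcLength_of_continuous (hψ m).continuous) hg
    (memLp_mul_normal_discrete hT hv i k) h3
  refine tendsto_nhds_unique ((l1.add l2).congr fun m => ?_) (l3.const_mul (sgn i)).neg
  have h4 := greenDefect_eq_zero hT hv i k (hψ m)
  rw [greenDefect, integral_add] at h4
  · exact eq_neg_of_add_eq_zero_left h4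
  · exact (memLp_part_of_continuous i (contDiff_partialDeriv k (hψ m)).continuous).integrable_mul
      (memLp_discrete hv i)
  · exact (memLp_part_of_continuous i (hψ m).continuous).integrable_mul
      (memLp_partialDeriv_discrete hv i k)

end Green

section Consistency

variable {Q : Rect} {T : Mesh Q} {I : Interface Q} {p : ℕ} {v w w' : Side → Plane → ℝ}
  {K : Rect} {α : Side → ℝ}

/-! ### Functions with traces on the pieces of the interface -/

/-- The traces in the definition of the forms exist on `Γ_K`. -/
structure HasTraces {Q : Rect} (I : Interface Q) (K : Rect) (w : Side → Plane → ℝ) : Prop where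
  memSobolev : ∀ i, MemSobolev (I.part i) 1 (w i)
  exists_trace : ∀ i, ∃ g,
    IsTrace (K.inner ∩ I.part i) (I.arcLength.restrict K.closed) (w i) g
  exists_trace_deriv : ∀ i k, ∃ g, IsTrace (K.inner ∩ I.part i) (I.arcLength.restrict K.closed)
    (weakPartial (I.part i) k (w i)) g

namespace HasTraces

lemma memLp_traceOn (h : HasTraces I K w) (i : Side) :
    MemLp (traceOn I K i (w i)) 2 (I.arcLength.restrict K.closed) :=
  (h.exists_trace i).choose_spec.isTrace_trace.2.1

lemma memLp_normalDer (h : HasTraces I K w) (i : Side) :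
    MemLp (normalDer I K i w) 2 (I.arcLength.restrict K.closed) :=
  memLp_finsetSum _ fun k _ => I.memLp_mul_normal Measure.restrict_le_self
    (h.exists_trace_deriv i k).choose_spec.isTrace_trace.2.1 k

lemma memLp_jump (h : HasTraces I K w) :
    MemLp (jump I K w) 2 (I.arcLength.restrict K.closed) :=
  (h.memLp_traceOn plus).sub (h.memLp_traceOn minus)

lemma memLp_avgFlux (h : HasTraces I K w) :
    MemLp (avgFlux I α K w) 2 (I.arcLength.restrict K.closed) :=
  memLp_finsetSum _ fun i _ => ((h.memLp_normalDer i).const_mul (α i)).const_mul _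

variable (hT : ∀ K ∈ T.elems, (I.carrier ∩ K.bdry).Finite) (hK : K ∈ T.elems)

include hT hK

/-- A representative is chosen for each function separately, so additivity comes from the uniqueness
of traces. -/
lemma traceOn_sub (h : HasTraces I K w) (h' : HasTraces I K w') (i : Side) :
    traceOn I K i (w i - w' i) =ᵐ[I.arcLength.restrict K.closed]
      traceOn I K i (w i) - traceOn I K i (w' i) :=
  Interface.traceOn_ae_eq hT hK ((h.exists_trace i).choose_spec.isTrace_trace.sub
    (I.isOpen_cut i) (h'.exists_trace i).choose_spec.isTrace_trace)

lemma traceOn_deriv_sub (h : HasTraces I K w) (h' : HasTraces I K w') (i : Side) (k : Fin 2) :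
    traceOn I K i (weakPartial (I.part i) k (w i - w' i)) =ᵐ[I.arcLength.restrict K.closed]
      traceOn I K i (weakPartial (I.part i) k (w i)) -
        traceOn I K i (weakPartial (I.part i) k (w' i)) := by
  refine Interface.traceOn_ae_eq hT hK (((h.exists_trace_deriv i k).choose_spec.isTrace_trace.sub
    (I.isOpen_cut i) (h'.exists_trace_deriv i k).choose_spec.isTrace_trace).congr
    (I.isOpen_cut i) ?_)
  exact ae_restrict_of_ae_restrict_of_subset inter_subset_right
    (weakPartial_sub_ae_eq (I.isOpen_part i) (h.memSobolev i) (h'.memSobolev i) k).symm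

lemma jump_sub (h : HasTraces I K w) (h' : HasTraces I K w') :
    jump I K (w - w') =ᵐ[I.arcLength.restrict K.closed] jump I K w - jump I K w' := by
  filter_upwards [traceOn_sub hT hK h h' plus, traceOn_sub hT hK h h' minus] with x h1 h2
  simp only [jump, h1, h2, Pi.sub_apply]
  ring

lemma avgFlux_sub (h : HasTraces I K w) (h' : HasTraces I K w') :
    avgFlux I α K (w - w') =ᵐ[I.arcLength.restrict K.closed]
      avgFlux I α K w - avgFlux I α K w' := by
  have h0 : ∀ᵐ x ∂(I.arcLength.restrict K.closed), ∀ i k,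
      traceOn I K i (weakPartial (I.part i) k (w i - w' i)) x =
      (traceOn I K i (weakPartial (I.part i) k (w i)) -
        traceOn I K i (weakPartial (I.part i) k (w' i))) x := by
    rw [ae_all_iff]
    intro i
    rw [ae_all_iff]
    intro k
    exact traceOn_deriv_sub hT hK h h' i k
  filter_upwards [h0] with x hx
  simp only [avgFlux, normalDer, hx, Pi.sub_apply, sub_mul, Finset.sum_sub_distrib, mul_sub]

end HasTraces

variable (hT : ∀ K ∈ T.elems, (I.carrier ∩ K.bdry).Finite)

include hT

/-! ### Linearity of the form -/

/-- Splitting each integral requires integrability. The existence of traces provides it on Γ, and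
membership in $H^1$ in the volume. -/
theorem aForm_sub (hw : ∀ K ∈ T.elems, HasTraces I K w) (hw' : ∀ K ∈ T.elems, HasTraces I K w')
    (hv : ∀ K ∈ T.elems, HasTraces I K v) (hwS : ∀ i, MemSobolev (I.part i) 1 (w i))
    (hwS' : ∀ i, MemSobolev (I.part i) 1 (w' i)) (hvS : ∀ i, MemSobolev (I.part i) 1 (v i)) :
    aForm I α T p (w - w') v = aForm I α T p w v - aForm I α T p w' v := by
  have hel : ∀ K ∈ T.interfaceElems I, K ∈ T.elems := fun K hK =>
    ((T.mem_interfaceElems I).1 hK).1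
  have e1 : (∑ i, ∫ x in I.part i, ∑ k,
      α i * weakPartial (I.part i) k ((w - w') i) x * weakPartial (I.part i) k (v i) x) =
      (∑ i, ∫ x in I.part i, ∑ k,
        α i * weakPartial (I.part i) k (w i) x * weakPartial (I.part i) k (v i) x) -
      ∑ i, ∫ x in I.part i, ∑ k,
        α i * weakPartial (I.part i) k (w' i) x * weakPartial (I.part i) k (v i) x := by
    rw [← Finset.sum_sub_distrib]
    refine Finset.sum_congr rfl fun i _ => ?_
    have hint : ∀ z : Plane → ℝ, MemSobolev (I.part i) 1 z → Integrable (fun x => ∑ k,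
        α i * weakPartial (I.part i) k z x * weakPartial (I.part i) k (v i) x)
        (volume.restrict (I.part i)) := fun z hz =>
      integrable_finsetSum _ fun k _ =>
        ((hz.memLp_weakPartial (I.isOpen_part i) k).const_mul (α i)).integrable_mul
          ((hvS i).memLp_weakPartial (I.isOpen_part i) k)
    rw [← integral_sub (hint _ (hwS i)) (hint _ (hwS' i))]
    have h0 : ∀ᵐ x ∂(volume.restrict (I.part i)), ∀ k,
        weakPartial (I.part i) k (w i - w' i) x =
          (weakPartial (I.part i) k (w i) - weakPartial (I.part i) k (w' i)) x := by
      rw [ae_all_iff]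
      exact fun k => weakPartial_sub_ae_eq (I.isOpen_part i) (hwS i) (hwS' i) k
    refine integral_congr_ae ?_
    filter_upwards [h0] with x hx
    simp only [hx, Pi.sub_apply, mul_sub, sub_mul, Finset.sum_sub_distrib]
  have e2 : (∑ K ∈ T.interfaceElems I,
      ∫ x in K.closed, jump I K (w - w') x * avgFlux I α K v x ∂I.arcLength) =
      (∑ K ∈ T.interfaceElems I,
        ∫ x in K.closed, jump I K w x * avgFlux I α K v x ∂I.arcLength) -
      ∑ K ∈ T.interfaceElems I,
        ∫ x in K.closed, jump I K w' x * avgFlux I α K v x ∂I.arcLength := by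
    rw [← Finset.sum_sub_distrib]
    refine Finset.sum_congr rfl fun K hK => ?_
    have hK' := hel K hK
    rw [← integral_sub (f := fun x => jump I K w x * avgFlux I α K v x)
      (g := fun x => jump I K w' x * avgFlux I α K v x)
      ((hw K hK').memLp_jump.integrable_mul (hv K hK').memLp_avgFlux)
      ((hw' K hK').memLp_jump.integrable_mul (hv K hK').memLp_avgFlux)]
    refine integral_congr_ae ?_
    filter_upwards [(hw K hK').jump_sub hT hK' (hw' K hK')] with x hx
    simp only [hx, Pi.sub_apply, sub_mul]
  have e3 : (∑ K ∈ T.interfaceElems I,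
      ∫ x in K.closed, avgFlux I α K (w - w') x * jump I K v x ∂I.arcLength) =
      (∑ K ∈ T.interfaceElems I,
        ∫ x in K.closed, avgFlux I α K w x * jump I K v x ∂I.arcLength) -
      ∑ K ∈ T.interfaceElems I,
        ∫ x in K.closed, avgFlux I α K w' x * jump I K v x ∂I.arcLength := by
    rw [← Finset.sum_sub_distrib]
    refine Finset.sum_congr rfl fun K hK => ?_
    have hK' := hel K hK
    rw [← integral_sub (f := fun x => avgFlux I α K w x * jump I K v x)
      (g := fun x => avgFlux I α K w' x * jump I K v x)
      ((hw K hK').memLp_avgFlux.integrable_mul (hv K hK').memLp_jump)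
      ((hw' K hK').memLp_avgFlux.integrable_mul (hv K hK').memLp_jump)]
    refine integral_congr_ae ?_
    filter_upwards [(hw K hK').avgFlux_sub (α := α) hT hK' (hw' K hK')] with x hx
    simp only [hx, Pi.sub_apply, sub_mul]
  have e4 : (∑ K ∈ T.interfaceElems I, ∫ x in K.closed,
        gammaPen I α K * jump I K (w - w') x * jump I K v x ∂I.arcLength) =
      (∑ K ∈ T.interfaceElems I, ∫ x in K.closed,
        gammaPen I α K * jump I K w x * jump I K v x ∂I.arcLength) -
      ∑ K ∈ T.interfaceElems I, ∫ x in K.closed,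
        gammaPen I α K * jump I K w' x * jump I K v x ∂I.arcLength := by
    rw [← Finset.sum_sub_distrib]
    refine Finset.sum_congr rfl fun K hK => ?_
    have hK' := hel K hK
    rw [← integral_sub (f := fun x => gammaPen I α K * jump I K w x * jump I K v x)
      (g := fun x => gammaPen I α K * jump I K w' x * jump I K v x)
      (((hw K hK').memLp_jump.const_mul _).integrable_mul (hv K hK').memLp_jump)
      (((hw' K hK').memLp_jump.const_mul _).integrable_mul (hv K hK').memLp_jump)]
    refine integral_congr_ae ?_
    filter_upwards [(hw K hK').jump_sub hT hK' (hw' K hK')] with x hx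
    simp only [hx, Pi.sub_apply, sub_mul, mul_sub]
  simp only [aForm]
  rw [e1, e2, e3, e4]
  ring

/-! ### Traces of discrete functions -/

/-- On a cut cell a discrete function is a polynomial, which is its own trace. If $K$ does not meet
the part `i`, the cut cell is empty and no point of Γ lies inside $K$, so both claims are void up to
null sets. -/
lemma exists_isTrace_discrete (hv : v ∈ discreteSpace₀ T I p) (hK : K ∈ T.elems) (i : Side) :
    ∃ q : Plane → ℝ, q =ᵐ[I.arcLength.restrict K.closed] v i ∧
      IsTrace (K.inner ∩ I.part i) (I.arcLength.restrict K.closed) (v i) q ∧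
      ∀ k, IsTrace (K.inner ∩ I.part i) (I.arcLength.restrict K.closed)
        (weakPartial (I.part i) k (v i)) (partialDeriv k q) := by
  obtain ⟨q, hq, hqv⟩ := exists_polynomials hv i
  have hD := I.isOpen_cut (K := K) i
  have hDK : K.inner ∩ I.part i ⊆ K.closed := inter_subset_left.trans K.inner_subset_closed
  have hDside : ∀ x ∈ K.inner ∩ I.part i, K ∈ T.sideElems I i := fun x hx =>
    (T.mem_sideElems I).2 ⟨hK, x, K.inner_subset_closed hx.1, hx.2⟩
  have hm : ∀ {z : Plane → ℝ}, Continuous z → MemLp z 2 (I.arcLength.restrict K.closed) :=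
    fun hz => memLp_of_continuous K.isCompact_closed I.ae_restrict_mem_closed hz
  have hac : I.arcLength.restrict K.closed ≪ I.arcLength :=
    Measure.restrict_le_self.absolutelyContinuous
  refine ⟨q K, ?_, ?_, fun k => ?_⟩
  · filter_upwards [I.ae_restrict_mem_closed, hac.ae_le (I.ae_mem_inner hT),
      hac.ae_le I.ae_mem_carrier] with x hxK hxin hxc
    exact (hqv K (Interface.mem_sideElems_of_mem_inner hK hxc (hxin K hK hxK) i) hxK).symm
  · refine (isTrace_of_contDiff K.isCompact_closed hDK hD (hq K) (hm (hq K).continuous)).congr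
      hD ?_
    filter_upwards [ae_restrict_mem hD.measurableSet] with x hx
    exact (hqv K (hDside x hx) (hDK hx)).symm
  · have hq' := contDiff_partialDeriv k (hq K)
    refine (isTrace_of_contDiff K.isCompact_closed hDK hD hq' (hm hq'.continuous)).congr hD ?_
    filter_upwards [ae_restrict_mem hD.measurableSet, ae_restrict_of_ae_restrict_of_subset
      inter_subset_right (weakPartial_discrete_ae_eq hv i k)] with x hx hx'
    rw [hx', partialDeriv_congr k (eventuallyEq_of_mem_inner hqv (hDside x hx) hx.1)]

lemma hasTraces_discrete (hv : v ∈ discreteSpace₀ T I p) (hK : K ∈ T.elems) :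
    HasTraces I K v := by
  refine ⟨memSobolev_discrete hv, fun i => ?_, fun i k => ?_⟩
  · obtain ⟨q, _, h, _⟩ := exists_isTrace_discrete hT hv hK i
    exact ⟨q, h⟩
  · obtain ⟨q, _, _, h⟩ := exists_isTrace_discrete hT hv hK i
    exact ⟨_, h k⟩

lemma jump_discrete_ae_eq (hv : v ∈ discreteSpace₀ T I p) (hK : K ∈ T.elems) :
    jump I K v =ᵐ[I.arcLength.restrict K.closed] v plus - v minus := by
  obtain ⟨q, hq, h, _⟩ := exists_isTrace_discrete hT hv hK plus
  obtain ⟨q', hq', h', _⟩ := exists_isTrace_discrete hT hv hK minus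
  filter_upwards [hq, hq', Interface.traceOn_ae_eq hT hK h,
    Interface.traceOn_ae_eq hT hK h'] with x h1 h2 h3 h4
  simp only [jump, h3, h4, h1, h2, Pi.sub_apply]

/-- Elements overlap only in their boundaries, which carry no arc length of Γ. -/
lemma sum_integral_interfaceElems {G : Plane → ℝ} (hG : Integrable G I.arcLength) :
    ∑ K ∈ T.interfaceElems I, ∫ x in K.closed, G x ∂I.arcLength = ∫ x, G x ∂I.arcLength := by
  have hel : ∀ K ∈ T.interfaceElems I, K ∈ T.elems := fun K hK =>
    ((T.mem_interfaceElems I).1 hK).1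
  have h1 : ∀ K ∈ T.interfaceElems I, ∫ x in K.closed, G x ∂I.arcLength =
      ∫ x in K.inner, G x ∂I.arcLength := by
    intro K hK
    refine setIntegral_congr_set ?_
    filter_upwards [I.ae_mem_inner hT] with x hx
    exact propext ⟨hx K (hel K hK), fun h => K.inner_subset_closed h⟩
  rw [Finset.sum_congr rfl h1, ← integral_biUnion_finset _
    (fun K _ => K.isOpen_inner.measurableSet)
    (fun K hK L hL hKL => T.disjoint_inner K (hel K hK) L (hel L hL) hKL)
    (fun K _ => hG.integrableOn), Measure.restrict_eq_self_of_ae_mem]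
  filter_upwards [I.ae_mem_inner hT, I.ae_mem_carrier] with x hx hxc
  obtain ⟨K, hK, hxK⟩ := T.exists_mem_closed (I.carrier_subset hxc)
  exact mem_biUnion ((T.mem_interfaceElems I).2 ⟨hK, x, hxK, hxc⟩) (hx K hK hxK)

omit hT

/-! ### The weights -/

/-- A smooth curve has dense complement in the plane, so the open element contains a point off Γ,
and with it a disc in one of the parts. -/
lemma exists_cutArea_pos (hK : K ∈ T.elems) : ∃ i, 0 < cutArea I K i := by
  have hd : Dense (range I.curve)ᶜ := by
    refine ContDiff.dense_compl_range_of_finrank_lt_finrank (I.smooth.of_le (by simp)) ?_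
    simp
  obtain ⟨x, hxK, hx⟩ := hd.inter_open_nonempty _ K.isOpen_inner K.inner_nonempty
  have hx' : x ∈ I.part plus ∪ I.part minus := by
    rw [I.part_union]
    refine ⟨T.inner_subset hK hxK, fun h => hx (image_subset_range _ _ h)⟩
  have key : ∀ i, x ∈ I.part i → 0 < cutArea I K i := by
    intro i hxi
    have h1 : 0 < volume (K.inner ∩ I.part i) :=
      (I.isOpen_cut i).measure_pos volume ⟨x, hxK, hxi⟩
    have h2 : volume (K.inner ∩ I.part i) ≤ volume (K.closed ∩ I.part i) :=
      measure_mono (inter_subset_inter_left _ K.inner_subset_closed)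
    exact ENNReal.toReal_pos (h1.trans_le h2).ne'
      ((measure_mono inter_subset_left).trans_lt K.isCompact_closed.measure_lt_top).ne
  rcases hx' with h | h
  exacts [⟨_, key _ h⟩, ⟨_, key _ h⟩]

/-- The common denominator has to be nonzero: with division by zero equal to zero, the weights would
otherwise sum to 0. -/
lemma kappa_add (hα : ∀ i, 0 < α i) (hK : K ∈ T.elems) :
    kappa I α K plus + kappa I α K minus = 1 := by
  have hnn : ∀ i, 0 ≤ cutArea I K i := fun i => measureReal_nonneg
  have hne : α minus * cutArea I K plus + α plus * cutArea I K minus ≠ 0 := by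
    obtain ⟨i, hi⟩ := exists_cutArea_pos (I := I) hK
    have h1 := mul_nonneg (hα minus).le (hnn plus)
    have h2 := mul_nonneg (hα plus).le (hnn minus)
    cases i
    · have h3 := mul_pos (hα plus) hi
      exact (add_pos_of_nonneg_of_pos h1 h3).ne'
    · have h3 := mul_pos (hα minus) hi
      exact (add_pos_of_pos_of_nonneg h3 h2).ne'
  simp only [kappa, Bool.not_true, Bool.not_false]
  rw [← add_div]
  exact div_self hne

include hT

/-! ### Consistency -/

/-- The form is consistent: the exact solution solves the unperturbed discrete problem. -/
theorem aForm_eq_loadForm (hα : ∀ i, 0 < α i) {f : Plane → ℝ} {u : Side → Plane → ℝ}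
    (hu : ∀ i, MemSobolev (I.part i) 1 (u i)) (hsol : SolvesInterfaceProblem I α f u)
    (hv : v ∈ discreteSpace₀ T I p) :
    (∀ K ∈ T.elems, HasTraces I K u) ∧ aForm I α T p u v = loadForm I f v := by
  obtain ⟨hpde, ⟨g, hg, hgj⟩, ⟨q, hq, hqj⟩⟩ := hsol
  have hmono : ∀ (K : Rect) i {z z' : Plane → ℝ}, IsTrace (I.part i) I.arcLength z z' →
      IsTrace (K.inner ∩ I.part i) (I.arcLength.restrict K.closed) z z' := fun K i z z' h =>
    h.mono (I.isOpen_part i) (I.isOpen_cut i) inter_subset_right Measure.restrict_le_self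
  refine ⟨fun K _ => ⟨hu, fun i => ⟨_, hmono K i (hg i)⟩, fun i k => ⟨_, hmono K i (hq i k)⟩⟩, ?_⟩
  have hel : ∀ K ∈ T.interfaceElems I, K ∈ T.elems := fun K hK =>
    ((T.mem_interfaceElems I).1 hK).1
  have hac : ∀ K : Rect, I.arcLength.restrict K.closed ≪ I.arcLength := fun K =>
    Measure.restrict_le_self.absolutelyContinuous
  have hjump : ∀ K ∈ T.interfaceElems I, jump I K u =ᵐ[I.arcLength.restrict K.closed] 0 := by
    intro K hK
    filter_upwards [Interface.traceOn_ae_eq hT (hel K hK) (hmono K plus (hg plus)),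
      Interface.traceOn_ae_eq hT (hel K hK) (hmono K minus (hg minus)),
      (hac K).ae_le hgj] with x h1 h2 h3
    simp only [jump, h1, h2, h3, Pi.zero_apply]
  set F : Side → Plane → ℝ := fun i x => α i * ∑ k, q i k x * I.normal x k with hF
  have hFm : ∀ i, MemLp (F i) 2 I.arcLength := fun i =>
    (memLp_finsetSum _ fun k _ => I.memLp_mul_normal le_rfl (hq i k).2.1 k).const_mul _
  -- The fluxes from the two sides agree, so any average with weights of sum 1 is the common flux.
  have hflux : ∀ K ∈ T.interfaceElems I,
      avgFlux I α K u =ᵐ[I.arcLength.restrict K.closed] F plus := by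
    intro K hK
    have h0 : ∀ᵐ x ∂(I.arcLength.restrict K.closed), ∀ i k,
        traceOn I K i (weakPartial (I.part i) k (u i)) x = q i k x := by
      rw [ae_all_iff]
      intro i
      rw [ae_all_iff]
      intro k
      exact Interface.traceOn_ae_eq hT (hel K hK) (hmono K i (hq i k))
    filter_upwards [h0, (hac K).ae_le hqj] with x hx hxj
    have h1 : avgFlux I α K u x =
        kappa I α K plus * F plus x + kappa I α K minus * F minus x := by
      simp only [avgFlux, normalDer, hx, hF, Fintype.sum_bool]
    have h2 : F minus x = F plus x := (sub_eq_zero.1 hxj).symm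
    rw [h1, h2, ← add_mul, kappa_add hα (hel K hK), one_mul]
  -- the four terms
  have hvs := fun i => memLp_arcLength_discrete hT hv i
  have e2 : (∑ K ∈ T.interfaceElems I,
      ∫ x in K.closed, jump I K u x * avgFlux I α K v x ∂I.arcLength) = 0 := by
    refine Finset.sum_eq_zero fun K hK => integral_eq_zero_of_ae ?_
    filter_upwards [hjump K hK] with x hx
    simp [hx]
  have e4 : (∑ K ∈ T.interfaceElems I, ∫ x in K.closed,
      gammaPen I α K * jump I K u x * jump I K v x ∂I.arcLength) = 0 := by
    refine Finset.sum_eq_zero fun K hK => integral_eq_zero_of_ae ?_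
    filter_upwards [hjump K hK] with x hx
    simp [hx]
  have hFv : ∀ i j, Integrable (fun x => F i x * v j x) I.arcLength := fun i j =>
    (hFm i).integrable_mul (hvs j)
  -- Since both fluxes agree, `F plus` times the jump of `v` can be written with each side's own
  -- flux, the shape in which Green's formula delivers the boundary terms.
  have e3 : (∑ K ∈ T.interfaceElems I,
      ∫ x in K.closed, avgFlux I α K u x * jump I K v x ∂I.arcLength) =
      (∫ x, F plus x * v plus x ∂I.arcLength) - ∫ x, F minus x * v minus x ∂I.arcLength := by
    have h1 : ∀ K ∈ T.interfaceElems I,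
        ∫ x in K.closed, avgFlux I α K u x * jump I K v x ∂I.arcLength =
        ∫ x in K.closed, (F plus x * v plus x - F minus x * v minus x) ∂I.arcLength := by
      intro K hK
      refine integral_congr_ae ?_
      filter_upwards [hflux K hK, jump_discrete_ae_eq hT hv (hel K hK), (hac K).ae_le hqj]
        with x h1 h2 h3
      have h4 : F minus x = F plus x := (sub_eq_zero.1 h3).symm
      rw [h1, h2, h4, Pi.sub_apply, mul_sub]
    rw [Finset.sum_congr rfl h1, sum_integral_interfaceElems
        (G := fun x => F plus x * v plus x - F minus x * v minus x) hT ((hFv _ _).sub (hFv _ _)),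
      integral_sub (hFv _ _) (hFv _ _)]
  have e1 : ∀ i, (∫ x in I.part i, ∑ k,
      α i * weakPartial (I.part i) k (u i) x * weakPartial (I.part i) k (v i) x) =
      (∫ x in I.part i, f x * v i x) - sgn i * ∫ x, F i x * v i x ∂I.arcLength := by
    intro i
    have hX : ∀ k, MemSobolev (I.part i) 1 (weakPartial (I.part i) k (u i)) :=
      fun k => (hq i k).1
    have hXm := fun k => (hX k).memLp
    have hXd := fun k => (hX k).memLp_weakPartial (I.isOpen_part i) k
    have h1 : (∫ x in I.part i, ∑ k,
        α i * weakPartial (I.part i) k (u i) x * weakPartial (I.part i) k (v i) x) =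
        ∑ k, α i * ∫ x in I.part i, weakPartial (I.part i) k (u i) x *
          partialDeriv k (v i) x := by
      have h0 : ∀ᵐ x ∂(volume.restrict (I.part i)), ∀ k,
          weakPartial (I.part i) k (v i) x = partialDeriv k (v i) x := by
        rw [ae_all_iff]
        exact fun k => weakPartial_discrete_ae_eq hv i k
      rw [integral_congr_ae (g := fun x => ∑ k, α i * (weakPartial (I.part i) k (u i) x *
        partialDeriv k (v i) x)), integral_finsetSum]
      · simp only [integral_const_mul]
      · exact fun k _ => ((hXm k).integrable_mul
          (memLp_partialDeriv_discrete hv i k)).const_mul _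
      · filter_upwards [h0] with x hx
        simp only [hx, mul_assoc]
    have h2 : (∫ x in I.part i, f x * v i x) =
        ∑ k, -(α i * ∫ x in I.part i, weakPartial (I.part i) k
          (weakPartial (I.part i) k (u i)) x * v i x) := by
      have h0 : ∀ᵐ x ∂(volume.restrict (I.part i)), ∀ k,
          weakPartial (I.part i) k (fun y => α i * weakPartial (I.part i) k (u i) y) x =
            α i * weakPartial (I.part i) k (weakPartial (I.part i) k (u i)) x := by
        rw [ae_all_iff]
        exact fun k => (((hX k).hasWeakPartial k).const_mul (α i)).weakPartial_ae_eq
          (I.isOpen_part i)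
      rw [integral_congr_ae (g := fun x => ∑ k, -(α i * (weakPartial (I.part i) k
        (weakPartial (I.part i) k (u i)) x * v i x))), integral_finsetSum]
      · simp only [integral_neg, integral_const_mul]
      · exact fun k _ => (((hXd k).integrable_mul (memLp_discrete hv i)).const_mul _).neg
      · filter_upwards [h0, hpde i] with x hx hxf
        simp only [← hxf, weakDiv, hx, neg_mul, Finset.sum_mul, Finset.sum_neg_distrib, mul_assoc]
    have h3 : ∫ x, F i x * v i x ∂I.arcLength =
        ∑ k, α i * ∫ x, q i k x * (v i x * I.normal x k) ∂I.arcLength := by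
      rw [integral_congr_ae (g := fun x => ∑ k, α i * (q i k x * (v i x * I.normal x k))),
        integral_finsetSum]
      · simp only [integral_const_mul]
      · exact fun k _ => ((hq i k).2.1.integrable_mul
          (memLp_mul_normal_discrete hT hv i k)).const_mul _
      · refine Eventually.of_forall fun x => ?_
        simp only [hF, Finset.mul_sum, Finset.sum_mul]
        refine Finset.sum_congr rfl fun k _ => ?_
        ring
    rw [h1, h2, h3, Finset.mul_sum, ← Finset.sum_sub_distrib]
    refine Finset.sum_congr rfl fun k _ => ?_
    have h4 := integral_weakPartial_mul hT hv i k (hq i k)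
    linear_combination α i * h4
  simp only [aForm, loadForm]
  -- The boundary terms of Green's formula on the two sides are opposite to the two integrals in
  -- `e3`.
  rw [e2, e3, e4, Finset.sum_congr rfl fun i _ => e1 i]
  simp only [Fintype.sum_bool, sgn]
  simp
  ring

end Consistency

end USEM

end

/-! ### Orthogonality of the error up to the ghost penalty. -/

theorem mainTheorem8 (Q : USEM.Rect) (I : USEM.Interface Q) (T : USEM.Mesh Q)
    (hT : ∀ K ∈ T.elems, (I.carrier ∩ K.bdry).Finite)
    (α : USEM.Side → ℝ) (α₀ : ℝ) (hα₀ : 0 < α₀) (hα : ∀ i, α₀ ≤ α i)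
    (p : ℕ) (hp : 1 ≤ p) (γA : ℝ) (f : USEM.Plane → ℝ)
    (u : USEM.Side → USEM.Plane → ℝ)
    (hu : ∀ i, USEM.MemSobolev (I.part i) (p + 1) (u i))
    (hsol : USEM.SolvesInterfaceProblem I α f u)
    (uh : USEM.Side → USEM.Plane → ℝ)
    (huh : USEM.IsDiscreteSolution I α T p γA f uh) :
    ∀ v ∈ USEM.discreteSpace₀ T I p,
      USEM.aForm I α T p (u - uh) v = γA / T.h ^ 2 * USEM.ghostForm I T p uh v := by
  intro v hv
  have hu1 := fun i => (hu i).succ_imp_one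
  obtain ⟨htr, hcons⟩ := USEM.aForm_eq_loadForm (p := p) hT (fun i => hα₀.trans_le (hα i))
    hu1 hsol hv
  -- By consistency $a(u,v)=l(v)$, and $l(v)$ is replaced by the extended form at the discrete
  -- solution, whose part $a(u_h,v)$ cancels.
  rw [USEM.aForm_sub hT htr (fun K hK => USEM.hasTraces_discrete hT huh.1 hK)
    (fun K hK => USEM.hasTraces_discrete hT hv hK) hu1 (USEM.memSobolev_discrete huh.1)
    (USEM.memSobolev_discrete hv), hcons, ← huh.2 v hv, USEM.extForm]
  ring
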